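/- Let $n\ge 2$, let $\overline M$ be a smooth compact manifold with boundary of dimension $n+1$ each of whose connected components has nonempty boundary, and let $M$ be its interior. Let $g$ be a conformally compact metric on $M$: $g=\rho^{-2}\overline g$, where $\rho\ge 0$ is a $C^3$ function on $\overline M$ which vanishes exactly on $\partial\overline M$ and has $d\rho\neq 0$ there, and $\overline g$ is a Riemannian metric on $\overline M$ of class $C^2$ up to the boundary. Let $A_g=\frac1{n-1}\left(\mathrm{Ric}_g-\frac{R_g}{2n}g\right)$ be the Schouten tensor. For $1\le k\le n+1$ and a constant $\beta_k$ put $$\mathcal F_k(g,u,\beta_k)=\sigma_k\left(\nabla^2u-du\otimes du+\tfrac12|\nabla u|^2g-A_g\right)-\beta_k e^{2ku},$$ where $\sigma_k$ is the $k$-th elementary symmetric function of the eigenvalues with respect to $g$. Suppose that $\beta_k>0$ and $g\in\Sigma_k(\beta_k)$, i.e. $\mathcal F_k(g,0,\beta_k)=0$ on $M$, and let $\mathcal L_k\phi=\frac{d}{d\epsilon}\big|_{\epsilon=0}\mathcal F_k(g,\epsilon\phi,\beta_k)$ be the linearization at $u=0$. Set $$c_{k,n}=2^{1-k}\binom{n}{k-1},\qquad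 \beta_k^0=2^{-k}\binom{n+1}{k}.$$ Then for every $\phi\in C^2(M)$ $$\mathcal L_k\phi=c_{k,n}\left(\frac{\beta_k}{\beta_k^0}\right)^{\frac{k-1}{k}}\Delta_g\phi-2k\beta_k\,\phi+\rho^3E\phi ,$$ where $E$ is a second order differential operator without constant term whose coefficients, in coordinate charts of $\overline M$, are bounded up to the boundary, and smooth up to the boundary if $\rho$ and $\overline g$ are smooth. (The coefficient of $\Delta_g\phi$ is $c_{k,n}$ if $\beta_k=\beta_k^0$, the constant of the hyperbolic metric.) Moreover, if $\phi\in C^2(M)$ is bounded and $\mathcal L_k\phi=0$, then $\phi\equiv 0$. -/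

import Mathlib

open Set
open scoped Manifold ContDiff

noncomputable section

namespace ConformallyCompact

/-! ### Linear algebra -/

/-- The `k`-th elementary symmetric function `σ_k` of the eigenvalues of a real square matrix `B`,
read off from `det (1 - t B) = ∏ (1 - t λ_i) = ∑ (-1)^k σ_k t^k`. -/
def sigma {d : ℕ} (k : ℕ) (B : Matrix (Fin d) (Fin d) ℝ) : ℝ :=
  (-1) ^ k * B.charpolyRev.coeff k

/-- `sigma k B` is the `k`-th elementary symmetric function of the eigenvalues (with multiplicity)
of `B` whenever all of them are real. -/
theorem sigma_eq_esymm {d : ℕ} (k : ℕ) (hk : k ≤ d) (B : Matrix (Fin d) (Fin d) ℝ)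
    (hB : B.charpoly.Splits) : sigma k B = B.charpoly.roots.esymm k := by
  have hd : B.charpoly.natDegree = d := by simp [Matrix.charpoly_natDegree_eq_dim]
  have h1 : B.charpolyRev.coeff k = B.charpoly.coeff (d - k) := by
    rw [← Matrix.reverse_charpoly, Polynomial.coeff_reverse, hd, Polynomial.revAt_le hk]
  have h2 := Polynomial.coeff_eq_esymm_roots_of_splits hB (k := d - k) (by omega)
  rw [hd, (Matrix.charpoly_monic B).leadingCoeff, Nat.sub_sub_self hk] at h2
  rw [sigma, h1, h2, one_mul, ← mul_assoc, ← mul_pow]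
  simp

/-! ### Riemannian geometry in a coordinate chart of dimension `n + 1`

Here `G : ℝ^{n+1} → Matrix` is the matrix `(g_{ij})` of a metric in coordinates. -/

section Coordinates

variable {n : ℕ}

/-- The partial derivative `∂_i f`. -/
def pderiv (i : Fin (n + 1)) (f : EuclideanSpace ℝ (Fin (n + 1)) → ℝ)
    (y : EuclideanSpace ℝ (Fin (n + 1))) : ℝ :=
  fderiv ℝ f y (EuclideanSpace.single i 1)

/-- The Christoffel symbol `Γ^l_{ij}` of the Levi-Civita connection. -/
def christoffel (G : EuclideanSpace ℝ (Fin (n + 1)) → Matrix (Fin (n + 1)) (Fin (n + 1)) ℝ)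
    (l i j : Fin (n + 1)) (y : EuclideanSpace ℝ (Fin (n + 1))) : ℝ :=
  (1 / 2) * ∑ m, (G y)⁻¹ l m *
    (pderiv i (fun z => G z m j) y + pderiv j (fun z => G z m i) y - pderiv m (fun z => G z i j) y)

/-- The Ricci tensor
`R_{ij} = ∂_l Γ^l_{ij} - ∂_j Γ^l_{il} + Γ^l_{lm} Γ^m_{ij} - Γ^l_{jm} Γ^m_{il}`. -/
def ricci (G : EuclideanSpace ℝ (Fin (n + 1)) → Matrix (Fin (n + 1)) (Fin (n + 1)) ℝ)
    (y : EuclideanSpace ℝ (Fin (n + 1))) : Matrix (Fin (n + 1)) (Fin (n + 1)) ℝ :=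
  Matrix.of fun i j =>
    (∑ l, (pderiv l (christoffel G l i j) y - pderiv j (christoffel G l i l) y)) +
      ∑ l, ∑ m, (christoffel G l l m y * christoffel G m i j y -
        christoffel G l j m y * christoffel G m i l y)

/-- The scalar curvature `R = g^{ij} R_{ij}`. -/
def scalarCurvature (G : EuclideanSpace ℝ (Fin (n + 1)) → Matrix (Fin (n + 1)) (Fin (n + 1)) ℝ)
    (y : EuclideanSpace ℝ (Fin (n + 1))) : ℝ :=
  ∑ i, ∑ j, (G y)⁻¹ i j * ricci G y i j

/-- The Schouten tensor `A = (n - 1)⁻¹ (Ric - R / (2 n) g)` in dimension `n + 1`. -/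
def schouten (G : EuclideanSpace ℝ (Fin (n + 1)) → Matrix (Fin (n + 1)) (Fin (n + 1)) ℝ)
    (y : EuclideanSpace ℝ (Fin (n + 1))) : Matrix (Fin (n + 1)) (Fin (n + 1)) ℝ :=
  ((n : ℝ) - 1)⁻¹ • (ricci G y - (scalarCurvature G y / (2 * n)) • G y)

/-- The Hessian `∇² u`, with components `∂_i ∂_j u - Γ^l_{ij} ∂_l u`. -/
def hessian (G : EuclideanSpace ℝ (Fin (n + 1)) → Matrix (Fin (n + 1)) (Fin (n + 1)) ℝ)
    (u : EuclideanSpace ℝ (Fin (n + 1)) → ℝ) (y : EuclideanSpace ℝ (Fin (n + 1))) :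
    Matrix (Fin (n + 1)) (Fin (n + 1)) ℝ :=
  Matrix.of fun i j => pderiv i (pderiv j u) y - ∑ l, christoffel G l i j y * pderiv l u y

/-- The squared length `|∇u|² = g^{ij} ∂_i u ∂_j u`. -/
def gradSq (G : EuclideanSpace ℝ (Fin (n + 1)) → Matrix (Fin (n + 1)) (Fin (n + 1)) ℝ)
    (u : EuclideanSpace ℝ (Fin (n + 1)) → ℝ) (y : EuclideanSpace ℝ (Fin (n + 1))) : ℝ :=
  ∑ i, ∑ j, (G y)⁻¹ i j * pderiv i u y * pderiv j u y

/-- The symmetric two-tensor `∇² u - du ⊗ du + ½ |∇u|² g - A_g`, which is `-A` of the metric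
`e^{2u} g`. -/
def negSchoutenConf (G : EuclideanSpace ℝ (Fin (n + 1)) → Matrix (Fin (n + 1)) (Fin (n + 1)) ℝ)
    (u : EuclideanSpace ℝ (Fin (n + 1)) → ℝ) (y : EuclideanSpace ℝ (Fin (n + 1))) :
    Matrix (Fin (n + 1)) (Fin (n + 1)) ℝ :=
  hessian G u y - Matrix.of (fun i j => pderiv i u y * pderiv j u y) +
    ((1 / 2) * gradSq G u y) • G y - schouten G y

end Coordinates

/-! ### The operators on a manifold with boundary -/

section Manifold

variable {n : ℕ} {M : Type*} [TopologicalSpace M]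
  [ChartedSpace (EuclideanHalfSpace (n + 1)) M]

/-- The matrix `g(∂_i, ∂_j)` of a field of bilinear forms `g`, in the coordinate frame of the
preferred chart at `q`, as a function of the coordinates. -/
def gram (g : (x : M) → TangentSpace (𝓡∂ (n + 1)) x →L[ℝ] TangentSpace (𝓡∂ (n + 1)) x →L[ℝ] ℝ)
    (q : M) (y : EuclideanSpace ℝ (Fin (n + 1))) : Matrix (Fin (n + 1)) (Fin (n + 1)) ℝ :=
  Matrix.of fun i j =>
    g ((extChartAt (𝓡∂ (n + 1)) q).symm y)
      (mfderivWithin 𝓘(ℝ, EuclideanSpace ℝ (Fin (n + 1))) (𝓡∂ (n + 1))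
        (extChartAt (𝓡∂ (n + 1)) q).symm (range (𝓡∂ (n + 1))) y
        (EuclideanSpace.single i (1 : ℝ) : EuclideanSpace ℝ (Fin (n + 1))))
      (mfderivWithin 𝓘(ℝ, EuclideanSpace ℝ (Fin (n + 1))) (𝓡∂ (n + 1))
        (extChartAt (𝓡∂ (n + 1)) q).symm (range (𝓡∂ (n + 1))) y
        (EuclideanSpace.single j (1 : ℝ) : EuclideanSpace ℝ (Fin (n + 1))))

/-- A function on the manifold, in the coordinates of the preferred chart at `q`. -/
def inChart (q : M) (u : M → ℝ) (y : EuclideanSpace ℝ (Fin (n + 1))) : ℝ :=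
  u ((extChartAt (𝓡∂ (n + 1)) q).symm y)

/-- The operator
`𝓕_k(g, u, C) = σ_k (∇² u - du ⊗ du + ½ |∇u|² g - A_g) - C e^{2ku}`,
the eigenvalues being taken with respect to `g`. The value at the (interior) point `x` is computed
in the preferred chart at `x`. -/
def yamabe (k : ℕ)
    (g : (x : M) → TangentSpace (𝓡∂ (n + 1)) x →L[ℝ] TangentSpace (𝓡∂ (n + 1)) x →L[ℝ] ℝ)
    (u : M → ℝ) (C : ℝ) (x : M) : ℝ :=
  sigma k ((gram g x (extChartAt (𝓡∂ (n + 1)) x x))⁻¹ *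
    negSchoutenConf (gram g x) (inChart x u) (extChartAt (𝓡∂ (n + 1)) x x)) -
      C * Real.exp (2 * k * u x)

/-- The Laplace-Beltrami operator `Δ_g u = g^{ij} (∇² u)_{ij}` at the (interior) point `x`. -/
def laplacian
    (g : (x : M) → TangentSpace (𝓡∂ (n + 1)) x →L[ℝ] TangentSpace (𝓡∂ (n + 1)) x →L[ℝ] ℝ)
    (u : M → ℝ) (x : M) : ℝ :=
  ∑ i, ∑ j, (gram g x (extChartAt (𝓡∂ (n + 1)) x x))⁻¹ i j *
    hessian (gram g x) (inChart x u) (extChartAt (𝓡∂ (n + 1)) x x) i j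

/-- The linearization `𝓛_k φ = d/dε 𝓕_k(g, ε φ, C)` at `ε = 0`. -/
def linearization (k : ℕ)
    (g : (x : M) → TangentSpace (𝓡∂ (n + 1)) x →L[ℝ] TangentSpace (𝓡∂ (n + 1)) x →L[ℝ] ℝ)
    (C : ℝ) (φ : M → ℝ) (x : M) : ℝ :=
  deriv (fun ε : ℝ => yamabe k g (fun z => ε * φ z) C x) 0

/-- `ρ` is a nonnegative defining function of class `C^3` for the boundary. -/
structure IsDefiningFunction (ρ : M → ℝ) : Prop where
  contMDiff : ContMDiff (𝓡∂ (n + 1)) 𝓘(ℝ, ℝ) 3 ρ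
  pos : ∀ x ∈ (𝓡∂ (n + 1)).interior M, 0 < ρ x
  eq_zero : ∀ x ∈ (𝓡∂ (n + 1)).boundary M, ρ x = 0
  mfderiv_ne_zero : ∀ x ∈ (𝓡∂ (n + 1)).boundary M, mfderiv (𝓡∂ (n + 1)) 𝓘(ℝ, ℝ) ρ x ≠ 0

/-- In the chart `e` the operator `P`, acting on functions on the interior, is
`∑ a_{ij} ∂_i ∂_j + ∑ b_i ∂_i`: a second order operator without constant term. -/
def HasCoefficients (P : (M → ℝ) → M → ℝ)
    (e : OpenPartialHomeomorph M (EuclideanHalfSpace (n + 1)))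
    (a : Fin (n + 1) → Fin (n + 1) → EuclideanSpace ℝ (Fin (n + 1)) → ℝ)
    (b : Fin (n + 1) → EuclideanSpace ℝ (Fin (n + 1)) → ℝ) : Prop :=
  ∀ φ : M → ℝ, ContMDiffOn (𝓡∂ (n + 1)) 𝓘(ℝ, ℝ) 2 φ ((𝓡∂ (n + 1)).interior M) →
    ∀ x ∈ e.source ∩ (𝓡∂ (n + 1)).interior M,
      P φ x =
        ∑ i, ∑ j, a i j (e.extend (𝓡∂ (n + 1)) x) *
          pderiv i (pderiv j (φ ∘ (e.extend (𝓡∂ (n + 1))).symm)) (e.extend (𝓡∂ (n + 1)) x) +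
        ∑ i, b i (e.extend (𝓡∂ (n + 1)) x) *
          pderiv i (φ ∘ (e.extend (𝓡∂ (n + 1))).symm) (e.extend (𝓡∂ (n + 1)) x)

/-- `P` is a second order operator without constant term whose coefficients are bounded up to the
boundary: in every smooth chart (boundary charts included) they are bounded on compact sets. -/
def IsBoundedSecondOrder (P : (M → ℝ) → M → ℝ) : Prop :=
  ∀ e ∈ IsManifold.maximalAtlas (𝓡∂ (n + 1)) ∞ M, ∃ a b, HasCoefficients P e a b ∧
    ∀ K ⊆ (e.extend (𝓡∂ (n + 1))).target, IsCompact K →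
      ∃ B : ℝ, ∀ y ∈ K, (∀ i j, |a i j y| ≤ B) ∧ ∀ i, |b i y| ≤ B

/-- `P` is a second order operator without constant term whose coefficients are smooth up to the
boundary, in every smooth chart. -/
def IsSmoothSecondOrder (P : (M → ℝ) → M → ℝ) : Prop :=
  ∀ e ∈ IsManifold.maximalAtlas (𝓡∂ (n + 1)) ∞ M, ∃ a b, HasCoefficients P e a b ∧
    (∀ i j, ContDiffOn ℝ ∞ (a i j) (e.extend (𝓡∂ (n + 1))).target) ∧
    ∀ i, ContDiffOn ℝ ∞ (b i) (e.extend (𝓡∂ (n + 1))).target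

/-- The metric `gbar` is `C^∞` up to the boundary. -/
def IsSmoothMetric [IsManifold (𝓡∂ (n + 1)) ∞ M]
    (gbar : Bundle.ContMDiffRiemannianMetric (𝓡∂ (n + 1)) 2 (EuclideanSpace ℝ (Fin (n + 1)))
      (fun x : M => TangentSpace (𝓡∂ (n + 1)) x)) : Prop :=
  ContMDiff (𝓡∂ (n + 1))
    ((𝓡∂ (n + 1)).prod 𝓘(ℝ, EuclideanSpace ℝ (Fin (n + 1)) →L[ℝ]
      EuclideanSpace ℝ (Fin (n + 1)) →L[ℝ] ℝ)) ∞
    (fun x : M => Bundle.TotalSpace.mk' (EuclideanSpace ℝ (Fin (n + 1)) →L[ℝ]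
      EuclideanSpace ℝ (Fin (n + 1)) →L[ℝ] ℝ)
      (E := fun x : M => TangentSpace (𝓡∂ (n + 1)) x →L[ℝ] TangentSpace (𝓡∂ (n + 1)) x →L[ℝ] ℝ)
      x (gbar.inner x))

end Manifold

/-- `c_{k,n} = 2^{1-k} (n choose k-1)`. -/
def cConst (k n : ℕ) : ℝ := (2 : ℝ) ^ (1 - (k : ℤ)) * (n.choose (k - 1) : ℝ)

/-- The value `2^{-k} (n+1 choose k)` of `σ_k(-A)` for the hyperbolic metric. -/
def betaHyp (k n : ℕ) : ℝ := (2 : ℝ) ^ (-(k : ℤ)) * ((n + 1).choose k : ℝ)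

end ConformallyCompact

end

/-! Let B = -g⁻¹A_g. Since u = εφ enters the tensor under σ_k linearly through ∇²φ and otherwise
only in order ε², and since the derivative of σ_k at B is H ↦ tr(T_{k-1}(B) H) with T the Newton
tensor (`hasDerivAt_sigma`), the linearization is tr(T_{k-1}(B) g⁻¹∇²φ) - 2kβφ.

The conformal formula for the Schouten tensor gives B = ½|dρ|² + ρ(…), with a bracket regular up to
the boundary (`IsConformalAt.inv_mul_neg_schouten`). On the boundary B is scalar, so σ_k(B) = β
forces |dρ|² = a₀ = (β/β⁰)^{1/k} there. Hadamard's lemma turns this into |dρ|² = a₀ + ρf, hence B =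
c + ρN with c = a₀/2, and T_{k-1}(B) = κ + ρS. The constant κ is the coefficient of the Laplacian in
the theorem.

The remainder is ρ tr(S g⁻¹∇²φ). Its second order part carries ρ³, but the Christoffel symbols of g
are of size ρ⁻¹, so the first order part seems to carry only ρ². The missing factor comes from two
cancellations. The singular first order terms involve S only through S∇ρ and tr S, hence, up to
O(ρ), only through N∇ρ and tr N. The equation σ_k(c + ρN) = β, whose zeroth order term is already β,
gives tr N = O(ρ). The identity ∇²ρ(∇ρ) = ½d|dρ|², applied to |dρ|² = a₀ + ρf, gives N∇ρ = O(ρ).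
These are combined in `IsSolutionChart.exists_coefficients`, where ρ of class C³ makes f of class
C¹, just enough for continuous coefficients.

Uniqueness is a maximum principle. It needs T_{k-1}(B) ≥ 0, which holds on the cone σ_1 > 0, …, σ_k
> 0 (`trace_newton_mul_nonneg`). The set of points with B in the cone, together with the boundary,
is open and closed: near the boundary B is close to a positive multiple of the identity, and σ_j ≥ 0
for all j ≤ k with σ_k = β > 0 already implies σ_j > 0 (`sigma_pos_of_nonneg`). As every component
reaches the boundary, the cone condition holds everywhere (`IsYamabeSolution.yamabe_pos`). The
barrier -log ρ tends to infinity at the boundary, while the second order part of the linearization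
maps it to a bounded function. For bounded φ the function φ + ε log ρ has an interior maximum, where
the equation bounds φ by a multiple of ε. Letting ε tend to 0 gives φ ≤ 0, and the same applies to
-φ. -/

noncomputable section

namespace ConformallyCompact

/-! ### Elementary symmetric functions and Newton tensors of a matrix. -/

section LinearAlgebra

open Matrix Polynomial

variable {d : ℕ}

/-- A principal minor of size k changes by (-1)^k under B ↦ -B, which absorbs the sign in `sigma`.
-/
theorem sigma_eq_coeff (k : ℕ) (B : Matrix (Fin d) (Fin d) ℝ) :
    sigma k B = (det (1 + (X : ℝ[X]) • B.map C)).coeff k := by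
  have h : B.charpolyRev = det (1 + (X : ℝ[X]) • (-B).map C) := by
    simp only [charpolyRev, sub_eq_add_neg]
    congr 2
    rw [Matrix.map_neg C (map_neg C) B, smul_neg]
  rw [sigma, h, coeff_det_one_add_X_smul_eq_sum_minors, coeff_det_one_add_X_smul_eq_sum_minors,
    Finset.mul_sum]
  refine Finset.sum_congr rfl fun s hs => ?_
  have hneg : (-B).submatrix (Subtype.val : s → Fin d) (Subtype.val : s → Fin d) =
      -B.submatrix (Subtype.val : s → Fin d) (Subtype.val : s → Fin d) := rfl
  rw [hneg, det_neg, Fintype.card_coe, (Finset.mem_powersetCard.mp hs).2, ← mul_assoc, ← mul_pow]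
  simp

theorem sigma_eq_sum_minors (k : ℕ) (B : Matrix (Fin d) (Fin d) ℝ) :
    sigma k B = ∑ s ∈ Finset.univ.powersetCard k,
      (B.submatrix (Subtype.val : s → Fin d) (Subtype.val : s → Fin d)).det := by
  rw [sigma_eq_coeff, coeff_det_one_add_X_smul_eq_sum_minors]

theorem sigma_zero (B : Matrix (Fin d) (Fin d) ℝ) : sigma 0 B = 1 := by
  simp [sigma_eq_sum_minors]

theorem sigma_one (B : Matrix (Fin d) (Fin d) ℝ) : sigma 1 B = B.trace := by
  rw [sigma_eq_coeff, coeff_det_one_add_X_smul_one]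

theorem sigma_smul (k : ℕ) (r : ℝ) (B : Matrix (Fin d) (Fin d) ℝ) :
    sigma k (r • B) = r ^ k * sigma k B := by
  rw [sigma_eq_sum_minors, sigma_eq_sum_minors, Finset.mul_sum]
  refine Finset.sum_congr rfl fun s hs => ?_
  have : (r • B).submatrix (Subtype.val : s → Fin d) (Subtype.val : s → Fin d) =
      r • B.submatrix (Subtype.val : s → Fin d) (Subtype.val : s → Fin d) := rfl
  rw [this, det_smul, Fintype.card_coe, (Finset.mem_powersetCard.mp hs).2]

theorem sigma_eq_zero_of_lt {k : ℕ} (hk : d < k) (B : Matrix (Fin d) (Fin d) ℝ) :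
    sigma k B = 0 := by
  rw [sigma_eq_sum_minors, Finset.powersetCard_eq_empty.2 (by simpa using hk), Finset.sum_empty]

theorem det_one_add_smul_eq_sum (t : ℝ) (B : Matrix (Fin d) (Fin d) ℝ) :
    det (1 + t • B) = ∑ j ∈ Finset.range (d + 1), t ^ j * sigma j B := by
  have h1 : det (1 + t • B) = (det (1 + (X : ℝ[X]) • B.map C)).eval t := by
    rw [← coe_evalRingHom, RingHom.map_det]
    congr 1
    ext i j
    rcases eq_or_ne i j with rfl | hij <;> (simp_all; ring)
  rw [h1, Polynomial.eval_eq_sum_range' (n := d + 1)]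
  · refine Finset.sum_congr rfl fun j _ => ?_
    rw [sigma_eq_coeff, mul_comm]
  · rw [Nat.lt_succ_iff, Polynomial.natDegree_le_iff_coeff_eq_zero]
    intro N hN
    rw [← sigma_eq_coeff, sigma_eq_zero_of_lt hN]

theorem sigma_conj (k : ℕ) {P : Matrix (Fin d) (Fin d) ℝ} (hP : IsUnit P.det)
    (B : Matrix (Fin d) (Fin d) ℝ) : sigma k (P⁻¹ * B * P) = sigma k B := by
  have := invertibleOfIsUnitDet P hP
  have h : (P⁻¹ * B * P).charpoly = B.charpoly := by
    have := charpoly_units_conj' (unitOfInvertible P) B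
    simpa [← invOf_eq_nonsing_inv] using this
  rw [sigma, sigma, ← reverse_charpoly, ← reverse_charpoly, h]

/-- Factor 1 + t(c + B) = (1 + tc)(1 + t/(1 + tc) B), take determinants and compare coefficients of
t^k. The division excludes at most one value of t, which does not matter for an identity of
polynomials. -/
theorem sigma_smul_one_add {k : ℕ} (hk : k ≤ d) (c : ℝ) (B : Matrix (Fin d) (Fin d) ℝ) :
    sigma k (c • 1 + B) = ∑ j ∈ Finset.range (k + 1),
      ((d - j).choose (k - j) : ℝ) * c ^ (k - j) * sigma j B := by
  have key : (∑ j ∈ Finset.range (d + 1), C (sigma j (c • 1 + B)) * X ^ j : ℝ[X]) =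
      ∑ j ∈ Finset.range (d + 1), C (sigma j B) * X ^ j * (1 + C c * X) ^ (d - j) := by
    have hinf : {t : ℝ | 1 + t * c ≠ 0}.Infinite := by
      have : {t : ℝ | 1 + t * c = 0}.Finite := by
        rcases eq_or_ne c 0 with rfl | hc
        · simp
        · refine (Set.finite_singleton (-1 / c)).subset fun t ht => ?_
          simp only [Set.mem_ofPred_eq] at ht
          rw [Set.mem_singleton_iff, eq_div_iff hc]; linarith
      exact this.infinite_compl
    refine Polynomial.eq_of_infinite_eval_eq _ _ (hinf.mono fun t ht => ?_)
    simp only [Set.mem_ofPred_eq] at ht ⊢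
    have e1 : det (1 + t • (c • 1 + B)) =
        ∑ j ∈ Finset.range (d + 1), t ^ j * sigma j (c • 1 + B) := det_one_add_smul_eq_sum _ _
    have e2 : (1 + t • (c • 1 + B)) = (1 + t * c) • (1 + (t / (1 + t * c)) • B) := by
      rw [smul_add (1 + t * c), smul_smul, mul_div_cancel₀ _ ht, smul_add, add_smul, smul_smul,
        one_smul, add_assoc]
    rw [e2, det_smul, Fintype.card_fin, det_one_add_smul_eq_sum, Finset.mul_sum] at e1
    simp only [eval_finsetSum, eval_mul, eval_C, eval_pow, eval_X, eval_add, eval_one]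
    rw [Finset.sum_congr rfl (fun j _ => mul_comm (sigma j (c • 1 + B)) (t ^ j)), ← e1]
    refine Finset.sum_congr rfl fun j hj => ?_
    have hj' : j ≤ d := by simpa [Nat.lt_succ_iff] using hj
    have hpow : (1 + t * c) ^ d = (1 + t * c) ^ (d - j) * (1 + t * c) ^ j := by
      rw [← pow_add, Nat.sub_add_cancel hj']
    rw [div_pow, hpow, mul_comm c t]
    field_simp
  have h2 := congrArg (fun p : ℝ[X] => p.coeff k) key
  simp only [finsetSum_coeff, coeff_C_mul, coeff_X_pow] at h2
  rw [Finset.sum_eq_single k (by intro b _ hb; simp [hb.symm])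
    (by intro h; simp at h; omega)] at h2
  simp only [if_true, mul_one] at h2
  rw [h2]
  have hco : ∀ j, ((C (sigma j B) * X ^ j * (1 + C c * X) ^ (d - j) : ℝ[X])).coeff k =
      if j ≤ k then ((d - j).choose (k - j) : ℝ) * c ^ (k - j) * sigma j B else 0 := by
    intro j
    have hexp : (1 + C c * X : ℝ[X]) ^ (d - j) = ((1 + X) ^ (d - j) : ℝ[X]).comp (C c * X) := by
      simp
    rw [mul_assoc, coeff_C_mul, coeff_X_pow_mul']
    split_ifs with h
    · rw [hexp, comp_C_mul_X_coeff, coeff_one_add_X_pow]; ring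
    · simp
  rw [Finset.sum_congr rfl (fun j _ => hco j), ← Finset.sum_filter]
  refine Finset.sum_congr ?_ fun _ _ => rfl
  ext j; simp; omega

/-- The `k`-th Newton tensor, `T_k = σ_k - B T_{k-1}`. -/
def newton : ℕ → Matrix (Fin d) (Fin d) ℝ → Matrix (Fin d) (Fin d) ℝ
  | 0, _ => 1
  | k + 1, B => sigma (k + 1) B • 1 - B * newton k B

theorem newton_zero (B : Matrix (Fin d) (Fin d) ℝ) : newton 0 B = 1 := rfl

theorem newton_succ (k : ℕ) (B : Matrix (Fin d) (Fin d) ℝ) :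
    newton (k + 1) B = sigma (k + 1) B • 1 - B * newton k B := rfl

theorem newton_one (B : Matrix (Fin d) (Fin d) ℝ) : newton 1 B = B.trace • 1 - B := by
  rw [newton_succ, newton_zero, mul_one, sigma_one]

theorem newton_smul (k : ℕ) (r : ℝ) (B : Matrix (Fin d) (Fin d) ℝ) :
    newton k (r • B) = r ^ k • newton k B := by
  induction k with
  | zero => simp [newton_zero]
  | succ k ih =>
    rw [newton_succ, newton_succ, ih, sigma_smul, smul_sub, smul_smul, smul_mul_smul_comm, pow_succ']

theorem newton_commute (k : ℕ) (B : Matrix (Fin d) (Fin d) ℝ) :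
    B * newton k B = newton k B * B := by
  induction k with
  | zero => simp [newton_zero]
  | succ k ih =>
    rw [newton_succ, mul_sub, sub_mul, mul_smul_comm, smul_mul_assoc, mul_one, one_mul, mul_assoc,
      ← ih]

theorem newton_conj (k : ℕ) {P : Matrix (Fin d) (Fin d) ℝ} (hP : IsUnit P.det)
    (B : Matrix (Fin d) (Fin d) ℝ) : newton k (P⁻¹ * B * P) = P⁻¹ * newton k B * P := by
  induction k with
  | zero => simp [newton_zero, nonsing_inv_mul _ hP]
  | succ k ih =>
    rw [newton_succ, newton_succ, ih, sigma_conj _ hP, mul_sub, sub_mul, mul_smul_comm,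
      smul_mul_assoc, mul_one, nonsing_inv_mul _ hP]
    congr 1
    calc P⁻¹ * B * P * (P⁻¹ * newton k B * P)
        = P⁻¹ * B * (P * P⁻¹) * newton k B * P := by simp only [mul_assoc]
      _ = _ := by rw [mul_nonsing_inv _ hP, mul_one]; simp only [mul_assoc]

/-- With P the inverse metric and Y a symmetric tensor, PY itself need not be symmetric, but P(PY)ᵀ
= (PY)P and T_k commutes with PY, so raising an index of T_k gives a symmetric matrix. This makes
the leading coefficients of the remainder symmetric. -/
theorem newton_mul_isSymm (k : ℕ) {P Y : Matrix (Fin d) (Fin d) ℝ} (hP : P.IsSymm)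
    (hY : Y.IsSymm) : (newton k (P * Y) * P).IsSymm := by
  induction k with
  | zero => simpa [newton_zero] using hP
  | succ k ih =>
    have hPB : P * (P * Y)ᵀ = (P * Y) * P := by
      rw [transpose_mul, hP.eq, hY.eq, mul_assoc]
    have h2 : (P * Y * newton k (P * Y) * P).IsSymm := by
      rw [Matrix.IsSymm]
      calc (P * Y * newton k (P * Y) * P)ᵀ = (newton k (P * Y) * P)ᵀ * (P * Y)ᵀ := by
            rw [← transpose_mul]; simp only [mul_assoc]
        _ = newton k (P * Y) * (P * (P * Y)ᵀ) := by rw [ih.eq, mul_assoc]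
        _ = _ := by rw [hPB, ← mul_assoc, ← newton_commute]
    rw [newton_succ, sub_mul, smul_mul_assoc, one_mul]
    exact (hP.smul _).sub h2

end LinearAlgebra

/-! ### The derivative of σ_k is the Newton tensor. -/

section LinearAlgebra

open Matrix Polynomial

variable {d : ℕ}

/-- Jacobi's formula: in the Leibniz expansion, differentiating the factor from column i produces
the determinant with that column replaced, which is Cramer's rule for the adjugate. -/
theorem hasDerivAt_det {A : ℝ → Matrix (Fin d) (Fin d) ℝ} {A' : Matrix (Fin d) (Fin d) ℝ} {x : ℝ}
    (hA : ∀ i j, HasDerivAt (fun ε => A ε i j) (A' i j) x) :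
    HasDerivAt (fun ε => (A ε).det) ((adjugate (A x) * A').trace) x := by
  have h1 : HasDerivAt (fun ε => ∑ σ : Equiv.Perm (Fin d),
      (((Equiv.Perm.sign σ : ℤ) : ℝ) * ∏ i, A ε (σ i) i))
      (∑ σ : Equiv.Perm (Fin d), ((Equiv.Perm.sign σ : ℤ) : ℝ) *
        ∑ i, (∏ j ∈ Finset.univ.erase i, A x (σ j) j) • A' (σ i) i) x :=
    HasDerivAt.fun_sum fun σ _ =>
      (HasDerivAt.fun_finsetProd (fun i _ => hA (σ i) i)).const_mul _
  have h2 : (fun ε => (A ε).det) = fun ε => ∑ σ : Equiv.Perm (Fin d),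
      (((Equiv.Perm.sign σ : ℤ) : ℝ) * ∏ i, A ε (σ i) i) := by
    funext ε; rw [det_apply']
  rw [h2]
  convert h1 using 1
  have h3 : ∀ i, (adjugate (A x) * A') i i = ((A x).updateCol i (fun l => A' l i)).det := by
    intro i
    rw [← cramer_apply, cramer_eq_adjugate_mulVec]
    rfl
  rw [trace]
  simp only [diag_apply, h3, det_apply', Finset.mul_sum]
  rw [Finset.sum_comm]
  refine Finset.sum_congr rfl fun σ _ => Finset.sum_congr rfl fun i _ => ?_
  rw [← Finset.prod_erase_mul _ _ (Finset.mem_univ i), updateCol_self, smul_eq_mul]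
  congr 2
  refine Finset.prod_congr rfl fun j hj => ?_
  rw [updateCol_ne (Finset.ne_of_mem_erase hj)]

/-- Comparing coefficients of X^{k+1} in (1 + XB) adj(1 + XB) = det(1 + XB) gives exactly the
recursion that defines `newton`. -/
theorem adjugate_one_add_X_smul_coeff (k : ℕ) (B : Matrix (Fin d) (Fin d) ℝ) (i j : Fin d) :
    (adjugate (1 + (X : ℝ[X]) • B.map C) i j).coeff k = newton k B i j := by
  have h := mul_adjugate (1 + (X : ℝ[X]) • B.map C)
  have hz : ∀ i j, adjugate (1 + (X : ℝ[X]) • B.map C) i j +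
      X * ∑ l, C (B i l) * adjugate (1 + (X : ℝ[X]) • B.map C) l j =
      (1 + (X : ℝ[X]) • B.map C).det * (1 : Matrix (Fin d) (Fin d) ℝ[X]) i j := by
    intro i j
    have := congrFun (congrFun h i) j
    rw [add_mul, one_mul, smul_mul_assoc] at this
    simpa [mul_apply] using this
  have hone : ∀ k i, ((1 + (X : ℝ[X]) • B.map C).det *
      (1 : Matrix (Fin d) (Fin d) ℝ[X]) i j).coeff k =
      sigma k B * (1 : Matrix (Fin d) (Fin d) ℝ) i j := by
    intro k i
    rw [sigma_eq_coeff, one_apply, one_apply]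
    split_ifs <;> simp
  induction k generalizing i with
  | zero =>
    have := congrArg (fun p : ℝ[X] => p.coeff 0) (hz i j)
    simp only [coeff_add, mul_coeff_zero, coeff_X_zero, zero_mul, add_zero] at this
    rw [this, ← mul_coeff_zero, hone, newton_zero, sigma_zero, one_mul]
  | succ k ih =>
    have := congrArg (fun p : ℝ[X] => p.coeff (k + 1)) (hz i j)
    simp only [coeff_add, coeff_X_mul, finsetSum_coeff, coeff_C_mul, hone, ih] at this
    rw [newton_succ, Matrix.sub_apply, Matrix.smul_apply, smul_eq_mul, mul_apply]
    linarith

/-- Differentiate det(1 + tA) = Σ t^j σ_j(A) by Jacobi's formula for every t, and read off the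
coefficient of t^{k+1}. The coefficients of the adjugate are the Newton tensors. -/
theorem hasDerivAt_sigma (k : ℕ) {A : ℝ → Matrix (Fin d) (Fin d) ℝ}
    {A' : Matrix (Fin d) (Fin d) ℝ} {x : ℝ} (hA : ∀ i j, HasDerivAt (fun ε => A ε i j) (A' i j) x) :
    HasDerivAt (fun ε => sigma (k + 1) (A ε)) ((newton k (A x) * A').trace) x := by
  have hdiff : ∀ j, DifferentiableAt ℝ (fun ε => sigma j (A ε)) x := by
    intro j
    simp only [sigma_eq_sum_minors]
    refine DifferentiableAt.fun_sum fun s _ => ?_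
    simp only [det_apply']
    refine DifferentiableAt.fun_sum fun σ _ => ?_
    refine (DifferentiableAt.fun_finsetProd fun i _ => ?_).const_mul _
    exact (hA _ _).differentiableAt
  have key : (∑ j ∈ Finset.range (d + 1), C (deriv (fun ε => sigma j (A ε)) x) * X ^ j : ℝ[X]) =
      X * (adjugate (1 + (X : ℝ[X]) • (A x).map C) * A'.map C).trace := by
    refine Polynomial.funext fun t => ?_
    have h1 : HasDerivAt (fun ε => (1 + t • A ε).det)
        ((adjugate (1 + t • A x) * (t • A')).trace) x := by
      refine hasDerivAt_det fun i j => ?_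
      simpa [Matrix.add_apply] using ((hA i j).const_mul t).const_add ((1 : Matrix (Fin d) (Fin d) ℝ) i j)
    have h2 : HasDerivAt (fun ε => (1 + t • A ε).det)
        (∑ j ∈ Finset.range (d + 1), t ^ j * deriv (fun ε => sigma j (A ε)) x) x := by
      simp only [det_one_add_smul_eq_sum]
      exact HasDerivAt.fun_sum fun j _ => (hdiff j).hasDerivAt.const_mul _
    have h3 := h2.unique h1
    have h4 : (evalRingHom t) (adjugate (1 + (X : ℝ[X]) • (A x).map C) * A'.map C).trace =
        (adjugate (1 + t • A x) * A').trace := by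
      have e1 : (1 + (X : ℝ[X]) • (A x).map C).map (evalRingHom t) = 1 + t • A x := by
        ext i j
        rcases eq_or_ne i j with rfl | hij <;> (simp_all; ring)
      have e2 := RingHom.map_adjugate (evalRingHom t) (1 + (X : ℝ[X]) • (A x).map C)
      simp only [RingHom.mapMatrix_apply] at e2
      rw [e1] at e2
      rw [← e2]
      simp [trace, mul_apply]
    rw [mul_smul_comm, trace_smul, smul_eq_mul, ← h4] at h3
    simp only [eval_finsetSum, eval_mul, eval_C, eval_pow, eval_X]
    rw [coe_evalRingHom] at h3
    rw [← h3]
    exact Finset.sum_congr rfl fun _ _ => mul_comm _ _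
  have h5 := congrArg (fun p : ℝ[X] => p.coeff (k + 1)) key
  have h6 : (X * (adjugate (1 + (X : ℝ[X]) • (A x).map C) * A'.map C).trace).coeff (k + 1) =
      (newton k (A x) * A').trace := by
    rw [coeff_X_mul]
    simp [trace, mul_apply, finsetSum_coeff, adjugate_one_add_X_smul_coeff]
  rw [h6] at h5
  simp only [finsetSum_coeff, coeff_C_mul, coeff_X_pow] at h5
  rw [← h5]
  -- Beyond the dimension σ_{k+1} vanishes identically, and so does the coefficient of X^{k+1} on
  -- the left of `key`.
  rcases lt_or_ge d (k + 1) with hk | hk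
  · rw [Finset.sum_eq_zero]
    · simpa [sigma_eq_zero_of_lt hk] using hasDerivAt_const x (0 : ℝ)
    · intro j hj
      have : j ≤ d := by simpa [Nat.lt_succ_iff] using hj
      rw [if_neg (by omega), mul_zero]
  · rw [Finset.sum_eq_single (k + 1) (by intro b _ hb; simp [hb.symm])
      (by intro h; simp at h; omega), if_pos rfl, mul_one]
    exact (hdiff _).hasDerivAt

end LinearAlgebra

/-! ### Real-rooted polynomials and positivity of coefficients. -/

section LinearAlgebra

open Matrix Polynomial

/-- Rolle's theorem with multiplicities: a derivative has at most one root fewer, and its degree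
also drops. -/
theorem splits_iterate_derivative {p : ℝ[X]} (hp : p.Splits) (m : ℕ) :
    (derivative^[m] p).Splits := by
  induction m with
  | zero => exact hp
  | succ m ih =>
    rw [Function.iterate_succ_apply']
    set q := derivative^[m] p
    rw [splits_iff_card_roots] at ih ⊢
    have h1 := card_roots_le_derivative q
    have h2 := natDegree_derivative_le q
    have h3 := card_roots' (derivative q)
    rcases Nat.eq_zero_or_pos q.natDegree with h0 | h0
    · omega
    · omega

theorem coeff_prod_X_add_C_pos {s : Multiset ℝ} (hs : ∀ a ∈ s, 0 < a) {i : ℕ}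
    (hi : i ≤ Multiset.card s) : 0 < ((s.map fun r => X + C r).prod).coeff i := by
  have hnn : ∀ (t : Multiset ℝ), (∀ a ∈ t, 0 < a) → ∀ i,
      0 ≤ ((t.map fun r => X + C r).prod).coeff i := by
    intro t
    induction t using Multiset.induction_on with
    | empty => intro _ i; simp [coeff_one]; split_ifs <;> norm_num
    | cons a t ih =>
      intro h i
      have ih' := ih fun b hb => h b (Multiset.mem_cons_of_mem hb)
      have ha := h a (Multiset.mem_cons_self a t)
      rw [Multiset.map_cons, Multiset.prod_cons, add_mul, coeff_add, coeff_C_mul]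
      cases i with
      | zero => simpa using mul_nonneg ha.le (ih' 0)
      | succ i => rw [coeff_X_mul]; exact add_nonneg (ih' i) (mul_nonneg ha.le (ih' _))
  induction s using Multiset.induction_on generalizing i with
  | empty => 
    have : i = 0 := by simpa using hi
    simp [this]
  | cons a t ih =>
    have h' : ∀ b ∈ t, 0 < b := fun b hb => hs b (Multiset.mem_cons_of_mem hb)
    have ha := hs a (Multiset.mem_cons_self a t)
    rw [Multiset.map_cons, Multiset.prod_cons, add_mul, coeff_add, coeff_C_mul]
    cases i with
    | zero => simpa using mul_pos ha (ih h' (Nat.zero_le _))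
    | succ i =>
      rw [coeff_X_mul]
      refine add_pos_of_pos_of_nonneg (ih h' ?_) (mul_nonneg ha.le (hnn t h' _))
      simpa using hi

/-- A real-rooted polynomial with nonnegative coefficients and nonzero constant coefficient
has positive coefficients. -/
theorem coeff_pos_of_splits {p : ℝ[X]} (hp : p.Splits) (h0 : ∀ i, 0 ≤ p.coeff i)
    (hpos : 0 < p.coeff 0) {i : ℕ} (hi : i ≤ p.natDegree) : 0 < p.coeff i := by
  have hev : ∀ x, 0 ≤ x → 0 < p.eval x := by
    intro x hx
    rw [eval_eq_sum_range, Finset.sum_range_succ']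
    refine add_pos_of_nonneg_of_pos (Finset.sum_nonneg fun j _ => ?_) (by simpa using hpos)
    exact mul_nonneg (h0 _) (pow_nonneg hx _)
  have hp0 : p ≠ 0 := by rintro rfl; simp at hpos
  -- Nonnegative coefficients make p positive on [0, ∞). All factors X - r therefore have positive
  -- coefficients, and so does their product.
  have hroots : ∀ r ∈ p.roots, r < 0 := by
    intro r hr
    by_contra hr0
    exact (hev r (not_lt.1 hr0)).ne' (isRoot_of_mem_roots hr)
  have hlead : 0 < p.leadingCoeff :=
    lt_of_le_of_ne (h0 _) (leadingCoeff_ne_zero.2 hp0).symm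
  have hfac : p = C p.leadingCoeff * ((p.roots.map Neg.neg).map fun r => X + C r).prod := by
    conv_lhs => rw [hp.eq_prod_roots]
    simp [sub_eq_add_neg]
  rw [hfac, coeff_C_mul]
  refine mul_pos hlead (coeff_prod_X_add_C_pos ?_ ?_)
  · intro a ha
    obtain ⟨r, hr, rfl⟩ := Multiset.mem_map.1 ha
    exact neg_pos.2 (hroots r hr)
  · rwa [Multiset.card_map, ← hp.natDegree_eq_card_roots]

theorem coeff_iterate_derivative_pos_iff {p : ℝ[X]} (m i : ℕ) :
    0 < (derivative^[m] p).coeff i ↔ 0 < p.coeff (i + m) := by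
  rw [coeff_iterate_derivative, nsmul_eq_mul]
  have : (0 : ℝ) < ((i + m).descFactorial m : ℝ) := by
    exact_mod_cast Nat.descFactorial_pos.2 (Nat.le_add_left _ _)
  exact mul_pos_iff_of_pos_left this

theorem coeff_iterate_derivative_nonneg_iff {p : ℝ[X]} (m i : ℕ) :
    0 ≤ (derivative^[m] p).coeff i ↔ 0 ≤ p.coeff (i + m) := by
  rw [coeff_iterate_derivative, nsmul_eq_mul]
  have : (0 : ℝ) < ((i + m).descFactorial m : ℝ) := by
    exact_mod_cast Nat.descFactorial_pos.2 (Nat.le_add_left _ _)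
  exact mul_nonneg_iff_of_pos_left this

theorem natDegree_iterate_derivative_eq (p : ℝ[X]) (m : ℕ) :
    (derivative^[m] p).natDegree = p.natDegree - m := by
  refine le_antisymm (natDegree_iterate_derivative _ _) ?_
  rcases le_or_gt m p.natDegree with hm | hm
  · rcases eq_or_ne p 0 with rfl | hp
    · simp
    refine le_natDegree_of_ne_zero ?_
    rw [coeff_iterate_derivative, Nat.sub_add_cancel hm, nsmul_eq_mul]
    refine mul_ne_zero ?_ (leadingCoeff_ne_zero.2 hp)
    exact_mod_cast (Nat.descFactorial_pos.2 hm).ne'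
  · omega

/-- Differentiating m times keeps all roots real, moves the coefficient of X^m to the constant term,
and changes the remaining coefficients only by positive factors. -/
theorem coeff_pos_of_splits_of_le {p : ℝ[X]} (hp : p.Splits) {m : ℕ}
    (h0 : ∀ i, m ≤ i → 0 ≤ p.coeff i) (hpos : 0 < p.coeff m) {i : ℕ} (hm : m ≤ i)
    (hi : i ≤ p.natDegree) : 0 < p.coeff i := by
  have h := coeff_pos_of_splits (splits_iterate_derivative hp m) (i := i - m)
    (fun j => (coeff_iterate_derivative_nonneg_iff m j).2 (h0 _ (Nat.le_add_left _ _)))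
    ((coeff_iterate_derivative_pos_iff m 0).2 (by simpa using hpos))
    (by rw [natDegree_iterate_derivative_eq]; omega)
  rw [coeff_iterate_derivative_pos_iff, Nat.sub_add_cancel hm] at h
  exact h

theorem iterate_derivative_X_add_C_mul (a : ℝ) (q : ℝ[X]) (m : ℕ) :
    derivative^[m + 1] ((X + C a) * q) =
      (X + C a) * derivative^[m + 1] q + (m + 1 : ℝ[X]) * derivative^[m] q := by
  induction m with
  | zero => simp; ring
  | succ m ih =>
    rw [Function.iterate_succ_apply', ih, derivative_add, derivative_mul, derivative_mul,
      Function.iterate_succ_apply' derivative (m + 1), Function.iterate_succ_apply' derivative m]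
    simp
    ring

/-- This is the source of ellipticity, with q the product of X + v_j over all eigenvalues but one.
If the conclusion fails, f = q^(m) is negative at 0 and so has a largest root s₀ > 0. The m-th
derivative of (X + a)q has positive coefficients; at s₀ it equals m F(s₀) with F = q^(m-1), since
f(s₀) = 0. Thus F(s₀) > 0. As F' = f ≥ 0 beyond s₀, every root of F lies below s₀, so F'/F = Σ 1/(s₀
- u) is positive at s₀, against F'(s₀) = 0. -/
theorem coeff_nonneg_of_splits_mul {q : ℝ[X]} (hq : q.Splits) (hmon : q.Monic) (a : ℝ) {m : ℕ}
    (hm : m ≤ q.natDegree)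
    (hpos : ∀ i, m ≤ i → i ≤ q.natDegree + 1 → 0 < ((X + C a) * q).coeff i) :
    0 ≤ q.coeff m := by
  by_contra hneg
  have hdeg : ((X + C a) * q).natDegree = q.natDegree + 1 := by
    rw [Monic.natDegree_mul (monic_X_add_C a) hmon, natDegree_X_add_C, add_comm]
  set f := derivative^[m] q with hf
  have hfs : f.Splits := splits_iterate_derivative hq m
  have hfd : f.natDegree = q.natDegree - m := natDegree_iterate_derivative_eq _ _
  have hlead : 0 < f.leadingCoeff := by
    rw [leadingCoeff, hfd, hf, coeff_iterate_derivative_pos_iff, Nat.sub_add_cancel hm,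
      hmon.coeff_natDegree]
    exact one_pos
  have hf0 : f ≠ 0 := leadingCoeff_ne_zero.1 hlead.ne'
  have hfneg : f.eval 0 < 0 := by
    rw [← coeff_zero_eq_eval_zero]
    by_contra h
    exact hneg (by simpa using (coeff_iterate_derivative_nonneg_iff m 0).1 (not_lt.1 h))
  have hge : ∀ s, (∀ r ∈ f.roots, r ≤ s) → 0 ≤ f.eval s := by
    intro s hs
    rw [hfs.eval_eq_prod_roots]
    refine mul_nonneg hlead.le (Multiset.prod_nonneg ?_)
    intro b hb
    obtain ⟨r, hr, rfl⟩ := Multiset.mem_map.1 hb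
    exact sub_nonneg.2 (hs r hr)
  obtain ⟨r0, hr0, hr0pos⟩ : ∃ r ∈ f.roots, 0 < r := by
    by_contra! h
    exact absurd (hge 0 h) (not_le.2 hfneg)
  obtain ⟨s0, hs0, hmax⟩ := f.roots.toFinset.exists_max_image id
    ⟨r0, Multiset.mem_toFinset.2 hr0⟩
  simp only [id, Multiset.mem_toFinset] at hs0 hmax
  have hs0pos : 0 < s0 := hr0pos.trans_le (hmax r0 hr0)
  have hDpos : 0 < (derivative^[m] ((X + C a) * q)).eval s0 := by
    rw [eval_eq_sum_range, natDegree_iterate_derivative_eq, hdeg]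
    refine Finset.sum_pos (fun i hi => mul_pos ?_ (pow_pos hs0pos _)) ⟨0, by simp⟩
    rw [coeff_iterate_derivative_pos_iff]
    refine hpos _ (by omega) ?_
    have := Finset.mem_range.1 hi
    omega
  have hfs0 : f.eval s0 = 0 := isRoot_of_mem_roots hs0
  cases m with
  | zero =>
    simp only [Function.iterate_zero, id] at hf hDpos
    -- For m = 0 there is no F: the product (X + a)q itself vanishes at s₀.
    rw [eval_mul, ← hf, hfs0, mul_zero] at hDpos
    exact lt_irrefl _ hDpos
  | succ m =>
    rw [iterate_derivative_X_add_C_mul, ← hf, eval_add, eval_mul, hfs0, mul_zero, zero_add,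
      eval_mul] at hDpos
    set F := derivative^[m] q with hF
    have hfF : f = derivative F := by rw [hf, Function.iterate_succ_apply']
    have hFpos : 0 < F.eval s0 := by
      refine pos_of_mul_pos_right hDpos ?_
      simp
      positivity
    have hmono : MonotoneOn (fun x => F.eval x) (Ici s0) := by
      refine monotoneOn_of_deriv_nonneg (convex_Ici s0) F.continuous.continuousOn
        F.differentiable.differentiableOn fun x hx => ?_
      rw [Polynomial.deriv, ← hfF]
      rw [interior_Ici] at hx
      exact hge x fun r hr => (hmax r hr).trans (le_of_lt hx)
    have hFs : F.Splits := splits_iterate_derivative hq m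
    have hroot : ∀ u ∈ F.roots, 0 < 1 / (s0 - u) := by
      intro u hu
      refine one_div_pos.2 (sub_pos.2 ?_)
      by_contra h
      have h1 : F.eval s0 ≤ F.eval u := hmono (mem_Ici.2 le_rfl) (mem_Ici.2 (not_lt.1 h)) (not_lt.1 h)
      rw [isRoot_of_mem_roots hu] at h1
      exact absurd hFpos (not_lt.2 h1)
    have hsum := hFs.eval_derivative_div_eval_of_ne_zero hFpos.ne'
    rw [← hfF, hfs0, zero_div] at hsum
    have hne : F.roots ≠ 0 := by
      intro h
      have := hFs.natDegree_eq_card_roots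
      rw [h, hF, natDegree_iterate_derivative_eq, Multiset.card_zero] at this
      omega
    have : 0 < (F.roots.map fun z ↦ 1 / (s0 - z)).sum := by
      obtain ⟨u, hu⟩ := Multiset.exists_mem_of_ne_zero hne
      obtain ⟨t, ht⟩ := Multiset.exists_cons_of_mem hu
      rw [ht, Multiset.map_cons, Multiset.sum_cons]
      refine add_pos_of_pos_of_nonneg (hroot u hu) (Multiset.sum_nonneg ?_)
      intro b hb
      obtain ⟨z, hz, rfl⟩ := Multiset.mem_map.1 hb
      exact (hroot z (by rw [ht]; exact Multiset.mem_cons_of_mem hz)).le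
    exact this.ne hsum

end LinearAlgebra

/-! ### Diagonalization, ellipticity, and expansions at a scalar matrix. -/

section LinearAlgebra

open Matrix Polynomial

variable {d : ℕ}

theorem sigma_diagonal {k : ℕ} (hk : k ≤ d) (v : Fin d → ℝ) :
    sigma k (diagonal v) = (∏ j, (X + C (v j))).coeff (d - k) := by
  rw [Finset.prod_X_add_C_coeff _ _ (by simp), sigma_eq_sum_minors, Finset.card_univ,
    Fintype.card_fin, Nat.sub_sub_self hk]
  refine Finset.sum_congr rfl fun s _ => ?_
  rw [submatrix_diagonal _ _ Subtype.val_injective, det_diagonal]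
  exact Finset.prod_coe_sort s v

theorem newton_diagonal {k : ℕ} (hk : k < d) (v : Fin d → ℝ) :
    newton k (diagonal v) =
      diagonal fun i => (∏ j ∈ Finset.univ.erase i, (X + C (v j))).coeff (d - 1 - k) := by
  induction k with
  | zero =>
    rw [newton_zero, ← diagonal_one]
    congr 1
    funext i
    have hcard : (Finset.univ.erase i).card = d - 1 := by simp
    rw [Finset.prod_X_add_C_coeff _ _ (by rw [hcard]; simp), hcard]
    simp
  | succ k ih =>
    rw [newton_succ, ih (by omega), diagonal_mul_diagonal, sigma_diagonal hk.le,
      ← diagonal_one, ← diagonal_smul, diagonal_sub]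
    congr 1
    funext i
    have hp : (∏ j, (X + C (v j))) =
        (X + C (v i)) * ∏ j ∈ Finset.univ.erase i, (X + C (v j)) :=
      (Finset.mul_prod_erase _ _ (Finset.mem_univ i)).symm
    have e1 : d - (k + 1) = d - 1 - (k + 1) + 1 := by omega
    have e2 : d - 1 - k = d - 1 - (k + 1) + 1 := by omega
    rw [hp, e1, e2, add_mul, coeff_add, coeff_X_mul, coeff_C_mul]
    simp

theorem exists_orthogonal_diagonalization {A : Matrix (Fin d) (Fin d) ℝ} (hA : A.IsSymm) :
    ∃ (U : Matrix (Fin d) (Fin d) ℝ) (v : Fin d → ℝ), Uᵀ * U = 1 ∧ Uᵀ * A * U = diagonal v := by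
  have hA' : A.IsHermitian := by rw [IsHermitian, conjTranspose_eq_transpose_of_trivial]; exact hA
  refine ⟨hA'.eigenvectorUnitary, hA'.eigenvalues, ?_, ?_⟩
  · have := Unitary.coe_star_mul_self hA'.eigenvectorUnitary
    rwa [star_eq_conjTranspose, conjTranspose_eq_transpose_of_trivial] at this
  · have := hA'.conjStarAlgAut_star_eigenvectorUnitary
    rw [Unitary.conjStarAlgAut_apply] at this
    simpa [star_eq_conjTranspose, conjTranspose_eq_transpose_of_trivial] using this

theorem exists_simultaneous_diagonalization {G Y : Matrix (Fin d) (Fin d) ℝ} (hG : G.PosDef)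
    (hY : Y.IsSymm) :
    ∃ (P : Matrix (Fin d) (Fin d) ℝ) (v : Fin d → ℝ), Pᵀ * G * P = 1 ∧
      Pᵀ * Y * P = diagonal v := by
  have hGs : G.IsSymm := by
    have := hG.isHermitian
    rwa [IsHermitian, conjTranspose_eq_transpose_of_trivial] at this
  obtain ⟨U, μ, hU, hUG⟩ := exists_orthogonal_diagonalization hGs
  have hUu : IsUnit U := by
    rw [isUnit_iff_isUnit_det]
    exact isUnit_det_of_left_inverse hU
  have hμ : ∀ i, 0 < μ i := by
    have h : (diagonal μ).PosDef := by
      rw [← hUG]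
      have := (hUu.posDef_star_left_conjugate_iff (x := G)).2 hG
      rwa [star_eq_conjTranspose, conjTranspose_eq_transpose_of_trivial] at this
    exact posDef_diagonal_iff.1 h
  -- Congruence by U D, with D the inverse square root of the eigenvalues of G, normalizes G to the
  -- identity. The orthogonal V that then diagonalizes the transformed Y preserves this.
  set D : Matrix (Fin d) (Fin d) ℝ := diagonal fun i => (Real.sqrt (μ i))⁻¹
  have hD : D * diagonal μ * D = 1 := by
    rw [diagonal_mul_diagonal, diagonal_mul_diagonal, ← diagonal_one]
    congr 1
    funext i
    have : Real.sqrt (μ i) ≠ 0 := (Real.sqrt_pos.2 (hμ i)).ne'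
    field_simp
    rw [Real.sq_sqrt (hμ i).le]
  have hDt : Dᵀ = D := diagonal_transpose _
  have hY1 : ((U * D)ᵀ * Y * (U * D)).IsSymm := by
    simp only [IsSymm, transpose_mul, transpose_transpose, hY.eq, mul_assoc]
  obtain ⟨V, v, hV, hVY⟩ := exists_orthogonal_diagonalization hY1
  refine ⟨U * D * V, v, ?_, ?_⟩
  · calc (U * D * V)ᵀ * G * (U * D * V)
        = Vᵀ * (D * (Uᵀ * G * U) * D) * V := by
          rw [transpose_mul, transpose_mul, hDt]; simp only [mul_assoc]
      _ = 1 := by rw [hUG, hD, mul_one, hV]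
  · rw [← hVY, transpose_mul _ V]; simp only [mul_assoc]

theorem isUnit_det_of_transpose_mul_mul {G P : Matrix (Fin d) (Fin d) ℝ}
    (h : Pᵀ * G * P = 1) : IsUnit P.det := isUnit_det_of_left_inverse h

theorem inv_eq_mul_transpose {G P : Matrix (Fin d) (Fin d) ℝ}
    (h : Pᵀ * G * P = 1) : G⁻¹ = P * Pᵀ := by
  refine inv_eq_left_inv ?_
  have h1 : P * (Pᵀ * G) = 1 := mul_eq_one_comm.1 h
  rw [mul_assoc, h1]

theorem exists_diagonal_conj {G Y : Matrix (Fin d) (Fin d) ℝ} (hG : G.PosDef)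
    (hY : Y.IsSymm) :
    ∃ (P : Matrix (Fin d) (Fin d) ℝ) (v : Fin d → ℝ), IsUnit P.det ∧ G⁻¹ = P * Pᵀ ∧
      P⁻¹ * (G⁻¹ * Y) * P = diagonal v := by
  obtain ⟨P, v, h1, h2⟩ := exists_simultaneous_diagonalization hG hY
  have hP := isUnit_det_of_transpose_mul_mul h1
  have hGi := inv_eq_mul_transpose h1
  refine ⟨P, v, hP, hGi, ?_⟩
  rw [hGi, ← h2]
  calc P⁻¹ * (P * Pᵀ * Y) * P = (P⁻¹ * P) * Pᵀ * Y * P := by simp only [mul_assoc]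
    _ = _ := by rw [nonsing_inv_mul _ hP, one_mul]

theorem splits_prod_X_add_C (s : Finset (Fin d)) (v : Fin d → ℝ) :
    (∏ j ∈ s, (X + C (v j))).Splits :=
  Splits.prod fun j _ => Splits.X_add_C (v j)

theorem natDegree_prod_X_add_C (s : Finset (Fin d)) (v : Fin d → ℝ) :
    (∏ j ∈ s, (X + C (v j))).natDegree = s.card := by
  rw [natDegree_prod_of_monic _ _ fun j _ => monic_X_add_C (v j)]
  simp

/-- The cone `σ_1 > 0, …, σ_k > 0` is relatively closed in `σ_k > 0`. -/
theorem sigma_pos_of_nonneg {G Y : Matrix (Fin d) (Fin d) ℝ} (hG : G.PosDef) (hY : Y.IsSymm)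
    {k : ℕ} (hk : k ≤ d) (h0 : ∀ j ≤ k, 0 ≤ sigma j (G⁻¹ * Y)) (hpos : 0 < sigma k (G⁻¹ * Y))
    {j : ℕ} (hj : j ≤ k) : 0 < sigma j (G⁻¹ * Y) := by
  obtain ⟨P, v, hP, -, hPY⟩ := exists_diagonal_conj hG hY
  have hs : ∀ i, sigma i (G⁻¹ * Y) = sigma i (diagonal v) := fun i => by
    rw [← hPY, sigma_conj _ hP]
  simp only [hs] at *
  have hdeg := natDegree_prod_X_add_C Finset.univ v
  rw [Finset.card_univ, Fintype.card_fin] at hdeg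
  rw [sigma_diagonal (hj.trans hk)]
  -- σ_i is the coefficient of X^{d-i} in ∏ (X + v_j), so σ_0, …, σ_k are the coefficients of degree
  -- at least d - k.
  refine coeff_pos_of_splits_of_le (m := d - k) (splits_prod_X_add_C _ v) ?_ ?_ (by omega)
    (by rw [hdeg]; omega)
  · intro i hi
    rcases le_or_gt i d with h | h
    · have := h0 (d - i) (by omega)
      rwa [sigma_diagonal (by omega), Nat.sub_sub_self h] at this
    · rw [coeff_eq_zero_of_natDegree_lt (by rw [hdeg]; exact h)]
  · rwa [sigma_diagonal hk] at hpos

/-- Ellipticity: on the cone `σ_1 > 0, …, σ_k > 0` the Newton tensor `T_{k-1}` is nonnegative. -/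
theorem trace_newton_mul_nonneg {G Y H : Matrix (Fin d) (Fin d) ℝ} (hG : G.PosDef)
    (hY : Y.IsSymm) {k : ℕ} (hk : k < d) (hpos : ∀ j ≤ k + 1, 0 < sigma j (G⁻¹ * Y))
    (hH : H.PosSemidef) : 0 ≤ (newton k (G⁻¹ * Y) * (G⁻¹ * H)).trace := by
  obtain ⟨P, v, hP, hGi, hPY⟩ := exists_diagonal_conj hG hY
  have hs : ∀ i, sigma i (G⁻¹ * Y) = sigma i (diagonal v) := fun i => by
    rw [← hPY, sigma_conj _ hP]
  have hN : P * newton k (diagonal v) * P⁻¹ = newton k (G⁻¹ * Y) := by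
    rw [← hPY, newton_conj _ hP]
    calc P * (P⁻¹ * newton k (G⁻¹ * Y) * P) * P⁻¹ =
        (P * P⁻¹) * newton k (G⁻¹ * Y) * (P * P⁻¹) := by simp only [mul_assoc]
      _ = _ := by rw [mul_nonsing_inv _ hP, one_mul, mul_one]
  have htr : (newton k (G⁻¹ * Y) * (G⁻¹ * H)).trace =
      (newton k (diagonal v) * (Pᵀ * H * P)).trace := by
    rw [← hN, hGi]
    calc (P * newton k (diagonal v) * P⁻¹ * (P * Pᵀ * H)).trace
        = (P * (newton k (diagonal v) * (P⁻¹ * P) * (Pᵀ * H))).trace := by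
          simp only [mul_assoc]
      _ = _ := by
        rw [nonsing_inv_mul _ hP, mul_one, trace_mul_comm]
        simp only [mul_assoc]
  have hPH : (Pᵀ * H * P).PosSemidef := by
    have := hH.conjTranspose_mul_mul_same P
    rwa [conjTranspose_eq_transpose_of_trivial] at this
  rw [htr, newton_diagonal hk, trace]
  refine Finset.sum_nonneg fun i _ => ?_
  rw [diag_apply, diagonal_mul]
  refine mul_nonneg ?_ hPH.diag_nonneg
  have hdeg := natDegree_prod_X_add_C (Finset.univ.erase i) v
  have hcard : (Finset.univ.erase i).card = d - 1 := by simp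
  rw [hcard] at hdeg
  -- The i-th eigenvalue of T_k is σ_k of the other eigenvalues, the coefficient of degree m = d - 1
  -- - k in the product without X + v_i. In the full product the coefficients of degree m, …, d are
  -- σ_{k+1}, …, σ_0, all positive by `hpos`.
  refine coeff_nonneg_of_splits_mul (splits_prod_X_add_C _ v)
    (monic_prod_of_monic _ _ fun j _ => monic_X_add_C (v j)) (v i) (by rw [hdeg]; omega) ?_
  intro l hl hl'
  rw [hdeg] at hl'
  rw [Finset.mul_prod_erase _ (fun j => X + C (v j)) (Finset.mem_univ i)]
  have := hpos (d - l) (by omega)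
  rwa [hs, sigma_diagonal (by omega), Nat.sub_sub_self (by omega)] at this

theorem sum_range_split (f : ℕ → ℝ) (m : ℕ) :
    ∑ j ∈ Finset.range (m + 1), f j =
      f 0 + (if 1 ≤ m then f 1 else 0) + ∑ j ∈ Finset.Icc 2 m, f j := by
  rcases Nat.eq_zero_or_pos m with rfl | hm
  · simp
  · have : Finset.range (m + 1) = insert 0 (insert 1 (Finset.Icc 2 m)) := by
      ext j; simp; omega
    rw [this, Finset.sum_insert (by simp), Finset.sum_insert (by simp), if_pos (show 1 ≤ m from hm), add_assoc]

/-- The quadratic remainder in the expansion of `σ_k (c + r N)` in powers of `r`. -/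
def sigmaRemainder (k : ℕ) (c r : ℝ) (N : Matrix (Fin d) (Fin d) ℝ) : ℝ :=
  ∑ j ∈ Finset.Icc 2 k, ((d - j).choose (k - j) : ℝ) * c ^ (k - j) * (r ^ (j - 2) * sigma j N)

/-- The quadratic remainder in the expansion of `T_k (c + r N)` in powers of `r`. -/
def newtonRemainder (k : ℕ) (c r : ℝ) (N : Matrix (Fin d) (Fin d) ℝ) :
    Matrix (Fin d) (Fin d) ℝ :=
  ∑ j ∈ Finset.Icc 2 k,
    (((d - 1 - j).choose (k - j) : ℝ) * c ^ (k - j) * r ^ (j - 2)) • newton j N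

theorem sigma_expansion {k : ℕ} (hk1 : 1 ≤ k) (hk : k ≤ d) (c r : ℝ)
    (N : Matrix (Fin d) (Fin d) ℝ) :
    sigma k (c • 1 + r • N) = (d.choose k : ℝ) * c ^ k +
      r * (((d - 1).choose (k - 1) : ℝ) * c ^ (k - 1) * N.trace) +
      r ^ 2 * sigmaRemainder k c r N := by
  rw [sigma_smul_one_add hk, sum_range_split, if_pos hk1, sigmaRemainder, Finset.mul_sum]
  simp only [sigma_smul]
  rw [sigma_zero, sigma_one]
  congr 1
  · simp; ring
  · refine Finset.sum_congr rfl fun j hj => ?_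
    have hj2 : 2 ≤ j := (Finset.mem_Icc.1 hj).1
    obtain ⟨i, rfl⟩ := Nat.exists_eq_add_of_le hj2
    rw [Nat.add_sub_cancel_left, pow_add]; ring

/-- A matrix is determined by its traces against all H. Differentiating σ_{k+1}(c + B + εH) at ε =
0, directly and through `sigma_smul_one_add`, gives both sides. -/
theorem newton_smul_one_add {k : ℕ} (hk : k < d) (c : ℝ) (B : Matrix (Fin d) (Fin d) ℝ) :
    newton k (c • 1 + B) = ∑ j ∈ Finset.range (k + 1),
      (((d - 1 - j).choose (k - j) : ℝ) * c ^ (k - j)) • newton j B := by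
  refine ext_iff_trace_mul_right.2 fun H => ?_
  have hline : ∀ (A : Matrix (Fin d) (Fin d) ℝ) (i j : Fin d),
      HasDerivAt (fun ε : ℝ => (A + ε • H) i j) (H i j) 0 := by
    intro A i j
    simpa [Matrix.add_apply] using ((hasDerivAt_id (0 : ℝ)).mul_const (H i j)).const_add (A i j)
  have h1 := hasDerivAt_sigma k (hline (c • 1 + B))
  have h2 : HasDerivAt (fun ε : ℝ => sigma (k + 1) (c • 1 + B + ε • H))
      (∑ j ∈ Finset.range (k + 1), ((d - (j + 1)).choose (k + 1 - (j + 1)) : ℝ) *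
        c ^ (k + 1 - (j + 1)) * (newton j B * H).trace) 0 := by
    have e : ∀ ε : ℝ, sigma (k + 1) (c • 1 + B + ε • H) = ∑ j ∈ Finset.range (k + 1),
        ((d - (j + 1)).choose (k + 1 - (j + 1)) : ℝ) * c ^ (k + 1 - (j + 1)) *
          sigma (j + 1) (B + ε • H) + (d.choose (k + 1) : ℝ) * c ^ (k + 1) := by
      intro ε
      rw [add_assoc, sigma_smul_one_add hk, Finset.sum_range_succ', sigma_zero]
      simp
    simp only [e]
    refine (HasDerivAt.fun_sum fun j _ => ?_).add_const _
    simpa using (hasDerivAt_sigma j (hline B)).const_mul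
      (((d - (j + 1)).choose (k + 1 - (j + 1)) : ℝ) * c ^ (k + 1 - (j + 1)))
  have h3 := h1.unique h2
  rw [zero_smul, add_zero] at h3
  rw [h3, Finset.sum_mul, trace_sum]
  refine Finset.sum_congr rfl fun j _ => ?_
  rw [smul_mul_assoc, trace_smul, smul_eq_mul, Nat.add_sub_add_right, Nat.sub_sub, add_comm 1 j]

/-- The linear term is a multiple of T_1(N) = tr N - N. It is absent for k = 0, where truncated
subtraction would make its coefficient 1; hence the case distinction. -/
theorem newton_expansion {k : ℕ} (hk : k < d) (c r : ℝ) (N : Matrix (Fin d) (Fin d) ℝ) :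
    newton k (c • 1 + r • N) = (((d - 1).choose k : ℝ) * c ^ k) • 1 +
      r • (((if 1 ≤ k then ((d - 2).choose (k - 1) : ℝ) * c ^ (k - 1) else 0) •
        (N.trace • 1 - N)) + r • newtonRemainder k c r N) := by
  ext a b
  rw [newton_smul_one_add hk]
  simp only [newton_smul, Matrix.sum_apply, Matrix.add_apply, Matrix.smul_apply, smul_eq_mul,
    newtonRemainder]
  rw [sum_range_split, newton_zero, newton_one, mul_add, Finset.mul_sum, Finset.mul_sum, ← add_assoc]
  congr 1
  · split_ifs <;> simp [Matrix.sub_apply, Nat.sub_sub]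
    ring
  · refine Finset.sum_congr rfl fun j hj => ?_
    have hj2 : 2 ≤ j := (Finset.mem_Icc.1 hj).1
    obtain ⟨i, rfl⟩ := Nat.exists_eq_add_of_le hj2
    rw [Nat.add_sub_cancel_left, pow_add]; ring

end LinearAlgebra

end ConformallyCompact

set_option maxSynthPendingDepth 3

namespace ConformallyCompact

/-! ### Curvature of a connection and its naturality. -/

section Connection

open Filter Topology

variable {V : Type*} [NormedAddCommGroup V] [NormedSpace ℝ V]

/-- The curvature `R(u, v) w` of the connection with Christoffel form `Γ`. -/
def curvature (Γ : V → V →L[ℝ] V →L[ℝ] V) (y u v w : V) : V :=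
  fderiv ℝ Γ y u v w - fderiv ℝ Γ y v u w + Γ y u (Γ y v w) - Γ y v (Γ y u w)

theorem fderiv_clm_apply₂ {W : Type*} [NormedAddCommGroup W] [NormedSpace ℝ W]
    {Γ : V → V →L[ℝ] V →L[ℝ] W} {y : V} (hΓ : DifferentiableAt ℝ Γ y) {a b : V → V}
    (ha : DifferentiableAt ℝ a y) (hb : DifferentiableAt ℝ b y) (u : V) :
    fderiv ℝ (fun z => Γ z (a z) (b z)) y u =
      fderiv ℝ Γ y u (a y) (b y) + Γ y (fderiv ℝ a y u) (b y) + Γ y (a y) (fderiv ℝ b y u) := by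
  have h := ((hΓ.hasFDerivAt.clm_apply ha.hasFDerivAt).clm_apply hb.hasFDerivAt).fderiv
  rw [h]
  simp
  abel

/-- The curvature is a tensor: it is natural under changes of coordinates. -/
theorem curvature_comp {Γ Γ' : V → V →L[ℝ] V →L[ℝ] V} {ψ : V → V} {y : V}
    (hψ : ContDiffAt ℝ 3 ψ y) (hΓ : DifferentiableAt ℝ Γ (ψ y)) (hΓ' : DifferentiableAt ℝ Γ' y)
    (h : ∀ᶠ z in 𝓝 y, ∀ v w, fderiv ℝ ψ z (Γ' z v w) =
      fderiv ℝ (fderiv ℝ ψ) z v w + Γ (ψ z) (fderiv ℝ ψ z v) (fderiv ℝ ψ z w)) (u v w : V) :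
    fderiv ℝ ψ y (curvature Γ' y u v w) =
      curvature Γ (ψ y) (fderiv ℝ ψ y u) (fderiv ℝ ψ y v) (fderiv ℝ ψ y w) := by
  set J := fderiv ℝ ψ with hJ
  have hJ2 : ContDiffAt ℝ 2 J y := hψ.fderiv_right (by norm_num)
  have hJ1 : ContDiffAt ℝ 1 (fderiv ℝ J) y := hJ2.fderiv_right (by norm_num)
  have dψ : DifferentiableAt ℝ ψ y := hψ.differentiableAt (by norm_num)
  have dJ : DifferentiableAt ℝ J y := hJ2.differentiableAt (by norm_num)
  have dJ2 : DifferentiableAt ℝ (fderiv ℝ J) y := hJ1.differentiableAt (by norm_num)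
  have dc : ∀ v : V, DifferentiableAt ℝ (fun _ : V => v) y := fun v => differentiableAt_const v
  have dJv : ∀ v, DifferentiableAt ℝ (fun z => J z v) y := fun v => dJ.clm_apply (dc v)
  have fJv : ∀ v u, fderiv ℝ (fun z => J z v) y u = fderiv ℝ J y u v := by
    intro v u
    rw [(dJ.hasFDerivAt.clm_apply (dc v).hasFDerivAt).fderiv]
    simp
  -- The derivative of the transformation law in the direction u.
  have key : ∀ u v w, fderiv ℝ J y u (Γ' y v w) + J y (fderiv ℝ Γ' y u v w) =
      fderiv ℝ (fderiv ℝ J) y u v w + (fderiv ℝ Γ (ψ y) (J y u) (J y v) (J y w) +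
        Γ (ψ y) (fderiv ℝ J y u v) (J y w) + Γ (ψ y) (J y v) (fderiv ℝ J y u w)) := by
    intro u v w
    have h1 : (fun z => J z (Γ' z v w)) =ᶠ[𝓝 y]
        fun z => fderiv ℝ J z v w + Γ (ψ z) (J z v) (J z w) := by
      filter_upwards [h] with z hz using hz v w
    have dΓ'v : DifferentiableAt ℝ (fun z => Γ' z v w) y :=
      (hΓ'.clm_apply (dc v)).clm_apply (dc w)
    have h2 := congrArg (fun L : V →L[ℝ] V => L u) h1.fderiv_eq
    have e1 : fderiv ℝ (fun z => J z (Γ' z v w)) y u =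
        fderiv ℝ J y u (Γ' y v w) + J y (fderiv ℝ Γ' y u v w) := by
      rw [(dJ.hasFDerivAt.clm_apply dΓ'v.hasFDerivAt).fderiv]
      have := fderiv_clm_apply₂ hΓ' (dc v) (dc w) u
      simp at this
      simp [this]
      abel
    have dΓψ : DifferentiableAt ℝ (fun z => Γ (ψ z)) y :=
      DifferentiableAt.comp (g := Γ) y hΓ dψ
    have fΓψ : fderiv ℝ (fun z => Γ (ψ z)) y u = fderiv ℝ Γ (ψ y) (J y u) := by
      have := (HasFDerivAt.comp (g := Γ) y hΓ.hasFDerivAt dψ.hasFDerivAt).fderiv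
      simp only [Function.comp_def] at this
      rw [this]; rfl
    have e2 : fderiv ℝ (fun z => fderiv ℝ J z v w) y u = fderiv ℝ (fderiv ℝ J) y u v w := by
      have := fderiv_clm_apply₂ dJ2 (dc v) (dc w) u
      simpa using this
    have e3 := fderiv_clm_apply₂ dΓψ (dJv v) (dJv w) u
    rw [fΓψ, fJv, fJv] at e3
    have e4 : fderiv ℝ (fun z => fderiv ℝ J z v w + Γ (ψ z) (J z v) (J z w)) y u =
        fderiv ℝ (fun z => fderiv ℝ J z v w) y u +
          fderiv ℝ (fun z => Γ (ψ z) (J z v) (J z w)) y u := by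
      rw [fderiv_fun_add ((dJ2.clm_apply (dc v)).clm_apply (dc w))
        ((dΓψ.clm_apply (dJv v)).clm_apply (dJv w))]
      rfl
    rw [e1, e4, e2, e3] at h2
    exact h2
  have hy := h.self_of_nhds
  have s3 : ∀ u v w, fderiv ℝ (fderiv ℝ J) y u v w = fderiv ℝ (fderiv ℝ J) y v u w := by
    intro u v w
    have := (hJ2.isSymmSndFDerivAt (by simp)) u v
    rw [this]
  have s2 : ∀ u v, fderiv ℝ J y u v = fderiv ℝ J y v u :=
    fun u v => (hψ.isSymmSndFDerivAt (by simp; norm_num)) u v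
  -- Antisymmetrize in u and v: the third derivative of ψ and the terms with the second derivative
  -- in the first slot are symmetric and cancel. The second derivative applied to (u, Γ'(v, w)) is
  -- eliminated by the law itself, which produces the quadratic terms of the curvature.
  have k1 := key u v w
  have k2 := key v u w
  have a1 := hy u (Γ' y v w)
  have a2 := hy v (Γ' y u w)
  rw [hy v w, map_add] at a1
  rw [hy u w, map_add] at a2
  rw [s3 v u w, s2 v u] at k2
  simp only [curvature, map_sub, map_add]
  have k1' := eq_sub_of_add_eq' k1
  have k2' := eq_sub_of_add_eq' k2
  rw [k1', k2', a1, a2]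
  abel

end Connection

/-! ### The Levi-Civita connection: Koszul formula, symmetries of the curvature, conformal change.
-/

section LeviCivita

open Filter Topology

variable {V : Type*} [NormedAddCommGroup V] [NormedSpace ℝ V]

/-- The Koszul formula at `y`: `Γ` is the Levi-Civita connection of `g`. -/
def IsKoszul (g : V → V →L[ℝ] V →L[ℝ] ℝ) (Γ : V → V →L[ℝ] V →L[ℝ] V) (y : V) : Prop :=
  ∀ v w u, 2 * g y (Γ y v w) u = fderiv ℝ g y v w u + fderiv ℝ g y w v u - fderiv ℝ g y u v w

/-- The bilinear form is nondegenerate. -/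
def IsNondeg (b : V →L[ℝ] V →L[ℝ] ℝ) : Prop := ∀ x, (∀ u, b x u = 0) → x = 0

/-- The bilinear form is symmetric. -/
def IsSymmForm {W : Type*} [NormedAddCommGroup W] [NormedSpace ℝ W] (b : V →L[ℝ] V →L[ℝ] W) :
    Prop := ∀ v w, b v w = b w v

theorem IsNondeg.eq {b : V →L[ℝ] V →L[ℝ] ℝ} (hb : IsNondeg b) {x x' : V}
    (h : ∀ u, b x u = b x' u) : x = x' :=
  sub_eq_zero.1 (hb _ fun u => by simp [h u])

theorem fderiv_clm_const₂ {W : Type*} [NormedAddCommGroup W] [NormedSpace ℝ W]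
    {Γ : V → V →L[ℝ] V →L[ℝ] W} {y : V} (hΓ : DifferentiableAt ℝ Γ y) (v w u : V) :
    fderiv ℝ (fun z => Γ z v w) y u = fderiv ℝ Γ y u v w := by
  simpa using fderiv_clm_apply₂ hΓ (differentiableAt_const v) (differentiableAt_const w) u

theorem isSymmForm_fderiv {W : Type*} [NormedAddCommGroup W] [NormedSpace ℝ W]
    {g : V → V →L[ℝ] V →L[ℝ] W} {y : V}
    (hg : DifferentiableAt ℝ g y) (hs : ∀ᶠ z in 𝓝 y, IsSymmForm (g z)) (u : V) :
    IsSymmForm (fderiv ℝ g y u) := by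
  intro v w
  rw [← fderiv_clm_const₂ hg, ← fderiv_clm_const₂ hg]
  have : (fun z => g z v w) =ᶠ[𝓝 y] fun z => g z w v := by
    filter_upwards [hs] with z hz using hz v w
  rw [this.fderiv_eq]

theorem IsKoszul.isSymmForm {g : V → V →L[ℝ] V →L[ℝ] ℝ} {Γ : V → V →L[ℝ] V →L[ℝ] V} {y : V}
    (h : IsKoszul g Γ y) (hn : IsNondeg (g y)) (hg : DifferentiableAt ℝ g y)
    (hs : ∀ᶠ z in 𝓝 y, IsSymmForm (g z)) : IsSymmForm (Γ y) := by
  intro v w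
  refine hn.eq fun u => ?_
  have h1 := h v w u
  have h2 := h w v u
  have h3 := isSymmForm_fderiv hg hs u v w
  linarith

/-- Metric compatibility ∇g = 0: add the Koszul formulas for (u, v, w) and (u, w, v); the other
derivatives cancel. -/
theorem IsKoszul.fderiv_eq {g : V → V →L[ℝ] V →L[ℝ] ℝ} {Γ : V → V →L[ℝ] V →L[ℝ] V} {y : V}
    (h : IsKoszul g Γ y) (hg : DifferentiableAt ℝ g y)
    (hs : ∀ᶠ z in 𝓝 y, IsSymmForm (g z)) (u v w : V) :
    fderiv ℝ g y u v w = g y (Γ y u v) w + g y v (Γ y u w) := by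
  have h1 := h u v w
  have h2 := h u w v
  have h3 := isSymmForm_fderiv hg hs u v w
  have h4 := hs.self_of_nhds v (Γ y u w)
  have h5 := isSymmForm_fderiv hg hs v u w
  have h6 := isSymmForm_fderiv hg hs w u v
  linarith

/-- Transformation law of the Christoffel form. -/
theorem IsKoszul.comp {g g' : V → V →L[ℝ] V →L[ℝ] ℝ} {Γ Γ' : V → V →L[ℝ] V →L[ℝ] V} {ψ : V → V}
    {y : V} (h : IsKoszul g Γ (ψ y)) (h' : IsKoszul g' Γ' y) (hψ : ContDiffAt ℝ 2 ψ y)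
    (hJ : Function.Surjective (fderiv ℝ ψ y)) (hn : IsNondeg (g (ψ y)))
    (hs : ∀ᶠ z in 𝓝 (ψ y), IsSymmForm (g z)) (hg : DifferentiableAt ℝ g (ψ y))
    (hg' : DifferentiableAt ℝ g' y)
    (heq : ∀ᶠ z in 𝓝 y, ∀ v w, g' z v w = g (ψ z) (fderiv ℝ ψ z v) (fderiv ℝ ψ z w)) (v w : V) :
    fderiv ℝ ψ y (Γ' y v w) =
      fderiv ℝ (fderiv ℝ ψ) y v w + Γ (ψ y) (fderiv ℝ ψ y v) (fderiv ℝ ψ y w) := by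
  set J := fderiv ℝ ψ with hJdef
  have hJ1 : ContDiffAt ℝ 1 J y := hψ.fderiv_right (by norm_num)
  have dψ : DifferentiableAt ℝ ψ y := hψ.differentiableAt (by norm_num)
  have dJ : DifferentiableAt ℝ J y := hJ1.differentiableAt (by norm_num)
  have dJv : ∀ v, DifferentiableAt ℝ (fun z => J z v) y :=
    fun v => dJ.clm_apply (differentiableAt_const v)
  have fJv : ∀ v u, fderiv ℝ (fun z => J z v) y u = fderiv ℝ J y u v := by
    intro v u
    rw [(dJ.hasFDerivAt.clm_apply (differentiableAt_const v).hasFDerivAt).fderiv]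
    simp
  have s2 : ∀ u v, fderiv ℝ J y u v = fderiv ℝ J y v u :=
    fun u v => (hψ.isSymmSndFDerivAt (by simp)) u v
  -- In the alternating sum of the Koszul formula for g', the terms with the second derivative of ψ
  -- cancel except those pairing it at (v, w) with J u, by its symmetry.
  have key : ∀ u v w, fderiv ℝ g' y u v w = fderiv ℝ g (ψ y) (J y u) (J y v) (J y w) +
      g (ψ y) (fderiv ℝ J y u v) (J y w) + g (ψ y) (J y v) (fderiv ℝ J y u w) := by
    intro u v w
    have dgψ : DifferentiableAt ℝ (fun z => g (ψ z)) y :=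
      DifferentiableAt.comp (g := g) y hg dψ
    have fgψ : fderiv ℝ (fun z => g (ψ z)) y u = fderiv ℝ g (ψ y) (J y u) := by
      have := (HasFDerivAt.comp (g := g) y hg.hasFDerivAt dψ.hasFDerivAt).fderiv
      simp only [Function.comp_def] at this
      rw [this]; rfl
    have e := fderiv_clm_apply₂ dgψ (dJv v) (dJv w) u
    rw [fgψ, fJv, fJv] at e
    rw [← e, ← fderiv_clm_const₂ hg']
    have : (fun z => g' z v w) =ᶠ[𝓝 y] fun z => g (ψ z) (J z v) (J z w) := by
      filter_upwards [heq] with z hz using hz v w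
    rw [this.fderiv_eq]
  have hy := heq.self_of_nhds
  have hsy := hs.self_of_nhds
  refine hn.eq fun u' => ?_
  obtain ⟨u, rfl⟩ := hJ u'
  have h1 := h' v w u
  rw [hy, key, key, key] at h1
  have h2 := h (J y v) (J y w) (J y u)
  rw [map_add, add_apply]
  have h3 := hsy (fderiv ℝ J y u v) (J y w)
  have h4 := hsy (J y w) (fderiv ℝ J y v u)
  have h5 := hsy (J y v) (fderiv ℝ J y w u)
  rw [s2 w v, s2 w u] at h1
  rw [s2 v u] at h4 h1
  rw [s2 w u] at h5
  linarith

/-- The difference of the Levi-Civita connections of the metrics `e^{2w} g` and `g`, where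
`θ = dw` and `X = ∇w`. -/
def conformalShift (b : V →L[ℝ] V →L[ℝ] ℝ) (θ : V →L[ℝ] ℝ) (X : V) (v w : V) : V :=
  θ v • w + θ w • v - b v w • X

/-- With f = e^{2w} and θ = dw one has dg' = f(2θ ⊗ g + dg). In the Koszul formula the factor f
drops out, and the extra terms are `conformalShift` paired with u; nondegeneracy removes the
pairing. -/
theorem IsKoszul.conformal {g g' : V → V →L[ℝ] V →L[ℝ] ℝ} {Γ Γ' : V → V →L[ℝ] V →L[ℝ] V}
    {y : V} {f : V → ℝ} {θ : V →L[ℝ] ℝ} {X : V}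
    (h : IsKoszul g Γ y) (h' : IsKoszul g' Γ' y) (hn : IsNondeg (g y))
    (hs : ∀ᶠ z in 𝓝 y, IsSymmForm (g z)) (hg : DifferentiableAt ℝ g y)
    (hf : HasFDerivAt f ((2 * f y) • θ) y) (hf0 : f y ≠ 0)
    (heq : g' =ᶠ[𝓝 y] fun z => f z • g z) (hX : ∀ v, g y X v = θ v) (v w : V) :
    Γ' y v w = Γ y v w + conformalShift (g y) θ X v w := by
  have key : ∀ u v w, fderiv ℝ g' y u v w =
      f y * (2 * θ u * g y v w + fderiv ℝ g y u v w) := by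
    intro u v w
    rw [heq.fderiv_eq, (hf.fun_smul hg.hasFDerivAt).fderiv]
    simp
    ring
  have hsy := hs.self_of_nhds
  refine hn.eq fun u => ?_
  have h1 := h' v w u
  rw [key, key, key, heq.self_of_nhds] at h1
  have h2 := h v w u
  simp only [smul_apply, smul_eq_mul] at h1
  have h3 : g y (Γ' y v w) u = g y (Γ y v w) u + θ v * g y w u + θ w * g y v u - θ u * g y v w := by
    have : f y * (2 * g y (Γ' y v w) u) = f y * (2 * (g y (Γ y v w) u + θ v * g y w u +
      θ w * g y v u - θ u * g y v w)) := by
      linear_combination h1 - f y * h2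
    have := mul_left_cancel₀ hf0 this
    linarith
  rw [h3, conformalShift]
  simp only [map_add, map_sub, map_smul, add_apply,
    sub_apply, smul_apply, smul_eq_mul, hX]
  ring

/-- The curvature operator is skew-adjoint. -/
theorem IsKoszul.curvature_skew {g : V → V →L[ℝ] V →L[ℝ] ℝ} {Γ : V → V →L[ℝ] V →L[ℝ] V} {y : V}
    (h : ∀ᶠ z in 𝓝 y, IsKoszul g Γ z) (hg : ContDiffAt ℝ 2 g y) (hΓ : DifferentiableAt ℝ Γ y)
    (hs : ∀ᶠ z in 𝓝 y, IsSymmForm (g z)) (u v w x : V) :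
    g y (curvature Γ y u v w) x + g y w (curvature Γ y u v x) = 0 := by
  have dg : DifferentiableAt ℝ g y := hg.differentiableAt (by norm_num)
  have hdg : ∀ᶠ z in 𝓝 y, DifferentiableAt ℝ g z := by
    filter_upwards [hg.eventually (by simp)] with z hz using hz.differentiableAt (by norm_num)
  have dg2 : DifferentiableAt ℝ (fderiv ℝ g) y :=
    (hg.fderiv_right (m := 1) (by norm_num)).differentiableAt (by norm_num)
  have s2 : ∀ u v, fderiv ℝ (fderiv ℝ g) y u v = fderiv ℝ (fderiv ℝ g) y v u :=
    fun u v => (hg.isSymmSndFDerivAt (by simp)) u v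
  have dc : ∀ v : V, DifferentiableAt ℝ (fun _ : V => v) y := fun v => differentiableAt_const v
  have dΓv : ∀ v w, DifferentiableAt ℝ (fun z => Γ z v w) y :=
    fun v w => (hΓ.clm_apply (dc v)).clm_apply (dc w)
  -- The derivative of ∇g = 0. Its left side is symmetric in u and v, so antisymmetrizing leaves the
  -- curvature terms alone.
  have key : ∀ u v w x, fderiv ℝ (fderiv ℝ g) y u v w x =
      (fderiv ℝ g y u (Γ y v w) x + g y (fderiv ℝ Γ y u v w) x) +
      (fderiv ℝ g y u w (Γ y v x) + g y w (fderiv ℝ Γ y u v x)) := by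
    intro u v w x
    have h1 : (fun z => fderiv ℝ g z v w x) =ᶠ[𝓝 y]
        fun z => g z (Γ z v w) x + g z w (Γ z v x) := by
      filter_upwards [h, hdg, hs.eventually_nhds] with z hz hz' hz''
      exact hz.fderiv_eq hz' hz'' v w x
    have dgv : DifferentiableAt ℝ (fun z => fderiv ℝ g z v) y := dg2.clm_apply (dc v)
    have fgv : fderiv ℝ (fun z => fderiv ℝ g z v) y u = fderiv ℝ (fderiv ℝ g) y u v := by
      rw [(dg2.hasFDerivAt.clm_apply (dc v).hasFDerivAt).fderiv]
      simp
    have e1 := fderiv_clm_const₂ dgv w x u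
    rw [fgv] at e1
    have e2 := fderiv_clm_apply₂ dg (dΓv v w) (dc x) u
    have e3 := fderiv_clm_apply₂ dg (dc w) (dΓv v x) u
    rw [fderiv_clm_const₂ hΓ] at e2 e3
    have e4 := congrArg (fun L : V →L[ℝ] ℝ => L u) h1.fderiv_eq
    rw [fderiv_fun_add ((dg.clm_apply (dΓv v w)).clm_apply (dc x))
        ((dg.clm_apply (dc w)).clm_apply (dΓv v x))] at e4
    simp only [add_apply] at e4
    rw [e1, e2, e3] at e4
    simpa using e4
  have hc := h.self_of_nhds.fderiv_eq dg hs
  have k1 := key u v w x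
  have k2 := key v u w x
  rw [s2 v u, k1] at k2
  simp only [hc] at k2
  simp only [curvature, map_add, map_sub, add_apply,
    sub_apply]
  linarith

/-- The first Bianchi identity. -/
theorem curvature_bianchi {Γ : V → V →L[ℝ] V →L[ℝ] V} {y : V} (hΓ : DifferentiableAt ℝ Γ y)
    (hs : ∀ᶠ z in 𝓝 y, IsSymmForm (Γ z)) (u v w : V) :
    curvature Γ y u v w + curvature Γ y v w u + curvature Γ y w u v = 0 := by
  have h := isSymmForm_fderiv hΓ hs
  have hy := hs.self_of_nhds
  simp only [curvature]
  rw [h u v w, h v w u, h w u v, hy v w, hy u w, hy u v]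
  abel

/-- The curvature of the Levi-Civita connection of a conformal metric. Here `f = e^{2w}`,
`θ = dw` and `X = ∇w`. -/
theorem curvature_conformal {g : V → V →L[ℝ] V →L[ℝ] ℝ} {Γ Γ' : V → V →L[ℝ] V →L[ℝ] V} {y : V}
    {θ : V → V →L[ℝ] ℝ} {X : V → V} (h : ∀ᶠ z in 𝓝 y, IsKoszul g Γ z)
    (hs : ∀ᶠ z in 𝓝 y, IsSymmForm (g z))
    (hsΓ : IsSymmForm (Γ y)) (hsθ : ∀ u v, fderiv ℝ θ y u v = fderiv ℝ θ y v u)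
    (hg : DifferentiableAt ℝ g y) (hΓ : DifferentiableAt ℝ Γ y) (hθ : DifferentiableAt ℝ θ y)
    (hXd : DifferentiableAt ℝ X y) (hX : ∀ᶠ z in 𝓝 y, ∀ v, g z (X z) v = θ z v)
    (hΓ' : DifferentiableAt ℝ Γ' y)
    (heq : ∀ᶠ z in 𝓝 y, ∀ v w, Γ' z v w = Γ z v w + conformalShift (g z) (θ z) (X z) v w) :
    ∃ S : V →L[ℝ] V, (∀ u v, g y (S u) v = fderiv ℝ θ y u v - θ y (Γ y u v)) ∧ ∀ u v w : V,
    curvature Γ' y u v w = curvature Γ y u v w +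
      ((fderiv ℝ θ y u w - θ y (Γ y u w)) • v - (fderiv ℝ θ y v w - θ y (Γ y v w)) • u
        - g y v w • S u + g y u w • S v) +
      ((θ y v * θ y w) • u - (θ y u * θ y w) • v -
        θ y (X y) • (g y v w • u - g y u w • v) + (θ y u * g y v w - θ y v * g y u w) • X y) := by
  have dc : ∀ v : V, DifferentiableAt ℝ (fun _ : V => v) y := fun v => differentiableAt_const v
  have hc := h.self_of_nhds.fderiv_eq hg hs
  have hXy := hX.self_of_nhds
  have hsy := hs.self_of_nhds
  have hXy' : ∀ v, g y v (X y) = θ y v := fun v => by rw [hsy, hXy]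
  have dθv : ∀ v, DifferentiableAt ℝ (fun z => θ z v) y := fun v => hθ.clm_apply (dc v)
  have fθv : ∀ v u, fderiv ℝ (fun z => θ z v) y u = fderiv ℝ θ y u v := by
    intro v u
    rw [(hθ.hasFDerivAt.clm_apply (dc v).hasFDerivAt).fderiv]
    simp
  -- S is the covariant derivative of X = ∇w, that is, the Hessian of w with an index raised.
  refine ⟨fderiv ℝ X y + (Γ y).flip (X y), ?_, ?_⟩
  · intro u v
    have e1 : (fun z => g z (X z) v) =ᶠ[𝓝 y] fun z => θ z v := by
      filter_upwards [hX] with z hz using hz v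
    have e2 := fderiv_clm_apply₂ hg hXd (dc v) u
    rw [e1.fderiv_eq, fθv, hc, hXy] at e2
    simp only [add_apply, ContinuousLinearMap.flip_apply, map_add]
    simp at e2
    linarith
  · intro u v w
    have hΓ'y := heq.self_of_nhds
    have key : ∀ u v w, fderiv ℝ Γ' y u v w = fderiv ℝ Γ y u v w + (fderiv ℝ θ y u v • w +
        fderiv ℝ θ y u w • v - ((g y (Γ y u v) w + g y v (Γ y u w)) • X y +
          g y v w • fderiv ℝ X y u)) := by
      intro u v w
      rw [← fderiv_clm_const₂ hΓ']
      have e1 : (fun z => Γ' z v w) =ᶠ[𝓝 y]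
          fun z => Γ z v w + (θ z v • w + θ z w • v - g z v w • X z) := by
        filter_upwards [heq] with z hz using hz v w
      have d1 : DifferentiableAt ℝ (fun z => Γ z v w) y := (hΓ.clm_apply (dc v)).clm_apply (dc w)
      have d2 : DifferentiableAt ℝ (fun z => g z v w) y := (hg.clm_apply (dc v)).clm_apply (dc w)
      have f1 : ∀ v w : V, fderiv ℝ (fun z => θ z v • w) y u = fderiv ℝ θ y u v • w := by
        intro v w
        rw [((dθv v).hasFDerivAt.smul_const w).fderiv, ← fθv]
        simp
      have f2 : fderiv ℝ (fun z => g z v w • X z) y u =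
          (g y (Γ y u v) w + g y v (Γ y u w)) • X y + g y v w • fderiv ℝ X y u := by
        rw [(d2.hasFDerivAt.fun_smul hXd.hasFDerivAt).fderiv]
        simp [fderiv_clm_const₂ hg, hc]
        abel
      rw [e1.fderiv_eq, fderiv_fun_add d1
        ((((dθv v).smul_const w).fun_add ((dθv w).smul_const v)).fun_sub (d2.fun_smul hXd)),
        fderiv_fun_sub (((dθv v).smul_const w).fun_add ((dθv w).smul_const v)) (d2.fun_smul hXd),
        fderiv_fun_add ((dθv v).smul_const w) ((dθv w).smul_const v)]
      simp only [add_apply, sub_apply, f1, f2, fderiv_clm_const₂ hΓ]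
    simp only [curvature, key, hΓ'y, conformalShift, add_apply, map_add, map_sub,
      map_smul, ContinuousLinearMap.flip_apply, hXy', smul_eq_mul]
    rw [hsθ v u, hsΓ v u, hsy v u]
    module

end LeviCivita

/-! ### Smooth dependence of determinants, inverses, σ_k and Newton tensors on the matrix. -/

section Regularity

open Matrix

variable {V : Type*} [NormedAddCommGroup V] [NormedSpace ℝ V] {m : WithTop ℕ∞} {s : Set V} {y : V}

theorem contDiffWithinAt_det {ι : Type*} [Fintype ι] [DecidableEq ι] {A : V → Matrix ι ι ℝ}
    (hA : ∀ i j, ContDiffWithinAt ℝ m (fun z => A z i j) s y) :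
    ContDiffWithinAt ℝ m (fun z => (A z).det) s y := by
  simp only [det_apply']
  refine ContDiffWithinAt.sum fun σ _ => contDiffWithinAt_const.mul ?_
  exact contDiffWithinAt_prod fun i _ => hA _ _

theorem contDiffWithinAt_matrix_inv {ι : Type*} [Fintype ι] [DecidableEq ι] {A : V → Matrix ι ι ℝ}
    (hA : ∀ i j, ContDiffWithinAt ℝ m (fun z => A z i j) s y) (h0 : (A y).det ≠ 0) (i j : ι) :
    ContDiffWithinAt ℝ m (fun z => (A z)⁻¹ i j) s y := by
  have h1 : ∀ z, (A z)⁻¹ i j = (A z).det⁻¹ * ((A z).updateRow j (Pi.single i 1)).det := by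
    intro z
    rw [inv_def, Ring.inverse_eq_inv', Matrix.smul_apply, smul_eq_mul, adjugate_apply]
  simp only [h1]
  refine ((contDiffWithinAt_det hA).inv h0).mul (contDiffWithinAt_det fun a b => ?_)
  rcases eq_or_ne a j with rfl | ha
  · simpa using contDiffWithinAt_const
  · simpa [updateRow_ne ha] using hA a b

theorem contDiffWithinAt_matrix_mul {ι κ l : Type*} [Fintype κ] {A : V → Matrix ι κ ℝ}
    {B : V → Matrix κ l ℝ}
    (hA : ∀ i j, ContDiffWithinAt ℝ m (fun z => A z i j) s y)
    (hB : ∀ i j, ContDiffWithinAt ℝ m (fun z => B z i j) s y) (i : ι) (j : l) :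
    ContDiffWithinAt ℝ m (fun z => (A z * B z) i j) s y := by
  simp only [mul_apply]
  exact ContDiffWithinAt.sum fun a _ => (hA _ _).mul (hB _ _)

theorem contDiffWithinAt_sigma {d : ℕ} (k : ℕ) {A : V → Matrix (Fin d) (Fin d) ℝ}
    (hA : ∀ i j, ContDiffWithinAt ℝ m (fun z => A z i j) s y) :
    ContDiffWithinAt ℝ m (fun z => sigma k (A z)) s y := by
  simp only [sigma_eq_sum_minors]
  exact ContDiffWithinAt.sum fun t _ => contDiffWithinAt_det fun i j => hA _ _

theorem contDiffWithinAt_newton {d : ℕ} (k : ℕ) {A : V → Matrix (Fin d) (Fin d) ℝ}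
    (hA : ∀ i j, ContDiffWithinAt ℝ m (fun z => A z i j) s y) (i j : Fin d) :
    ContDiffWithinAt ℝ m (fun z => newton k (A z) i j) s y := by
  induction k generalizing i j with
  | zero => exact contDiffWithinAt_const
  | succ k ih =>
    simp only [newton_succ, Matrix.sub_apply, Matrix.smul_apply, smul_eq_mul]
    exact ((contDiffWithinAt_sigma _ hA).mul contDiffWithinAt_const).sub
      (contDiffWithinAt_matrix_mul hA ih i j)

end Regularity

/-! ### From index notation to bilinear forms on the coordinate space. -/

section Coordinates

open Filter Topology

variable {n : ℕ}

/-- The space of coordinates of a chart. -/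
abbrev Coord (n : ℕ) := EuclideanSpace ℝ (Fin (n + 1))

/-- The coordinate vector `∂_i`. -/
abbrev basisVec (i : Fin (n + 1)) : Coord n := EuclideanSpace.single i 1

theorem sum_smul_basisVec (v : Coord n) : ∑ i, v i • (basisVec i : Coord n) = v := by
  ext j
  simp [Finset.sum_apply, Pi.single_apply]

theorem basisVec_induction {p : Coord n → Prop} (hadd : ∀ v w, p v → p w → p (v + w))
    (hsmul : ∀ (c : ℝ) v, p v → p (c • v)) (hb : ∀ i, p (basisVec i)) (v : Coord n) : p v := by
  rw [← sum_smul_basisVec v]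
  refine Finset.sum_induction _ p hadd ?_ fun i _ => hsmul _ _ (hb i)
  simpa using hsmul 0 _ (hb 0)

theorem sum_mul_map_basisVec (L : Coord n →L[ℝ] ℝ) (v : Coord n) :
    ∑ i, L (basisVec i) * v i = L v := by
  conv_rhs => rw [← sum_smul_basisVec v, map_sum]
  refine Finset.sum_congr rfl fun i _ => ?_
  rw [map_smul, smul_eq_mul, mul_comm]

/-- The bilinear map with the values `T i j` on the coordinate vectors. -/
def bilin {W : Type*} [NormedAddCommGroup W] [NormedSpace ℝ W]
    (T : Fin (n + 1) → Fin (n + 1) → W) : Coord n →L[ℝ] Coord n →L[ℝ] W :=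
  ∑ i, ∑ j, (EuclideanSpace.proj i : Coord n →L[ℝ] ℝ).smulRight
    ((EuclideanSpace.proj j : Coord n →L[ℝ] ℝ).smulRight (T i j))

variable {W : Type*} [NormedAddCommGroup W] [NormedSpace ℝ W]

theorem bilin_apply (T : Fin (n + 1) → Fin (n + 1) → W) (v w : Coord n) :
    bilin T v w = ∑ i, ∑ j, v i • w j • T i j := by
  simp [bilin]

theorem bilin_basisVec (T : Fin (n + 1) → Fin (n + 1) → W) (i j : Fin (n + 1)) :
    bilin T (basisVec i) (basisVec j) = T i j := by
  simp [bilin_apply]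

theorem bilin_ext {B B' : Coord n →L[ℝ] Coord n →L[ℝ] W}
    (h : ∀ i j, B (basisVec i) (basisVec j) = B' (basisVec i) (basisVec j)) : B = B' := by
  ext v w
  rw [← sum_smul_basisVec v, ← sum_smul_basisVec w]
  simp only [map_sum, map_smul, sum_apply, smul_apply, h]

theorem contDiffAt_bilin {m : WithTop ℕ∞} {T : Coord n → Fin (n + 1) → Fin (n + 1) → W}
    {y : Coord n} (hT : ∀ i j, ContDiffAt ℝ m (fun z => T z i j) y) :
    ContDiffAt ℝ m (fun z => bilin (T z)) y := by
  unfold bilin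
  refine ContDiffAt.sum fun i _ => ContDiffAt.sum fun j _ => ?_
  exact contDiffAt_const.smulRight (contDiffAt_const.smulRight (hT i j))

theorem fderiv_bilin {T : Coord n → Fin (n + 1) → Fin (n + 1) → W}
    {y : Coord n} (hT : ∀ i j, ContDiffAt ℝ 1 (fun z => T z i j) y) (u : Coord n)
    (i j : Fin (n + 1)) :
    fderiv ℝ (fun z => bilin (T z)) y u (basisVec i) (basisVec j) =
      fderiv ℝ (fun z => T z i j) y u := by
  rw [← fderiv_clm_const₂ ((contDiffAt_bilin hT).differentiableAt (by norm_num))]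
  simp only [bilin_basisVec]

/-- `G` is a Riemannian metric of class `C^2` near `y`. -/
structure IsMetricAt (G : Coord n → Matrix (Fin (n + 1)) (Fin (n + 1)) ℝ) (y : Coord n) :
    Prop where
  contDiffAt : ∀ i j, ContDiffAt ℝ 2 (fun z => G z i j) y
  posDef : ∀ᶠ z in 𝓝 y, (G z).PosDef

variable {G : Coord n → Matrix (Fin (n + 1)) (Fin (n + 1)) ℝ} {y : Coord n}

theorem isSymm_of_posDef {d : ℕ} {A : Matrix (Fin d) (Fin d) ℝ} (h : A.PosDef) : A.IsSymm := by
  have := h.isHermitian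
  rwa [Matrix.IsHermitian, Matrix.conjTranspose_eq_transpose_of_trivial] at this

theorem IsMetricAt.eventually (h : IsMetricAt G y) : ∀ᶠ z in 𝓝 y, IsMetricAt G z := by
  have h1 : ∀ᶠ z in 𝓝 y, ∀ i j, ContDiffAt ℝ 2 (fun z => G z i j) z := by
    simp only [eventually_all]
    exact fun i j => (h.contDiffAt i j).eventually (by simp)
  filter_upwards [h1, h.posDef.eventually_nhds] with z hz hz'
  exact ⟨hz, hz'⟩

theorem IsMetricAt.posDef_self (h : IsMetricAt G y) : (G y).PosDef := h.posDef.self_of_nhds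

theorem IsMetricAt.det_ne_zero (h : IsMetricAt G y) : (G y).det ≠ 0 := by
  have := h.posDef_self.isUnit
  rw [Matrix.isUnit_iff_isUnit_det] at this
  exact this.ne_zero

theorem IsMetricAt.isUnit_det (h : IsMetricAt G y) : IsUnit (G y).det := h.det_ne_zero.isUnit

theorem IsMetricAt.congr {G' : Coord n → Matrix (Fin (n + 1)) (Fin (n + 1)) ℝ}
    (h : IsMetricAt G y) (hG : G' =ᶠ[𝓝 y] G) : IsMetricAt G' y := by
  refine ⟨fun i j => (h.contDiffAt i j).congr_of_eventuallyEq ?_, ?_⟩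
  · filter_upwards [hG] with z hz; rw [hz]
  · filter_upwards [hG, h.posDef] with z hz hz'; rwa [hz]

theorem contDiffAt_pderiv {m k : WithTop ℕ∞} {f : Coord n → ℝ} (hf : ContDiffAt ℝ k f y)
    (hmk : m + 1 ≤ k) (i : Fin (n + 1)) : ContDiffAt ℝ m (pderiv i f) y :=
  (hf.fderiv_right hmk).clm_apply contDiffAt_const

theorem IsMetricAt.contDiffAt_inv (h : IsMetricAt G y) (i j : Fin (n + 1)) :
    ContDiffAt ℝ 2 (fun z => (G z)⁻¹ i j) y :=
  contDiffWithinAt_matrix_inv (s := univ) h.contDiffAt h.det_ne_zero i j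

theorem IsMetricAt.contDiffAt_christoffel (h : IsMetricAt G y) (l i j : Fin (n + 1)) :
    ContDiffAt ℝ 1 (christoffel G l i j) y := by
  unfold christoffel
  refine contDiffAt_const.mul (ContDiffAt.sum fun m _ => ?_)
  have h2 : (1 : WithTop ℕ∞) + 1 ≤ 2 := by norm_num
  exact ((h.contDiffAt_inv l m).of_le (by norm_num)).mul
    (((contDiffAt_pderiv (h.contDiffAt _ _) h2 _).add
      (contDiffAt_pderiv (h.contDiffAt _ _) h2 _)).sub (contDiffAt_pderiv (h.contDiffAt _ _) h2 _))

/-- The metric as a field of bilinear forms. -/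
def metricForm (G : Coord n → Matrix (Fin (n + 1)) (Fin (n + 1)) ℝ) (z : Coord n) :
    Coord n →L[ℝ] Coord n →L[ℝ] ℝ := bilin fun i j => G z i j

/-- The Christoffel symbols as a field of bilinear maps. -/
def christoffelForm (G : Coord n → Matrix (Fin (n + 1)) (Fin (n + 1)) ℝ) (z : Coord n) :
    Coord n →L[ℝ] Coord n →L[ℝ] Coord n :=
  bilin fun i j => WithLp.toLp 2 fun l => christoffel G l i j z

theorem christoffelForm_basisVec (i j l : Fin (n + 1)) :
    christoffelForm G y (basisVec i) (basisVec j) l = christoffel G l i j y := by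
  rw [christoffelForm, bilin_basisVec]

theorem IsMetricAt.contDiffAt_metricForm (h : IsMetricAt G y) :
    ContDiffAt ℝ 2 (metricForm G) y := contDiffAt_bilin h.contDiffAt

theorem IsMetricAt.differentiableAt_metricForm (h : IsMetricAt G y) :
    DifferentiableAt ℝ (metricForm G) y := h.contDiffAt_metricForm.differentiableAt (by norm_num)

theorem IsMetricAt.contDiffAt_toLp_christoffel (h : IsMetricAt G y) (i j : Fin (n + 1)) :
    ContDiffAt ℝ 1 (fun z => (WithLp.toLp 2 fun l => christoffel G l i j z : Coord n)) y := by
  rw [contDiffAt_euclidean]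
  exact fun l => h.contDiffAt_christoffel l i j

theorem IsMetricAt.contDiffAt_christoffelForm (h : IsMetricAt G y) :
    ContDiffAt ℝ 1 (christoffelForm G) y :=
  contDiffAt_bilin h.contDiffAt_toLp_christoffel

theorem IsMetricAt.differentiableAt_christoffelForm (h : IsMetricAt G y) :
    DifferentiableAt ℝ (christoffelForm G) y :=
  h.contDiffAt_christoffelForm.differentiableAt (by norm_num)

theorem isSymmForm_metricForm (h : (G y).IsSymm) : IsSymmForm (metricForm G y) := by
  intro v w
  rw [metricForm, bilin_apply, bilin_apply, Finset.sum_comm]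
  refine Finset.sum_congr rfl fun i _ => Finset.sum_congr rfl fun j _ => ?_
  rw [h.apply i j]
  simp only [smul_eq_mul]; ring

theorem IsMetricAt.isSymmForm (h : IsMetricAt G y) : ∀ᶠ z in 𝓝 y, IsSymmForm (metricForm G z) := by
  filter_upwards [h.posDef] with z hz using isSymmForm_metricForm (isSymm_of_posDef hz)

theorem metricForm_basisVec_left (v : Coord n) (i : Fin (n + 1)) :
    metricForm G y (basisVec i) v = (G y).mulVec v i := by
  simp only [metricForm, bilin_apply, Matrix.mulVec, dotProduct]
  rw [Finset.sum_eq_single i (by intro b _ hb; simp [hb]) (by simp)]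
  refine Finset.sum_congr rfl fun j _ => ?_
  simp [mul_comm]

theorem isNondeg_metricForm (h : (G y).PosDef) : IsNondeg (metricForm G y) := by
  intro x hx
  have h1 : (G y).mulVec x = 0 := by
    funext i
    rw [← metricForm_basisVec_left, isSymmForm_metricForm (isSymm_of_posDef h), hx]
    rfl
  have h2 : IsUnit (G y) := h.isUnit
  have h3 := Matrix.mulVec_injective_of_isUnit h2 (h1.trans (Matrix.mulVec_zero _).symm)
  ext i
  exact congrFun h3 i

theorem IsMetricAt.isKoszul (h : IsMetricAt G y) :
    IsKoszul (metricForm G) (christoffelForm G) y := by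
  have h1 : ∀ i j, ContDiffAt ℝ 1 (fun z => G z i j) y :=
    fun i j => (h.contDiffAt i j).of_le (by norm_num)
  have hd : ∀ u i j, fderiv ℝ (metricForm G) y u (basisVec i) (basisVec j) =
      fderiv ℝ (fun z => G z i j) y u := fun u i j => fderiv_bilin h1 u i j
  have hs := isSymm_of_posDef h.posDef_self
  have key : ∀ i j u, 2 * metricForm G y (christoffelForm G y (basisVec i) (basisVec j))
      (basisVec u) = fderiv ℝ (metricForm G) y (basisVec i) (basisVec j) (basisVec u) +
        fderiv ℝ (metricForm G) y (basisVec j) (basisVec i) (basisVec u) -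
        fderiv ℝ (metricForm G) y (basisVec u) (basisVec i) (basisVec j) := by
    intro i j u
    rw [isSymmForm_metricForm hs, metricForm_basisVec_left, hd, hd, hd]
    set c : Fin (n + 1) → ℝ := fun m => pderiv i (fun z => G z m j) y +
      pderiv j (fun z => G z m i) y - pderiv m (fun z => G z i j) y with hc
    have h2 : ∀ l, christoffelForm G y (basisVec i) (basisVec j) l =
        ((1 / 2 : ℝ) • (G y)⁻¹.mulVec c) l := by
      intro l
      rw [christoffelForm_basisVec]
      rfl
    have h3 : (G y).mulVec (christoffelForm G y (basisVec i) (basisVec j)) =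
        (1 / 2 : ℝ) • c := by
      rw [show ((christoffelForm G y (basisVec i) (basisVec j) : Coord n) : Fin (n + 1) → ℝ) =
        (1 / 2 : ℝ) • (G y)⁻¹.mulVec c from funext h2, Matrix.mulVec_smul, Matrix.mulVec_mulVec,
        Matrix.mul_nonsing_inv _ h.isUnit_det, Matrix.one_mulVec]
    -- The two formulas differ in the order of the indices of G under the derivative, so symmetry is
    -- needed near y and not only at y.
    have h4 : ∀ i j, (fun z => G z i j) =ᶠ[𝓝 y] fun z => G z j i := by
      intro i j
      filter_upwards [h.posDef] with z hz using (isSymm_of_posDef hz).apply j i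
    rw [h3, (h4 j u).fderiv_eq, (h4 i u).fderiv_eq]
    simp [hc, pderiv]
  refine basisVec_induction (fun v v' hv hv' w u => ?_) (fun c v hv w u => ?_) fun i => ?_
  · simp only [map_add, add_apply]; linarith [hv w u, hv' w u]
  · simp only [map_smul, smul_apply, smul_eq_mul]; linear_combination c * hv w u
  refine basisVec_induction (fun v v' hv hv' u => ?_) (fun c v hv u => ?_) fun j => ?_
  · simp only [map_add, add_apply]; linarith [hv u, hv' u]
  · simp only [map_smul, smul_apply, smul_eq_mul]; linear_combination c * hv u
  refine basisVec_induction (fun v v' hv hv' => ?_) (fun c v hv => ?_) fun u => key i j u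
  · simp only [map_add, add_apply]; linarith
  · simp only [map_smul, smul_apply, smul_eq_mul]; linear_combination c * hv

end Coordinates

/-! ### The Ricci form as a trace of the curvature. -/

section RicciForm

variable {V : Type*} [NormedAddCommGroup V] [NormedSpace ℝ V]

/-- The curvature operator `u ↦ R(u, v) w`. -/
def curvatureMap (Γ : V → V →L[ℝ] V →L[ℝ] V) (y v w : V) : V →ₗ[ℝ] V where
  toFun u := curvature Γ y u v w
  map_add' a b := by simp [curvature]; abel
  map_smul' c a := by simp [curvature, smul_sub, smul_add]

theorem curvatureMap_apply (Γ : V → V →L[ℝ] V →L[ℝ] V) (y u v w : V) :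
    curvatureMap Γ y v w u = curvature Γ y u v w := rfl

/-- The Ricci form `Ric(v, w) = tr (u ↦ R(u, v) w)`. -/
def ricciForm (Γ : V → V →L[ℝ] V →L[ℝ] V) (y : V) : V →ₗ[ℝ] V →ₗ[ℝ] ℝ :=
  LinearMap.mk₂ ℝ (fun v w => LinearMap.trace ℝ V (curvatureMap Γ y v w))
    (fun a b c => by
      rw [← map_add]; congr 1; ext u; simp [curvatureMap_apply, curvature]; abel)
    (fun a b c => by
      rw [← map_smul]; congr 1; ext u; simp [curvatureMap_apply, curvature, smul_sub, smul_add])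
    (fun a b c => by
      rw [← map_add]; congr 1; ext u; simp [curvatureMap_apply, curvature]; abel)
    (fun a b c => by
      rw [← map_smul]; congr 1; ext u; simp [curvatureMap_apply, curvature, smul_sub, smul_add])

theorem ricciForm_apply (Γ : V → V →L[ℝ] V →L[ℝ] V) (y v w : V) :
    ricciForm Γ y v w = LinearMap.trace ℝ V (curvatureMap Γ y v w) := rfl

theorem ricciForm_comp {Γ Γ' : V → V →L[ℝ] V →L[ℝ] V} {y y' : V} (e : V ≃L[ℝ] V)
    (h : ∀ u v w, e (curvature Γ' y u v w) = curvature Γ y' (e u) (e v) (e w)) (v w : V) :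
    ricciForm Γ' y v w = ricciForm Γ y' (e v) (e w) := by
  rw [ricciForm_apply, ricciForm_apply,
    ← LinearMap.trace_conj' (curvatureMap Γ' y v w) e.toLinearEquiv]
  congr 1
  ext u
  have := h (e.symm u) v w
  rw [e.apply_symm_apply] at this
  simpa [LinearEquiv.conj_apply, curvatureMap_apply] using this

end RicciForm

/-! ### The Ricci tensor in coordinates: symmetry and transformation law. -/

section Coordinates

open Filter Topology Matrix

variable {n : ℕ} {G G' : Coord n → Matrix (Fin (n + 1)) (Fin (n + 1)) ℝ} {y : Coord n}

theorem trace_eq_sum (A : Coord n →ₗ[ℝ] Coord n) :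
    LinearMap.trace ℝ (Coord n) A = ∑ l, A (basisVec l) l := by
  rw [LinearMap.trace_eq_matrix_trace ℝ (EuclideanSpace.basisFun (Fin (n + 1)) ℝ).toBasis,
    Matrix.trace]
  refine Finset.sum_congr rfl fun l _ => ?_
  rw [Matrix.diag_apply, LinearMap.toMatrix_apply]
  simp

theorem fderiv_apply_coord {f : Coord n → Coord n} (hf : DifferentiableAt ℝ f y) (u : Coord n)
    (l : Fin (n + 1)) : fderiv ℝ f y u l = fderiv ℝ (fun z => f z l) y u := by
  have := ((EuclideanSpace.proj l : Coord n →L[ℝ] ℝ).hasFDerivAt.comp y hf.hasFDerivAt).fderiv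
  have h2 : ((EuclideanSpace.proj l : Coord n →L[ℝ] ℝ) ∘ f) = fun z => f z l := rfl
  rw [h2] at this
  rw [this]
  rfl

theorem IsMetricAt.isSymmForm_christoffelForm (h : IsMetricAt G y) :
    IsSymmForm (christoffelForm G y) :=
  h.isKoszul.isSymmForm (isNondeg_metricForm h.posDef_self) h.differentiableAt_metricForm
    h.isSymmForm

theorem IsMetricAt.christoffel_symm (h : IsMetricAt G y) (l i j : Fin (n + 1)) :
    christoffel G l i j y = christoffel G l j i y := by
  rw [← christoffelForm_basisVec, ← christoffelForm_basisVec, h.isSymmForm_christoffelForm]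

/-- The index j carries the derivative in the second term of `ricci`, so it occupies the second
curvature slot and i is the vector acted upon; hence the swapped arguments. -/
theorem IsMetricAt.ricci_eq (h : IsMetricAt G y) (i j : Fin (n + 1)) :
    ricci G y i j = ricciForm (christoffelForm G) y (basisVec j) (basisVec i) := by
  have hd : ∀ u i j l, fderiv ℝ (christoffelForm G) y u (basisVec i) (basisVec j) l =
      fderiv ℝ (christoffel G l i j) y u := by
    intro u i j l
    have := fderiv_bilin h.contDiffAt_toLp_christoffel u i j
    rw [show christoffelForm G = fun z => bilin fun i j =>
      WithLp.toLp 2 fun l => christoffel G l i j z from rfl, this,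
      fderiv_apply_coord ((h.contDiffAt_toLp_christoffel i j).differentiableAt (by norm_num))]
  have hs : ∀ l i j, christoffel G l i j =ᶠ[𝓝 y] christoffel G l j i := by
    intro l i j
    filter_upwards [h.eventually] with z hz using hz.christoffel_symm l i j
  have hq : ∀ a b c l, christoffelForm G y (basisVec a)
      (christoffelForm G y (basisVec b) (basisVec c)) l =
      ∑ m, christoffel G m b c y * christoffel G l a m y := by
    intro a b c l
    conv_lhs => rw [← sum_smul_basisVec (christoffelForm G y (basisVec b) (basisVec c)), map_sum]
    simp [christoffelForm_basisVec]
  rw [ricciForm_apply, trace_eq_sum, ricci, Matrix.of_apply, ← Finset.sum_add_distrib]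
  refine Finset.sum_congr rfl fun l _ => ?_
  simp only [curvatureMap_apply, curvature, PiLp.add_apply, PiLp.sub_apply, hd, hq]
  rw [Finset.sum_sub_distrib, pderiv, pderiv, (hs l i j).fderiv_eq, (hs l i l).fderiv_eq,
    add_sub_assoc]
  congr 2
  · refine Finset.sum_congr rfl fun m _ => ?_
    rw [h.christoffel_symm m i j]; ring
  · refine Finset.sum_congr rfl fun m _ => ?_
    rw [h.christoffel_symm m i l]; ring

/-- By the first Bianchi identity the antisymmetric part of Ric(v, w) is, up to sign, the trace of u
↦ R(v, w)u. That operator is skew-adjoint for the metric, so its trace vanishes. -/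
theorem IsMetricAt.ricci_isSymm (h : IsMetricAt G y) : (ricci G y).IsSymm := by
  have hsk := IsKoszul.curvature_skew (h.eventually.mono fun z hz => hz.isKoszul)
    h.contDiffAt_metricForm h.differentiableAt_christoffelForm h.isSymmForm
  have hb := curvature_bianchi h.differentiableAt_christoffelForm
    (h.eventually.mono fun z hz => hz.isSymmForm_christoffelForm)
  have hzero : ∀ v w, LinearMap.trace ℝ (Coord n)
      ({ toFun := fun u => curvature (christoffelForm G) y v w u
         map_add' := fun a b => by simp [curvature]; abel
         map_smul' := fun c a => by simp [curvature, smul_sub, smul_add] } :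
        Coord n →ₗ[ℝ] Coord n) = 0 := by
    intro v w
    set A : Coord n →ₗ[ℝ] Coord n := 
      { toFun := fun u => curvature (christoffelForm G) y v w u
        map_add' := fun a b => by simp [curvature]; abel
        map_smul' := fun c a => by simp [curvature, smul_sub, smul_add] } with hA
    have hAsk : ∀ x x', metricForm G y (A x) x' + metricForm G y x (A x') = 0 :=
      fun x x' => hsk v w x x'
    set M : Matrix (Fin (n + 1)) (Fin (n + 1)) ℝ := of fun i j => A (basisVec j) i with hM
    have hs := isSymm_of_posDef h.posDef_self
    have h1 : G y * M + Mᵀ * G y = 0 := by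
      ext i j
      have e1 := hAsk (basisVec i) (basisVec j)
      rw [metricForm_basisVec_left, isSymmForm_metricForm hs, metricForm_basisVec_left] at e1
      have e2 : (Mᵀ * G y) i j = (G y).mulVec (A (basisVec i)) j := by
        rw [← hs.eq, ← transpose_mul, transpose_apply, hs.eq]
        rfl
      rw [Matrix.add_apply, e2, Matrix.zero_apply, ← e1, add_comm]
      rfl
    have h2 : M = -((G y)⁻¹ * Mᵀ * G y) := by
      have := congrArg (fun B => (G y)⁻¹ * B) h1
      simp only [mul_add, mul_zero, ← mul_assoc, nonsing_inv_mul _ h.isUnit_det, one_mul] at this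
      exact eq_neg_of_add_eq_zero_left this
    have h3 : M.trace = -M.trace := by
      conv_lhs => rw [h2, trace_neg, mul_assoc, trace_mul_comm, mul_assoc,
        mul_nonsing_inv _ h.isUnit_det, mul_one, trace_transpose]
    rw [trace_eq_sum]
    have h4 : M.trace = 0 := by linarith
    exact h4
  refine Matrix.IsSymm.ext fun i j => ?_
  rw [h.ricci_eq, h.ricci_eq, ricciForm_apply, ricciForm_apply, ← sub_eq_zero, ← map_sub]
  have := hzero (basisVec i) (basisVec j)
  rw [← neg_eq_zero, ← map_neg] at this
  rw [← this]
  congr 1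
  ext1 u
  simp only [curvatureMap_apply, LinearMap.sub_apply, LinearMap.neg_apply, LinearMap.coe_mk,
    AddHom.coe_mk]
  have e1 := hb u (basisVec i) (basisVec j)
  have e2 : curvature (christoffelForm G) y (basisVec j) u (basisVec i) =
      - curvature (christoffelForm G) y u (basisVec j) (basisVec i) := by
    simp only [curvature]; abel
  rw [e2] at e1
  rw [← sub_eq_zero, ← e1]
  abel

/-- The Jacobian matrix. -/
def jacobian (ψ : Coord n → Coord n) (z : Coord n) : Matrix (Fin (n + 1)) (Fin (n + 1)) ℝ :=
  of fun i j => fderiv ℝ ψ z (basisVec j) i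

theorem bilinear_basisVec (B : Coord n →ₗ[ℝ] Coord n →ₗ[ℝ] ℝ) (v w : Coord n) :
    B v w = ∑ a, ∑ b, v a * B (basisVec a) (basisVec b) * w b := by
  conv_lhs => rw [← sum_smul_basisVec v, ← sum_smul_basisVec w]
  simp only [map_sum, map_smul, LinearMap.sum_apply, LinearMap.smul_apply, smul_eq_mul,
    Finset.mul_sum]
  rw [Finset.sum_comm]
  refine Finset.sum_congr rfl fun i _ => Finset.sum_congr rfl fun j _ => ?_
  ring

theorem transpose_jacobian_mul_mul_apply (ψ : Coord n → Coord n) (z : Coord n)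
    (A : Matrix (Fin (n + 1)) (Fin (n + 1)) ℝ) (i j : Fin (n + 1)) :
    ((jacobian ψ z)ᵀ * A * jacobian ψ z) i j =
      ∑ a, ∑ b, fderiv ℝ ψ z (basisVec i) a * A a b * fderiv ℝ ψ z (basisVec j) b := by
  simp only [mul_apply, transpose_apply, jacobian, of_apply, Finset.sum_mul]
  rw [Finset.sum_comm]

theorem metricForm_comp {ψ : Coord n → Coord n} {z : Coord n}
    (h : G' z = (jacobian ψ z)ᵀ * G (ψ z) * jacobian ψ z) (v w : Coord n) :
    metricForm G' z v w = metricForm G (ψ z) (fderiv ℝ ψ z v) (fderiv ℝ ψ z w) := by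
  have : metricForm G' z = ((metricForm G (ψ z)).bilinearComp (fderiv ℝ ψ z) (fderiv ℝ ψ z)) := by
    refine bilin_ext fun i j => ?_
    rw [metricForm, bilin_basisVec, h, transpose_jacobian_mul_mul_apply]
    simp only [ContinuousLinearMap.bilinearComp_apply, metricForm, bilin_apply, smul_eq_mul]
    refine Finset.sum_congr rfl fun i _ => Finset.sum_congr rfl fun j _ => ?_
    ring
  rw [this]; rfl

/-- A change of coordinates near `y`, from the metric `G'` to the metric `G`. -/
structure IsCoordChangeAt (ψ : Coord n → Coord n)
    (G' G : Coord n → Matrix (Fin (n + 1)) (Fin (n + 1)) ℝ) (y : Coord n) : Prop where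
  contDiffAt : ContDiffAt ℝ 3 ψ y
  isInvertible : (fderiv ℝ ψ y).IsInvertible
  metric : IsMetricAt G (ψ y)
  metric' : IsMetricAt G' y
  eventually_eq : ∀ᶠ z in 𝓝 y, G' z = (jacobian ψ z)ᵀ * G (ψ z) * jacobian ψ z

variable {ψ : Coord n → Coord n}

theorem IsCoordChangeAt.eventually (h : IsCoordChangeAt ψ G' G y) :
    ∀ᶠ z in 𝓝 y, IsCoordChangeAt ψ G' G z := by
  have h1 : ∀ᶠ z in 𝓝 y, ContDiffAt ℝ 3 ψ z := h.contDiffAt.eventually (by simp)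
  have h2 : ∀ᶠ z in 𝓝 y, (fderiv ℝ ψ z).IsInvertible := by
    obtain ⟨e, he⟩ := h.isInvertible
    have hc : ContinuousAt (fderiv ℝ ψ) y :=
      (h.contDiffAt.fderiv_right (m := 2) (by norm_num)).continuousAt
    have := hc.eventually (he ▸ ContinuousLinearEquiv.nhds e)
    filter_upwards [this] with z hz
    obtain ⟨e', he'⟩ := hz
    exact ⟨e', he'⟩
  have h3 : ∀ᶠ z in 𝓝 y, IsMetricAt G (ψ z) :=
    h.contDiffAt.continuousAt.eventually h.metric.eventually
  filter_upwards [h1, h2, h3, h.metric'.eventually, h.eventually_eq.eventually_nhds]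
    with z a b c d e using ⟨a, b, c, d, e⟩

theorem IsCoordChangeAt.christoffelForm_comp (h : IsCoordChangeAt ψ G' G y) (v w : Coord n) :
    fderiv ℝ ψ y (christoffelForm G' y v w) = fderiv ℝ (fderiv ℝ ψ) y v w +
      christoffelForm G (ψ y) (fderiv ℝ ψ y v) (fderiv ℝ ψ y w) := by
  refine IsKoszul.comp h.metric.isKoszul h.metric'.isKoszul (h.contDiffAt.of_le (by norm_num))
    ?_ (isNondeg_metricForm h.metric.posDef_self) h.metric.isSymmForm
    h.metric.differentiableAt_metricForm h.metric'.differentiableAt_metricForm ?_ v w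
  · obtain ⟨e, he⟩ := h.isInvertible
    rw [← he]; exact e.surjective
  · filter_upwards [h.eventually_eq] with z hz using metricForm_comp hz

theorem IsCoordChangeAt.ricci_comp (h : IsCoordChangeAt ψ G' G y) :
    ricci G' y = (jacobian ψ y)ᵀ * ricci G (ψ y) * jacobian ψ y := by
  obtain ⟨e, he⟩ := h.isInvertible
  have hc := curvature_comp h.contDiffAt h.metric.differentiableAt_christoffelForm
    h.metric'.differentiableAt_christoffelForm
    (h.eventually.mono fun z hz => hz.christoffelForm_comp)
  rw [← he] at hc
  ext i j
  rw [transpose_jacobian_mul_mul_apply, h.metric'.ricci_eq, ricciForm_comp e hc, ← he,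
    bilinear_basisVec, Finset.sum_comm]
  refine Finset.sum_congr rfl fun i _ => Finset.sum_congr rfl fun j _ => ?_
  rw [h.metric.ricci_eq, ContinuousLinearEquiv.coe_coe]; ring

end Coordinates

/-! ### Hessian, gradient and Schouten tensor under coordinate changes. -/

section Coordinates

open Filter Topology Matrix

variable {n : ℕ} {G G' : Coord n → Matrix (Fin (n + 1)) (Fin (n + 1)) ℝ} {y : Coord n}
  {ψ : Coord n → Coord n} {u u' : Coord n → ℝ}

/-- The vector of partial derivatives. -/
def gradVec (u : Coord n → ℝ) (y : Coord n) : Fin (n + 1) → ℝ := fun i => pderiv i u y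

theorem gradSq_eq (G : Coord n → Matrix (Fin (n + 1)) (Fin (n + 1)) ℝ) (u : Coord n → ℝ)
    (y : Coord n) : gradSq G u y = gradVec u y ⬝ᵥ (G y)⁻¹ *ᵥ gradVec u y := by
  simp only [gradSq, dotProduct, mulVec, gradVec, Finset.mul_sum]
  refine Finset.sum_congr rfl fun i _ => Finset.sum_congr rfl fun j _ => ?_
  ring

theorem sum_mul_eq_trace {d : ℕ} {A : Matrix (Fin d) (Fin d) ℝ} (hA : A.IsSymm)
    (B : Matrix (Fin d) (Fin d) ℝ) : ∑ i, ∑ j, A i j * B i j = (A * B).trace := by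
  rw [Finset.sum_comm]
  refine Finset.sum_congr rfl fun i _ => ?_
  rw [diag_apply, mul_apply]
  exact Finset.sum_congr rfl fun j _ => by rw [hA.apply]

theorem isSymm_inv {d : ℕ} {A : Matrix (Fin d) (Fin d) ℝ} (hA : A.IsSymm) : A⁻¹.IsSymm := by
  rw [IsSymm, transpose_nonsing_inv, hA.eq]

theorem pderiv_pderiv {i j : Fin (n + 1)} (hu : ContDiffAt ℝ 2 u y) :
    pderiv i (pderiv j u) y = fderiv ℝ (fderiv ℝ u) y (basisVec i) (basisVec j) := by
  have hd : DifferentiableAt ℝ (fderiv ℝ u) y :=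
    (hu.fderiv_right (m := 1) (by norm_num)).differentiableAt (by norm_num)
  have : pderiv j u = fun z => fderiv ℝ u z (basisVec j) := rfl
  rw [pderiv, this, (hd.hasFDerivAt.clm_apply (hasFDerivAt_const _ _)).fderiv]
  simp

theorem sum_christoffel_mul (L : Coord n →L[ℝ] ℝ) (i j : Fin (n + 1)) :
    ∑ l, christoffel G l i j y * L (basisVec l) =
      L (christoffelForm G y (basisVec i) (basisVec j)) := by
  rw [← sum_mul_map_basisVec]
  exact Finset.sum_congr rfl fun l _ => by rw [christoffelForm_basisVec, mul_comm]

theorem hessian_eq (hu : ContDiffAt ℝ 2 u y) (i j : Fin (n + 1)) :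
    hessian G u y i j = fderiv ℝ (fderiv ℝ u) y (basisVec i) (basisVec j) -
      fderiv ℝ u y (christoffelForm G y (basisVec i) (basisVec j)) := by
  rw [hessian, of_apply, pderiv_pderiv hu, ← sum_christoffel_mul]
  rfl

theorem hessian_isSymm (hG : IsMetricAt G y) (hu : ContDiffAt ℝ 2 u y) :
    (hessian G u y).IsSymm := by
  refine IsSymm.ext fun i j => ?_
  rw [hessian_eq hu, hessian_eq hu, hG.isSymmForm_christoffelForm,
    (hu.isSymmSndFDerivAt (by simp)) (basisVec i) (basisVec j)]

theorem IsMetricAt.schouten_isSymm (hG : IsMetricAt G y) : (schouten G y).IsSymm := by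
  rw [schouten]
  exact (hG.ricci_isSymm.sub ((isSymm_of_posDef hG.posDef_self).smul _)).smul _

theorem linear_eq_sum (L : Coord n →L[ℝ] ℝ) (v : Coord n) : L v = ∑ a, v a * L (basisVec a) := by
  rw [← sum_mul_map_basisVec]
  exact Finset.sum_congr rfl fun _ _ => mul_comm _ _

theorem clm_bilinear_basisVec (B : Coord n →L[ℝ] Coord n →L[ℝ] ℝ) (v w : Coord n) :
    B v w = ∑ a, ∑ b, v a * B (basisVec a) (basisVec b) * w b := by
  conv_lhs => rw [← sum_smul_basisVec v, ← sum_smul_basisVec w]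
  simp only [map_sum, map_smul, _root_.sum_apply, _root_.smul_apply, smul_eq_mul, Finset.mul_sum]
  rw [Finset.sum_comm]
  refine Finset.sum_congr rfl fun i _ => Finset.sum_congr rfl fun j _ => ?_
  ring

section CoordChange

theorem gradVec_comp (hψ : DifferentiableAt ℝ ψ y) (hu : DifferentiableAt ℝ u (ψ y))
    (h : u' =ᶠ[𝓝 y] u ∘ ψ) : gradVec u' y = (jacobian ψ y)ᵀ *ᵥ gradVec u (ψ y) := by
  funext i
  rw [gradVec, pderiv, h.fderiv_eq, fderiv_comp y hu hψ, ContinuousLinearMap.comp_apply,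
    linear_eq_sum]
  rfl

/-- The chain rule produces du applied to the second derivative of ψ, and the inhomogeneous term in
the transformation law of the Christoffel form cancels it. -/
theorem IsCoordChangeAt.hessian_comp (h : IsCoordChangeAt ψ G' G y) (hu : ContDiffAt ℝ 2 u (ψ y))
    (hu' : u' =ᶠ[𝓝 y] u ∘ ψ) :
    hessian G' u' y = (jacobian ψ y)ᵀ * hessian G u (ψ y) * jacobian ψ y := by
  have hψ2 : ContDiffAt ℝ 2 ψ y := h.contDiffAt.of_le (by norm_num)
  have dψ : DifferentiableAt ℝ ψ y := hψ2.differentiableAt (by norm_num)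
  have dJ : DifferentiableAt ℝ (fderiv ℝ ψ) y :=
    (hψ2.fderiv_right (m := 1) (by norm_num)).differentiableAt (by norm_num)
  have hu'2 : ContDiffAt ℝ 2 u' y := (hu.comp y hψ2).congr_of_eventuallyEq hu'
  have du2 : DifferentiableAt ℝ (fderiv ℝ u) (ψ y) :=
    (hu.fderiv_right (m := 1) (by norm_num)).differentiableAt (by norm_num)
  have e1 : fderiv ℝ u' =ᶠ[𝓝 y] fun z : Coord n => (fderiv ℝ u (ψ z)).comp (fderiv ℝ ψ z) := by
    have hd : ∀ᶠ z in 𝓝 y, DifferentiableAt ℝ ψ z := by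
      filter_upwards [hψ2.eventually (by simp)] with z hz using hz.differentiableAt (by norm_num)
    have hd1 : ∀ᶠ z in 𝓝 (ψ y), DifferentiableAt ℝ u z := by
      filter_upwards [hu.eventually (by simp)] with z hz using hz.differentiableAt (by norm_num)
    have hd2 := hψ2.continuousAt.eventually hd1
    filter_upwards [hu'.fderiv (𝕜 := ℝ), hd, hd2] with z h1 h2 h3
    rw [h1, fderiv_comp z h3 h2]
  have e2 : ∀ v w, fderiv ℝ (fderiv ℝ u') y v w =
      fderiv ℝ (fderiv ℝ u) (ψ y) (fderiv ℝ ψ y v) (fderiv ℝ ψ y w) +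
        fderiv ℝ u (ψ y) (fderiv ℝ (fderiv ℝ ψ) y v w) := by
    intro v w
    have h1 : HasFDerivAt (fun z : Coord n => fderiv ℝ u (ψ z))
        ((fderiv ℝ (fderiv ℝ u) (ψ y)).comp (fderiv ℝ ψ y)) y :=
      HasFDerivAt.comp (g := fderiv ℝ u) y du2.hasFDerivAt dψ.hasFDerivAt
    rw [e1.fderiv_eq, (h1.clm_comp dJ.hasFDerivAt).fderiv]
    simp
    abel
  have e3 : ∀ v w, fderiv ℝ (fderiv ℝ u') y v w - fderiv ℝ u' y (christoffelForm G' y v w) =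
      (fderiv ℝ (fderiv ℝ u) (ψ y) -
        (ContinuousLinearMap.compL ℝ _ _ ℝ (fderiv ℝ u (ψ y))).comp (christoffelForm G (ψ y)))
        (fderiv ℝ ψ y v) (fderiv ℝ ψ y w) := by
    intro v w
    rw [e2, e1.self_of_nhds, ContinuousLinearMap.comp_apply, h.christoffelForm_comp]
    simp
    abel
  ext i j
  rw [hessian_eq hu'2, e3, clm_bilinear_basisVec, transpose_jacobian_mul_mul_apply]
  refine Finset.sum_congr rfl fun a _ => Finset.sum_congr rfl fun b _ => ?_
  rw [hessian_eq hu]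
  rfl

theorem IsCoordChangeAt.isUnit_det (h : IsCoordChangeAt ψ G' G y) :
    IsUnit (jacobian ψ y).det := by
  have h1 := h.eventually_eq.self_of_nhds
  have h2 := h.metric'.det_ne_zero
  rw [h1, det_mul] at h2
  exact (right_ne_zero_of_mul h2).isUnit

theorem IsCoordChangeAt.inv_eq (h : IsCoordChangeAt ψ G' G y) :
    (G' y)⁻¹ = (jacobian ψ y)⁻¹ * (G (ψ y))⁻¹ * ((jacobian ψ y)ᵀ)⁻¹ := by
  rw [h.eventually_eq.self_of_nhds, Matrix.mul_inv_rev, Matrix.mul_inv_rev, mul_assoc]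

/-- Raising an index turns the congruence of bilinear forms into a conjugation. Hence σ_k and traces
do not depend on the chart. -/
theorem IsCoordChangeAt.inv_mul (h : IsCoordChangeAt ψ G' G y)
    (A : Matrix (Fin (n + 1)) (Fin (n + 1)) ℝ) :
    (G' y)⁻¹ * ((jacobian ψ y)ᵀ * A * jacobian ψ y) =
      (jacobian ψ y)⁻¹ * ((G (ψ y))⁻¹ * A) * jacobian ψ y := by
  have hT : IsUnit ((jacobian ψ y)ᵀ).det := by rw [det_transpose]; exact h.isUnit_det
  rw [h.inv_eq]
  calc (jacobian ψ y)⁻¹ * (G (ψ y))⁻¹ * ((jacobian ψ y)ᵀ)⁻¹ *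
      ((jacobian ψ y)ᵀ * A * jacobian ψ y) = (jacobian ψ y)⁻¹ * (G (ψ y))⁻¹ *
      (((jacobian ψ y)ᵀ)⁻¹ * (jacobian ψ y)ᵀ) * A * jacobian ψ y := by simp only [mul_assoc]
    _ = _ := by rw [nonsing_inv_mul _ hT, mul_one]; simp only [mul_assoc]

theorem IsCoordChangeAt.trace_inv_mul (h : IsCoordChangeAt ψ G' G y)
    (A : Matrix (Fin (n + 1)) (Fin (n + 1)) ℝ) :
    ((G' y)⁻¹ * ((jacobian ψ y)ᵀ * A * jacobian ψ y)).trace = ((G (ψ y))⁻¹ * A).trace := by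
  rw [h.inv_mul, trace_mul_comm, ← mul_assoc, mul_nonsing_inv _ h.isUnit_det, one_mul]

theorem IsCoordChangeAt.gradSq_comp (h : IsCoordChangeAt ψ G' G y)
    (hu : DifferentiableAt ℝ u (ψ y)) (hu' : u' =ᶠ[𝓝 y] u ∘ ψ) :
    gradSq G' u' y = gradSq G u (ψ y) := by
  have hT : IsUnit ((jacobian ψ y)ᵀ).det := by rw [det_transpose]; exact h.isUnit_det
  rw [gradSq_eq, gradSq_eq, gradVec_comp (h.contDiffAt.differentiableAt (by norm_num)) hu hu',
    h.inv_eq, mulVec_mulVec, mul_assoc, nonsing_inv_mul _ hT, mul_one, mulVec_transpose,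
    ← dotProduct_mulVec, mulVec_mulVec, ← mul_assoc, mul_nonsing_inv _ h.isUnit_det, one_mul]

theorem IsMetricAt.scalarCurvature_eq (h : IsMetricAt G y) :
    scalarCurvature G y = ((G y)⁻¹ * ricci G y).trace :=
  sum_mul_eq_trace (isSymm_inv (isSymm_of_posDef h.posDef_self)) _

theorem IsCoordChangeAt.schouten_comp (h : IsCoordChangeAt ψ G' G y) :
    schouten G' y = (jacobian ψ y)ᵀ * schouten G (ψ y) * jacobian ψ y := by
  have hs : scalarCurvature G' y = scalarCurvature G (ψ y) := by
    rw [h.metric'.scalarCurvature_eq, h.metric.scalarCurvature_eq, h.ricci_comp, h.trace_inv_mul]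
  rw [schouten, schouten, hs, h.ricci_comp, h.eventually_eq.self_of_nhds]
  simp only [mul_smul_comm, smul_mul_assoc, mul_sub, sub_mul]

theorem of_mul_eq_vecMulVec (u : Coord n → ℝ) (y : Coord n) :
    of (fun i j => pderiv i u y * pderiv j u y) = vecMulVec (gradVec u y) (gradVec u y) := rfl

theorem IsCoordChangeAt.negSchoutenConf_comp (h : IsCoordChangeAt ψ G' G y)
    (hu : ContDiffAt ℝ 2 u (ψ y)) (hu' : u' =ᶠ[𝓝 y] u ∘ ψ) :
    negSchoutenConf G' u' y =
      (jacobian ψ y)ᵀ * negSchoutenConf G u (ψ y) * jacobian ψ y := by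
  have du : DifferentiableAt ℝ u (ψ y) := hu.differentiableAt (by norm_num)
  have hv : vecMulVec ((jacobian ψ y)ᵀ *ᵥ gradVec u (ψ y)) ((jacobian ψ y)ᵀ *ᵥ gradVec u (ψ y)) =
      (jacobian ψ y)ᵀ * vecMulVec (gradVec u (ψ y)) (gradVec u (ψ y)) * jacobian ψ y := by
    rw [mul_vecMulVec, vecMulVec_mul, mulVec_transpose]
  rw [negSchoutenConf, negSchoutenConf, of_mul_eq_vecMulVec, of_mul_eq_vecMulVec,
    h.schouten_comp, h.hessian_comp hu hu', h.gradSq_comp du hu',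
    gradVec_comp (h.contDiffAt.differentiableAt (by norm_num)) du hu', hv,
    h.eventually_eq.self_of_nhds]
  simp only [mul_smul_comm, smul_mul_assoc, mul_sub, sub_mul, mul_add, add_mul]

end CoordChange

end Coordinates

/-! ### Curvature of the conformal metric ρ⁻² Gb. -/

section Conformal

open Filter Topology Matrix

variable {n : ℕ} {G Gb : Coord n → Matrix (Fin (n + 1)) (Fin (n + 1)) ℝ} {y : Coord n}
  {ρ u : Coord n → ℝ}

/-- Near `y` the metric `G` is `ρ⁻² Gb`. -/
structure IsConformalAt (ρ : Coord n → ℝ) (Gb G : Coord n → Matrix (Fin (n + 1)) (Fin (n + 1)) ℝ)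
    (y : Coord n) : Prop where
  contDiffAt : ContDiffAt ℝ 2 ρ y
  pos : 0 < ρ y
  metric : IsMetricAt Gb y
  eventually_eq : ∀ᶠ z in 𝓝 y, G z = ((ρ z) ^ 2)⁻¹ • Gb z

theorem IsConformalAt.eventually (h : IsConformalAt ρ Gb G y) :
    ∀ᶠ z in 𝓝 y, IsConformalAt ρ Gb G z := by
  filter_upwards [h.contDiffAt.eventually (by simp), h.metric.eventually,
    h.contDiffAt.continuousAt.eventually (lt_mem_nhds h.pos), h.eventually_eq.eventually_nhds]
    with z a b c d using ⟨a, c, b, d⟩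

theorem IsConformalAt.isMetricAt (h : IsConformalAt ρ Gb G y) : IsMetricAt G y := by
  have h1 : IsMetricAt (fun z => ((ρ z) ^ 2)⁻¹ • Gb z) y := by
    refine ⟨fun i j => ?_, ?_⟩
    · simp only [Matrix.smul_apply, smul_eq_mul]
      exact ((h.contDiffAt.pow 2).inv (pow_pos h.pos 2).ne').mul (h.metric.contDiffAt i j)
    · filter_upwards [h.metric.posDef, h.contDiffAt.continuousAt.eventually (lt_mem_nhds h.pos)]
        with z hz hz'
      exact hz.smul (inv_pos.2 (pow_pos hz' 2))
  exact h1.congr h.eventually_eq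

theorem IsConformalAt.inv_eq (h : IsConformalAt ρ Gb G y) : (G y)⁻¹ = (ρ y) ^ 2 • (Gb y)⁻¹ := by
  have h0 : (ρ y) ^ 2 ≠ 0 := (pow_pos h.pos 2).ne'
  rw [h.eventually_eq.self_of_nhds]
  refine inv_eq_left_inv ?_
  rw [smul_mul_smul_comm, mul_inv_cancel₀ h0, nonsing_inv_mul _ h.metric.isUnit_det, one_smul]

/-- The differential of `-log ρ`. -/
def conformalOneForm (ρ : Coord n → ℝ) (z : Coord n) : Coord n →L[ℝ] ℝ :=
  -((ρ z)⁻¹ • fderiv ℝ ρ z)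

/-- The gradient of `-log ρ`. -/
def conformalGradient (ρ : Coord n → ℝ) (Gb : Coord n → Matrix (Fin (n + 1)) (Fin (n + 1)) ℝ)
    (z : Coord n) : Coord n :=
  WithLp.toLp 2 fun l => ∑ m, (Gb z)⁻¹ l m * conformalOneForm ρ z (basisVec m)

theorem metricForm_conformalGradient (h : (Gb y).PosDef) (v : Coord n) :
    metricForm Gb y (conformalGradient ρ Gb y) v = conformalOneForm ρ y v := by
  have hu : IsUnit (Gb y).det := (isUnit_iff_isUnit_det _).1 h.isUnit
  refine basisVec_induction (p := fun v => metricForm Gb y (conformalGradient ρ Gb y) v =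
    conformalOneForm ρ y v) (fun v w hv hw => ?_) (fun c v hv => ?_) (fun i => ?_) v
  · rw [map_add, map_add, hv, hw]
  · rw [map_smul, map_smul, hv]
  · rw [isSymmForm_metricForm (isSymm_of_posDef h), metricForm_basisVec_left]
    have : ((conformalGradient ρ Gb y : Coord n) : Fin (n + 1) → ℝ) =
        (Gb y)⁻¹ *ᵥ fun m => conformalOneForm ρ y (basisVec m) := rfl
    rw [this, mulVec_mulVec, mul_nonsing_inv _ hu, one_mulVec]

theorem IsConformalAt.hasFDerivAt_factor (h : IsConformalAt ρ Gb G y) :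
    HasFDerivAt (fun z => ((ρ z) ^ 2)⁻¹)
      ((2 * ((ρ y) ^ 2)⁻¹) • conformalOneForm ρ y) y := by
  have hρ := (h.contDiffAt.differentiableAt (by norm_num)).hasFDerivAt
  have h0 := h.pos.ne'
  have h1 := (hasDerivAt_inv (pow_ne_zero 2 h0)).comp_hasFDerivAt y (hρ.pow 2)
  refine h1.congr_fderiv (ContinuousLinearMap.ext fun v => Eq.symm ?_)
  change 2 * ((ρ y) ^ 2)⁻¹ * (-((ρ y)⁻¹ * fderiv ℝ ρ y v)) =
    -((ρ y ^ 2) ^ 2)⁻¹ * ((2 • ρ y ^ (2 - 1)) * fderiv ℝ ρ y v)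
  field_simp
  simp
  ring

theorem IsConformalAt.metricForm_eq (h : IsConformalAt ρ Gb G y) :
    metricForm G =ᶠ[𝓝 y] fun z => ((ρ z) ^ 2)⁻¹ • metricForm Gb z := by
  filter_upwards [h.eventually_eq] with z hz
  refine bilin_ext fun i j => ?_
  rw [_root_.smul_apply, _root_.smul_apply, metricForm, metricForm, bilin_basisVec, bilin_basisVec, hz]
  rfl

theorem IsConformalAt.christoffelForm_eq (h : IsConformalAt ρ Gb G y) (v w : Coord n) :
    christoffelForm G y v w = christoffelForm Gb y v w +
      conformalShift (metricForm Gb y) (conformalOneForm ρ y) (conformalGradient ρ Gb y) v w :=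
  h.metric.isKoszul.conformal h.isMetricAt.isKoszul (isNondeg_metricForm h.metric.posDef_self)
    h.metric.isSymmForm h.metric.differentiableAt_metricForm h.hasFDerivAt_factor
    (inv_ne_zero (pow_ne_zero 2 h.pos.ne')) h.metricForm_eq
    (metricForm_conformalGradient h.metric.posDef_self) v w

theorem conformalOneForm_basisVec (i : Fin (n + 1)) :
    conformalOneForm ρ y (basisVec i) = -(ρ y)⁻¹ * gradVec ρ y i := by
  simp [conformalOneForm, gradVec, pderiv]

theorem apply_conformalGradient (L : Coord n →L[ℝ] ℝ) :
    L (conformalGradient ρ Gb y) = -(ρ y)⁻¹ *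
      ((Gb y)⁻¹ *ᵥ gradVec ρ y ⬝ᵥ fun i => L (basisVec i)) := by
  rw [← sum_mul_map_basisVec, dotProduct, Finset.mul_sum]
  refine Finset.sum_congr rfl fun i _ => ?_
  simp only [conformalGradient, conformalOneForm_basisVec, mulVec, dotProduct, Finset.mul_sum,
    Finset.sum_mul]
  refine Finset.sum_congr rfl fun j _ => ?_
  ring

/-- The Hessian of a conformal metric. -/
theorem IsConformalAt.hessian_eq (h : IsConformalAt ρ Gb G y) (hu : ContDiffAt ℝ 2 u y) :
    hessian G u y = hessian Gb u y + (ρ y)⁻¹ • (vecMulVec (gradVec ρ y) (gradVec u y) +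
      vecMulVec (gradVec u y) (gradVec ρ y)) -
      ((ρ y)⁻¹ * ((Gb y)⁻¹ *ᵥ gradVec ρ y ⬝ᵥ gradVec u y)) • Gb y := by
  ext i j
  rw [ConformallyCompact.hessian_eq hu, h.christoffelForm_eq, map_add, Matrix.sub_apply,
    Matrix.add_apply, ConformallyCompact.hessian_eq hu, conformalShift, map_sub, map_add, map_smul,
    map_smul, map_smul, apply_conformalGradient, conformalOneForm_basisVec,
    conformalOneForm_basisVec, metricForm, bilin_basisVec]
  simp only [vecMulVec, Matrix.smul_apply, Matrix.add_apply, of_apply, smul_eq_mul]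
  change _ - (_ + (_ * gradVec u y j + _ * gradVec u y i -
    _ * (_ * ((Gb y)⁻¹ *ᵥ gradVec ρ y ⬝ᵥ gradVec u y)))) = _
  ring

theorem contDiffAt_fderiv_of_two (h : ContDiffAt ℝ 2 ρ y) : ContDiffAt ℝ 1 (fderiv ℝ ρ) y :=
  h.fderiv_right (by norm_num)

theorem IsConformalAt.contDiffAt_conformalOneForm (h : IsConformalAt ρ Gb G y) :
    ContDiffAt ℝ 1 (conformalOneForm ρ) y :=
  (((h.contDiffAt.of_le (by norm_num)).inv h.pos.ne').smul
    (contDiffAt_fderiv_of_two h.contDiffAt)).neg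

theorem IsConformalAt.contDiffAt_conformalGradient (h : IsConformalAt ρ Gb G y) :
    ContDiffAt ℝ 1 (conformalGradient ρ Gb) y := by
  rw [contDiffAt_euclidean]
  intro l
  change ContDiffAt ℝ 1 (fun z => ∑ m, (Gb z)⁻¹ l m * conformalOneForm ρ z (basisVec m)) y
  exact ContDiffAt.sum fun m _ => ((h.metric.contDiffAt_inv l m).of_le (by norm_num)).mul
    (h.contDiffAt_conformalOneForm.clm_apply contDiffAt_const)

theorem IsConformalAt.fderiv_conformalOneForm (h : IsConformalAt ρ Gb G y) (v w : Coord n) :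
    fderiv ℝ (conformalOneForm ρ) y v w =
      ((ρ y) ^ 2)⁻¹ * (fderiv ℝ ρ y v * fderiv ℝ ρ y w) -
        (ρ y)⁻¹ * fderiv ℝ (fderiv ℝ ρ) y v w := by
  have hρ := (h.contDiffAt.differentiableAt (by norm_num)).hasFDerivAt
  have hρ2 := ((contDiffAt_fderiv_of_two h.contDiffAt).differentiableAt (by norm_num)).hasFDerivAt
  have h1 := ((hasDerivAt_inv h.pos.ne').comp_hasFDerivAt y hρ)
  have h2 := (h1.fun_smul hρ2).neg.fderiv
  have e : (fun z => -((ρ z)⁻¹ • fderiv ℝ ρ z)) = conformalOneForm ρ := rfl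
  have h3 : fderiv ℝ (conformalOneForm ρ) y = _ := h2
  rw [h3]
  simp
  ring

/-- The Hessian of `-log ρ` with respect to `Gb`. -/
def logHessian (ρ : Coord n → ℝ) (Gb : Coord n → Matrix (Fin (n + 1)) (Fin (n + 1)) ℝ)
    (y : Coord n) : Matrix (Fin (n + 1)) (Fin (n + 1)) ℝ :=
  ((ρ y) ^ 2)⁻¹ • vecMulVec (gradVec ρ y) (gradVec ρ y) - (ρ y)⁻¹ • hessian Gb ρ y

theorem IsConformalAt.logHessian_apply (h : IsConformalAt ρ Gb G y) (i j : Fin (n + 1)) :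
    logHessian ρ Gb y i j = fderiv ℝ (conformalOneForm ρ) y (basisVec i) (basisVec j) -
      conformalOneForm ρ y (christoffelForm Gb y (basisVec i) (basisVec j)) := by
  rw [h.fderiv_conformalOneForm, logHessian, Matrix.sub_apply, Matrix.smul_apply,
    Matrix.smul_apply, ConformallyCompact.hessian_eq h.contDiffAt]
  simp [conformalOneForm, vecMulVec, gradVec, pderiv]
  ring

/-- The trace over u of `curvature_conformal`, with w = -log ρ, dw = -ρ⁻¹dρ and |dw|² = ρ⁻²|dρ|².
The factors n - 1 are the dimension n + 1 minus 2. -/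
theorem IsConformalAt.ricci_eq (h : IsConformalAt ρ Gb G y) :
    ricci G y = ricci Gb y - ((n : ℝ) - 1) • (logHessian ρ Gb y -
        ((ρ y) ^ 2)⁻¹ • vecMulVec (gradVec ρ y) (gradVec ρ y)) -
      (((Gb y)⁻¹ * logHessian ρ Gb y).trace +
        ((n : ℝ) - 1) * (((ρ y) ^ 2)⁻¹ * gradSq Gb ρ y)) • Gb y := by
  have hb := h.metric
  have hs := isSymm_of_posDef hb.posDef_self
  have hsΓ := hb.isSymmForm_christoffelForm
  have hsθ : ∀ u v, fderiv ℝ (conformalOneForm ρ) y u v =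
      fderiv ℝ (conformalOneForm ρ) y v u := by
    intro u v
    rw [h.fderiv_conformalOneForm, h.fderiv_conformalOneForm,
      (h.contDiffAt.isSymmSndFDerivAt (by simp)) u v]
    ring
  obtain ⟨S, hS, hcurv⟩ := curvature_conformal
    (hb.eventually.mono fun z hz => hz.isKoszul) hb.isSymmForm hsΓ hsθ
    hb.differentiableAt_metricForm hb.differentiableAt_christoffelForm
    (h.contDiffAt_conformalOneForm.differentiableAt (by norm_num))
    (h.contDiffAt_conformalGradient.differentiableAt (by norm_num))
    (hb.posDef.mono fun z hz => metricForm_conformalGradient hz)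
    h.isMetricAt.differentiableAt_christoffelForm
    (h.eventually.mono fun z hz => hz.christoffelForm_eq)
  set θ := conformalOneForm ρ with hθ
  set X := conformalGradient ρ Gb y with hX
  set Γ := christoffelForm Gb with hΓ
  set g := metricForm Gb y with hg
  have hθX : θ y X = ((ρ y) ^ 2)⁻¹ * gradSq Gb ρ y := by
    rw [hX, apply_conformalGradient, gradSq_eq, dotProduct_comm (gradVec ρ y)]
    have : (fun i => θ y (basisVec i)) = -(ρ y)⁻¹ • gradVec ρ y := by
      funext i; rw [hθ, conformalOneForm_basisVec]; rfl
    rw [this, dotProduct_smul, smul_eq_mul]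
    field_simp
  have htrS : ∑ l, S (basisVec l) l = ((Gb y)⁻¹ * logHessian ρ Gb y).trace := by
    rw [← sum_mul_eq_trace (isSymm_inv hs)]
    refine Finset.sum_congr rfl fun l _ => ?_
    have h1 : (Gb y) *ᵥ (S (basisVec l)) = fun i => logHessian ρ Gb y l i := by
      funext i
      rw [← metricForm_basisVec_left, isSymmForm_metricForm hs, ← hg, hS, h.logHessian_apply]
    have h2 : (S (basisVec l) : Fin (n + 1) → ℝ) = (Gb y)⁻¹ *ᵥ fun i => logHessian ρ Gb y l i := by
      rw [← h1, mulVec_mulVec, nonsing_inv_mul _ hb.isUnit_det, one_mulVec]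
    rw [h2]; rfl
  ext i j
  set v : Coord n := basisVec j
  set w : Coord n := basisVec i
  have hh : logHessian ρ Gb y i j = fderiv ℝ θ y v w - θ y (Γ y v w) := by
    rw [h.logHessian_apply, hsθ, hsΓ]
  have e1 : ∑ l, (fderiv ℝ θ y (basisVec l) w - θ y (Γ y (basisVec l) w)) * v l =
      logHessian ρ Gb y i j := by
    rw [hh]
    simpa using sum_mul_map_basisVec ((fderiv ℝ θ y).flip w - (θ y).comp ((Γ y).flip w)) v
  have e2 : ∑ l : Fin (n + 1), (basisVec l : Coord n) l = (n : ℝ) + 1 := by simp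
  have e3 : ∀ x : Coord n, ∑ l, g (basisVec l) w * x l = g x w := by
    intro x
    simpa using sum_mul_map_basisVec (g.flip w) x
  have e4 : ∀ x : Coord n, ∑ l, θ y (basisVec l) * x l = θ y x :=
    fun x => sum_mul_map_basisVec (θ y) x
  have hgij : g v w = Gb y i j := by
    rw [hg, metricForm, bilin_basisVec, hs.apply]
  rw [h.isMetricAt.ricci_eq, ricciForm_apply, trace_eq_sum]
  simp only [curvatureMap_apply, hcurv]
  have e5 : ∑ l, (curvature Γ y (basisVec l) v w) l = ricci Gb y i j := by
    rw [hb.ricci_eq, ricciForm_apply, trace_eq_sum]; rfl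
  have e6 : ∀ l, ((curvature Γ y (basisVec l) v w +
      ((fderiv ℝ θ y (basisVec l) w - θ y (Γ y (basisVec l) w)) • v -
          (fderiv ℝ θ y v w - θ y (Γ y v w)) • (basisVec l : Coord n)
        - g v w • S (basisVec l) + g (basisVec l) w • S v) +
      ((θ y v * θ y w) • (basisVec l : Coord n) - (θ y (basisVec l) * θ y w) • v -
        θ y X • (g v w • (basisVec l : Coord n) - g (basisVec l) w • v) +
        (θ y (basisVec l) * g v w - θ y v * g (basisVec l) w) • X)) : Coord n) l =
      (curvature Γ y (basisVec l) v w) l +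
      (fderiv ℝ θ y (basisVec l) w - θ y (Γ y (basisVec l) w)) * v l -
      (logHessian ρ Gb y i j - θ y v * θ y w + θ y X * g v w) * (basisVec l : Coord n) l -
      g v w * S (basisVec l) l + g (basisVec l) w * S v l - θ y w * (θ y (basisVec l) * v l) +
      θ y X * (g (basisVec l) w * v l) + g v w * (θ y (basisVec l) * X l) -
      θ y v * (g (basisVec l) w * X l) := by
    intro l
    rw [hh]
    simp only [PiLp.add_apply, PiLp.sub_apply, PiLp.smul_apply, smul_eq_mul]
    ring
  rw [Finset.sum_congr rfl fun l _ => e6 l]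
  simp only [Finset.sum_add_distrib, Finset.sum_sub_distrib, ← Finset.mul_sum, e1, e2, e3, e4, e5,
    htrS]
  have e7 : g (S v) w = logHessian ρ Gb y i j := by rw [hS, hh]
  have e8 : g X w = θ y w := metricForm_conformalGradient hb.posDef_self w
  have e9 : θ y v * θ y w = ((ρ y) ^ 2)⁻¹ * (gradVec ρ y i * gradVec ρ y j) := by
    rw [hθ, conformalOneForm_basisVec, conformalOneForm_basisVec]
    field_simp
  have e10 : θ y w * θ y v = ((ρ y) ^ 2)⁻¹ * (gradVec ρ y i * gradVec ρ y j) := by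
    rw [mul_comm, e9]
  simp only [Matrix.sub_apply, Matrix.smul_apply, vecMulVec, of_apply, smul_eq_mul]
  rw [e7, e8, ← hθX, ← hgij, e10, e9]
  ring

theorem trace_mul_vecMulVec {d : ℕ} (A : Matrix (Fin d) (Fin d) ℝ) (v w : Fin d → ℝ) :
    (A * vecMulVec v w).trace = w ⬝ᵥ A *ᵥ v := by
  rw [mul_vecMulVec, trace_vecMulVec, dotProduct_comm]

/-- The dρ ⊗ dρ part of the Hessian of -log ρ cancels the dw ⊗ dw term, and the Laplacian of -log ρ
cancels between Ric and R. Only ρ⁻¹∇²ρ and a multiple of the metric survive. -/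
theorem IsConformalAt.schouten_eq (hn : 2 ≤ n) (h : IsConformalAt ρ Gb G y) :
    schouten G y = schouten Gb y + (ρ y)⁻¹ • hessian Gb ρ y -
      ((1 / 2) * (((ρ y) ^ 2)⁻¹ * gradSq Gb ρ y)) • Gb y := by
  have hn1 : (n : ℝ) - 1 ≠ 0 := by
    have : (2 : ℝ) ≤ n := by exact_mod_cast hn
    linarith
  have hn0 : (n : ℝ) ≠ 0 := by
    have : (2 : ℝ) ≤ n := by exact_mod_cast hn
    linarith
  have hR : scalarCurvature G y = (ρ y) ^ 2 * (scalarCurvature Gb y -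
      2 * n * ((Gb y)⁻¹ * logHessian ρ Gb y).trace -
      n * ((n : ℝ) - 1) * (((ρ y) ^ 2)⁻¹ * gradSq Gb ρ y)) := by
    rw [h.isMetricAt.scalarCurvature_eq, h.metric.scalarCurvature_eq, h.inv_eq, h.ricci_eq]
    simp only [mul_sub, smul_mul_assoc, mul_smul_comm, trace_sub, trace_smul, smul_eq_mul,
      trace_mul_vecMulVec, nonsing_inv_mul _ h.metric.isUnit_det, trace_one, ← gradSq_eq]
    rw [Fintype.card_fin]
    push_cast
    ring
  ext i j
  rw [schouten, hR, h.ricci_eq, h.eventually_eq.self_of_nhds, schouten, logHessian]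
  simp only [Matrix.sub_apply, Matrix.smul_apply, Matrix.add_apply, smul_eq_mul]
  have h0 := h.pos.ne'
  field_simp
  ring

end Conformal

/-! ### Hadamard's lemma up to the boundary of a half space. -/

section Hadamard

open Filter Topology MeasureTheory

variable {V W : Type} [NormedAddCommGroup V] [NormedSpace ℝ V] [NormedAddCommGroup W]
  [NormedSpace ℝ W]

/-- Differentiation under the integral sign, up to the boundary of a convex set. -/
theorem hasFDerivWithinAt_integral_of_convex {s : Set V} (hs : Convex ℝ s) {f : V → ℝ → W}
    {f' : V → ℝ → V →L[ℝ] W}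
    (hf : ∀ t ∈ Icc (0 : ℝ) 1, ∀ y ∈ s, HasFDerivWithinAt (f · t) (f' y t) s y)
    (hfc : ∀ y ∈ s, ContinuousOn (f y) (Icc 0 1))
    (hf' : ContinuousOn f'.uncurry (s ×ˢ Icc 0 1)) {y : V} (hy : y ∈ s) :
    HasFDerivWithinAt (fun z => ∫ t in (0 : ℝ)..1, f z t) (∫ t in (0 : ℝ)..1, f' y t) s y := by
  have hI : uIcc (0 : ℝ) 1 = Icc 0 1 := uIcc_of_le zero_le_one
  have hint : ∀ z ∈ s, IntervalIntegrable (f z) volume 0 1 := fun z hz =>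
    ContinuousOn.intervalIntegrable (hI ▸ hfc z hz)
  have hint' : IntervalIntegrable (f' y) volume 0 1 := by
    refine ContinuousOn.intervalIntegrable (hI ▸ ?_)
    exact hf'.comp (f := fun t => (y, t)) (by fun_prop) fun t ht => ⟨hy, ht⟩
  rw [hasFDerivWithinAt_iff_isLittleO, Asymptotics.isLittleO_iff]
  intro c hc
  -- By compactness of [0, 1] the derivatives are within c of those at y, uniformly in t. The mean
  -- value inequality on the convex set s ∩ ball then bounds the remainder for all t at once.
  obtain ⟨v, hv, hvc⟩ := isCompact_Icc.mem_uniformity_of_prod hf' hy (Metric.dist_mem_uniformity hc)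
  obtain ⟨ε, hε, hball⟩ := Metric.mem_nhdsWithin_iff.1 hv
  filter_upwards [inter_mem self_mem_nhdsWithin (mem_nhdsWithin_of_mem_nhds
    (Metric.ball_mem_nhds y hε))] with z hz
  have hb : ∀ t ∈ Icc (0 : ℝ) 1, ‖f z t - f y t - f' y t (z - y)‖ ≤ c * ‖z - y‖ := by
    intro t ht
    refine (hs.inter (convex_ball y ε)).norm_image_sub_le_of_norm_hasFDerivWithin_le'
      (f := fun z => f z t) (f' := fun z => f' z t)
      (fun x hx => (hf t ht x hx.1).mono inter_subset_left) (fun x hx => ?_)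
      ⟨hy, Metric.mem_ball_self hε⟩ hz
    have := hvc x (hball ⟨hx.2, hx.1⟩) t ht
    rw [← dist_eq_norm]
    exact le_of_lt this
  have e : (∫ t in (0 : ℝ)..1, f z t) - (∫ t in (0 : ℝ)..1, f y t) -
      (∫ t in (0 : ℝ)..1, f' y t) (z - y) =
      ∫ t in (0 : ℝ)..1, (f z t - f y t - f' y t (z - y)) := by
    rw [intervalIntegral.integral_sub ((hint z hz.1).sub (hint y hy)),
      intervalIntegral.integral_sub (hint z hz.1) (hint y hy),
      ContinuousLinearMap.intervalIntegral_apply hint']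
    refine ContinuousOn.intervalIntegrable (hI ▸ ContinuousOn.clm_apply ?_ continuousOn_const)
    exact hf'.comp (f := fun t => (y, t)) (by fun_prop) fun t ht => ⟨hy, ht⟩
  rw [e]
  refine (intervalIntegral.norm_integral_le_of_norm_le_const (C := c * ‖z - y‖) fun t ht => ?_).trans
    (by simp)
  rw [uIoc_of_le zero_le_one] at ht
  exact hb t ⟨ht.1.le, ht.2⟩

theorem continuousOn_integral_Icc {V : Type} [TopologicalSpace V] {s : Set V} {f : V × ℝ → W}
    (hf : ContinuousOn f (s ×ˢ Icc (0 : ℝ) 1)) :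
    ContinuousOn (fun y => ∫ t in (0 : ℝ)..1, f (y, t)) s := by
  -- Clamping t to [0, 1] leaves the integral unchanged and makes the integrand continuous for all
  -- real t.
  have h : ∀ t : ℝ, (max 0 (min t 1)) ∈ Icc (0 : ℝ) 1 := fun t => ⟨le_max_left _ _, by simp⟩
  have e : ∀ y, ∫ t in (0 : ℝ)..1, f (y, t) = ∫ t in (0 : ℝ)..1, f (y, max 0 (min t 1)) := by
    intro y
    refine intervalIntegral.integral_congr fun t ht => ?_
    rw [uIcc_of_le zero_le_one] at ht
    simp [ht.1, ht.2]
  simp only [e]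
  rw [continuousOn_iff_continuous_domRestrict]
  refine intervalIntegral.continuous_parametric_intervalIntegral_of_continuous'
    (f := fun (y : s) t => f (y, max 0 (min t 1))) ?_ 0 1
  exact hf.comp_continuous (f := fun p : s × ℝ => ((p.1 : V), max 0 (min p.2 1)))
    (by fun_prop) fun p => ⟨p.1.2, h _⟩

/-- Induction on p with W varying, since the derivative of the integral is the integral of a partial
derivative with values in V →L[ℝ] W. -/
theorem contDiffOn_integral_nat {s : Set V} (hs : Convex ℝ s) (hs' : UniqueDiffOn ℝ s) (p : ℕ) :
    ∀ {W : Type} [NormedAddCommGroup W] [NormedSpace ℝ W] {f : V × ℝ → W}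
      (_ : ContDiffOn ℝ p f (s ×ˢ Icc (0 : ℝ) 1)),
      ContDiffOn ℝ p (fun y => ∫ t in (0 : ℝ)..1, f (y, t)) s := by
  have hu : UniqueDiffOn ℝ (s ×ˢ Icc (0 : ℝ) 1) := hs'.prod (uniqueDiffOn_Icc zero_lt_one)
  induction p with
  | zero =>
    intro W _ _ f hf
    rw [Nat.cast_zero, contDiffOn_zero] at hf ⊢
    exact continuousOn_integral_Icc hf
  | succ p ih =>
    intro W _ _ f hf
    rw [Nat.cast_succ] at hf ⊢
    have h1 := (contDiffOn_succ_iff_fderivWithin hu).1 hf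
    have h2 : ContDiffOn ℝ p (fun q => (fderivWithin ℝ f (s ×ˢ Icc (0 : ℝ) 1) q).comp
        (ContinuousLinearMap.inl ℝ V ℝ)) (s ×ˢ Icc (0 : ℝ) 1) :=
      h1.2.2.clm_comp contDiffOn_const
    rw [contDiffOn_succ_iff_hasFDerivWithinAt_of_uniqueDiffOn hs']
    refine ⟨by simp, _, ih h2, fun y hy => ?_⟩
    refine hasFDerivWithinAt_integral_of_convex hs (f := fun y t => f (y, t))
      (f' := fun y t => (fderivWithin ℝ f (s ×ˢ Icc (0 : ℝ) 1) (y, t)).comp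
        (ContinuousLinearMap.inl ℝ V ℝ)) (fun t ht z hz => ?_) (fun z hz => ?_) ?_ hy
    · have hmaps : MapsTo (fun x : V => (x, t)) s (s ×ˢ Icc (0 : ℝ) 1) := fun x hx => ⟨hx, ht⟩
      exact (h1.1 (z, t) ⟨hz, ht⟩).hasFDerivWithinAt.comp z
        ((hasFDerivAt_prodMk_left z t).hasFDerivWithinAt) hmaps
    · exact hf.continuousOn.comp (f := fun t => (z, t)) (by fun_prop) fun t ht => ⟨hz, ht⟩
    · exact h2.continuousOn

theorem contDiffOn_integral {s : Set V} (hs : Convex ℝ s) (hs' : UniqueDiffOn ℝ s) {p : ℕ∞}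
    {f : V × ℝ → W} (hf : ContDiffOn ℝ p f (s ×ˢ Icc (0 : ℝ) 1)) :
    ContDiffOn ℝ p (fun y => ∫ t in (0 : ℝ)..1, f (y, t)) s := by
  rw [contDiffOn_iff_forall_nat_le] at hf ⊢
  exact fun q hq => contDiffOn_integral_nat hs hs' q (hf q hq)

/-- The half space `{y₀ ≥ 0}`. -/
def halfSpace (n : ℕ) : Set (Coord n) := {y | 0 ≤ y 0}

/-- The open half space `{y₀ > 0}`. -/
def openHalfSpace (n : ℕ) : Set (Coord n) := {y | 0 < y 0}

variable {n : ℕ}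

theorem openHalfSpace_subset : openHalfSpace n ⊆ halfSpace n :=
  fun y (h : 0 < y 0) => show 0 ≤ y 0 from h.le

theorem isOpen_openHalfSpace : IsOpen (openHalfSpace n) :=
  isOpen_lt continuous_const (by fun_prop)

theorem convex_halfSpace : Convex ℝ (halfSpace n) := by
  intro x hx y hy a b ha hb _
  change 0 ≤ (a • x + b • y) 0
  simp only [PiLp.add_apply, PiLp.smul_apply, smul_eq_mul]
  exact add_nonneg (mul_nonneg ha hx) (mul_nonneg hb hy)

/-- Every point of the half space is a limit of points of the open half space. -/
theorem mem_closure_openHalfSpace {y : Coord n} (hy : y ∈ halfSpace n) :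
    y ∈ closure (openHalfSpace n) := by
  have h1 : Tendsto (fun t : ℝ => y + t • (basisVec 0 : Coord n)) (𝓝[>] 0) (𝓝 y) := by
    have : Continuous fun t : ℝ => y + t • (basisVec 0 : Coord n) := by fun_prop
    have h := (this.tendsto 0).mono_left (nhdsWithin_le_nhds (s := Ioi 0))
    simpa using h
  refine mem_closure_of_tendsto h1 ?_
  filter_upwards [self_mem_nhdsWithin] with t ht
  change 0 < (y + t • (basisVec 0 : Coord n)) 0
  have h2 : 0 ≤ y 0 := hy
  have h3 : 0 < t := ht
  simp only [PiLp.add_apply, PiLp.smul_apply, smul_eq_mul, basisVec]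
  simp
  linarith

theorem nonempty_interior_halfSpace : (interior (halfSpace n)).Nonempty := by
  have h0 : (0 : Coord n) ∈ closure (openHalfSpace n) :=
    mem_closure_openHalfSpace (by simp [halfSpace])
  obtain ⟨y, hy⟩ := closure_nonempty_iff.1 ⟨_, h0⟩
  exact ⟨y, interior_maximal openHalfSpace_subset isOpen_openHalfSpace hy⟩

theorem uniqueDiffOn_inter_halfSpace {O : Set (Coord n)} (hO : IsOpen O) :
    UniqueDiffOn ℝ (O ∩ halfSpace n) := by
  rw [inter_comm]
  exact (uniqueDiffOn_convex convex_halfSpace nonempty_interior_halfSpace).inter hO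

theorem mem_closure_inter {O : Set (Coord n)} (hO : IsOpen O) {y : Coord n}
    (hy : y ∈ O ∩ halfSpace n) : y ∈ closure (O ∩ openHalfSpace n) :=
  hO.inter_closure ⟨hy.1, mem_closure_openHalfSpace hy.2⟩

/-- Continuous functions which agree in the interior agree up to the boundary. -/
theorem eqOn_of_eqOn_interior {O : Set (Coord n)} (hO : IsOpen O) {E : Type*} [TopologicalSpace E]
    [T2Space E] {f g : Coord n → E} (hf : ContinuousOn f (O ∩ halfSpace n))
    (hg : ContinuousOn g (O ∩ halfSpace n)) (h : EqOn f g (O ∩ openHalfSpace n)) :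
    EqOn f g (O ∩ halfSpace n) :=
  h.of_subset_closure hf hg (inter_subset_inter_right _ openHalfSpace_subset)
    fun _ hy => mem_closure_inter hO hy

/-- Contraction of the first coordinate. -/
def shrink (q : Coord n × ℝ) : Coord n := q.1 - ((1 - q.2) * q.1 0) • basisVec 0

theorem contDiff_shrink {p : ℕ∞ω} : ContDiff ℝ p (shrink (n := n)) := by
  have : ContDiff ℝ p fun q : Coord n × ℝ => q.1 0 :=
    (EuclideanSpace.proj (𝕜 := ℝ) (0 : Fin (n + 1))).contDiff.comp contDiff_fst
  exact contDiff_fst.sub (((contDiff_const.sub contDiff_snd).mul this).smul contDiff_const)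

theorem shrink_zero_apply (y : Coord n) (t : ℝ) : shrink (y, t) 0 = t * y 0 := by
  simp [shrink, basisVec]
  ring

theorem norm_shrink_sub_le {x : Coord n} (hx : x 0 = 0) (y : Coord n) {t : ℝ}
    (ht : t ∈ Icc (0 : ℝ) 1) : ‖shrink (y, t) - x‖ ≤ ‖y - x‖ := by
  rw [EuclideanSpace.norm_eq, EuclideanSpace.norm_eq]
  refine Real.sqrt_le_sqrt (Finset.sum_le_sum fun i _ => ?_)
  rw [PiLp.sub_apply, PiLp.sub_apply]
  by_cases hi : i = 0
  · subst hi
    rw [shrink_zero_apply, hx, sub_zero, sub_zero, norm_mul]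
    have : ‖t‖ ≤ 1 := by rw [Real.norm_of_nonneg ht.1]; exact ht.2
    gcongr
    exact mul_le_of_le_one_left (norm_nonneg _) this
  · simp [shrink, basisVec, hi]

/-- The quotient of a function vanishing at the boundary by the boundary coordinate. -/
def boundaryQuotient (s : Set (Coord n)) (f : Coord n → ℝ) (y : Coord n) : ℝ :=
  if 0 < y 0 then f y / y 0 else fderivWithin ℝ f s y (basisVec 0)

theorem mul_boundaryQuotient {O : Set (Coord n)} {f : Coord n → ℝ}
    (h0 : ∀ y ∈ O, y 0 = 0 → f y = 0) {y : Coord n} (hy : y ∈ O ∩ halfSpace n) :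
    y 0 * boundaryQuotient (O ∩ halfSpace n) f y = f y := by
  by_cases h : 0 < y 0
  · rw [boundaryQuotient, if_pos h]
    field_simp
  · have h1 : y 0 = 0 := le_antisymm (not_lt.1 h) hy.2
    rw [h0 y hy.1 h1, h1, zero_mul]

/-- Near the boundary f(y)/y₀ is the integral over t of ∂₀f at `shrink (y, t)`, which is as regular
as ∂₀f. This is why one derivative is lost. -/
theorem contDiffOn_boundaryQuotient {O : Set (Coord n)} (hO : IsOpen O) {f : Coord n → ℝ} {p : ℕ∞}
    (hf : ContDiffOn ℝ (p + 1) f (O ∩ halfSpace n)) (h0 : ∀ y ∈ O, y 0 = 0 → f y = 0) :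
    ContDiffOn ℝ p (boundaryQuotient (O ∩ halfSpace n) f) (O ∩ halfSpace n) := by
  intro x hx
  by_cases hx0 : 0 < x 0
  · have h1 : ContDiffWithinAt ℝ p (fun y => f y / y 0) (O ∩ halfSpace n) x :=
      ((hf x hx).of_le le_self_add).div
        (EuclideanSpace.proj (𝕜 := ℝ) (0 : Fin (n + 1))).contDiff.contDiffWithinAt hx0.ne'
    refine h1.congr_of_eventuallyEq ?_ (by rw [boundaryQuotient, if_pos hx0])
    filter_upwards [mem_nhdsWithin_of_mem_nhds (isOpen_openHalfSpace.mem_nhds hx0)] with y hy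
    exact if_pos hy
  have hx0 : x 0 = 0 := le_antisymm (not_lt.1 hx0) hx.2
  obtain ⟨ε, hε, hball⟩ := Metric.isOpen_iff.1 hO x hx.1
  -- A half ball around a boundary point is convex and stable under `shrink`, as neither need hold
  -- for O ∩ halfSpace.
  set c : Set (Coord n) := Metric.ball x ε ∩ halfSpace n with hc
  have hcs : c ⊆ O ∩ halfSpace n := inter_subset_inter_left _ hball
  have hcc : Convex ℝ c := (convex_ball x ε).inter convex_halfSpace
  have hcu : UniqueDiffOn ℝ c := uniqueDiffOn_inter_halfSpace Metric.isOpen_ball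
  have hfc : ContDiffOn ℝ (p + 1) f c := hf.mono hcs
  have hmaps : MapsTo (shrink (n := n)) (c ×ˢ Icc (0 : ℝ) 1) c := by
    rintro ⟨y, t⟩ ⟨hy, ht⟩
    refine ⟨?_, ?_⟩
    · rw [mem_ball_iff_norm]
      exact (norm_shrink_sub_le hx0 y ht).trans_lt (mem_ball_iff_norm.1 hy.1)
    · change 0 ≤ shrink (y, t) 0
      rw [shrink_zero_apply]
      exact mul_nonneg ht.1 hy.2
  have h1 : ContDiffOn ℝ p (fun y => fderivWithin ℝ f c y (basisVec 0)) c :=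
    (hfc.fderivWithin hcu le_rfl).clm_apply contDiffOn_const
  have h2 := contDiffOn_integral hcc hcu (h1.comp contDiff_shrink.contDiffOn hmaps)
  have hxc : x ∈ c := ⟨Metric.mem_ball_self hε, hx.2⟩
  have hcn : c ∈ 𝓝[O ∩ halfSpace n] x :=
    inter_mem (mem_nhdsWithin_of_mem_nhds (Metric.ball_mem_nhds x hε))
      (mem_of_superset self_mem_nhdsWithin inter_subset_right)
  have h3 : EqOn (boundaryQuotient (O ∩ halfSpace n) f)
      (fun y => ∫ t in (0 : ℝ)..1, fderivWithin ℝ f c (shrink (y, t)) (basisVec 0)) c := by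
    intro y hy
    have hcont : ContinuousOn (fun t : ℝ => fderivWithin ℝ f c (shrink (y, t)) (basisVec 0))
        (Icc 0 1) :=
      h1.continuousOn.comp (f := fun t : ℝ => shrink (y, t))
        (contDiff_shrink (p := 0).continuous.comp (by fun_prop)).continuousOn
        fun t ht => hmaps ⟨hy, ht⟩
    by_cases hy0 : 0 < y 0
    · have hS : ∀ t : ℝ, HasDerivAt (fun t : ℝ => shrink (y, t)) (y 0 • basisVec 0) t := by
        intro t
        have := (((hasDerivAt_id t).const_sub 1).mul_const (y 0)).smul_const
          (basisVec 0 : Coord n) |>.const_sub y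
        simpa [shrink] using this
      have hd : ∀ t ∈ Icc (0 : ℝ) 1, HasDerivWithinAt (fun t : ℝ => f (shrink (y, t)))
          (y 0 * fderivWithin ℝ f c (shrink (y, t)) (basisVec 0)) (Icc 0 1) t := by
        intro t ht
        have := ((hfc.differentiableOn (by simp)) _
          (hmaps (⟨hy, ht⟩ : (y, t) ∈ c ×ˢ Icc (0 : ℝ) 1))).hasFDerivWithinAt.comp_hasDerivWithinAt
          t (hS t).hasDerivWithinAt (fun u hu => hmaps ⟨hy, hu⟩)
        rw [map_smul, smul_eq_mul] at this
        exact this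
      have hftc := intervalIntegral.integral_eq_sub_of_hasDerivAt_of_le zero_le_one
        (fun t ht => (hd t ht).continuousWithinAt)
        (fun t ht => (hd t ⟨ht.1.le, ht.2.le⟩).hasDerivAt (Icc_mem_nhds ht.1 ht.2))
        (ContinuousOn.intervalIntegrable ((uIcc_of_le (zero_le_one (α := ℝ))).symm ▸
          (continuousOn_const.mul hcont)))
      have e1 : shrink (y, 1) = y := by simp [shrink]
      have e0 : f (shrink (y, 0)) = 0 := by
        refine h0 _ (hcs (hmaps (⟨hy, by simp⟩ : (y, (0 : ℝ)) ∈ c ×ˢ Icc (0 : ℝ) 1))).1 ?_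
        rw [shrink_zero_apply, zero_mul]
      rw [e1, e0, sub_zero, intervalIntegral.integral_const_mul] at hftc
      rw [boundaryQuotient, if_pos hy0, ← hftc]
      field_simp
    · have hy0' : y 0 = 0 := le_antisymm (not_lt.1 hy0) hy.2
      rw [boundaryQuotient, if_neg hy0]
      -- On the boundary the integrand is constant, equal to ∂₀f(y), which is the value chosen in
      -- `boundaryQuotient`.
      have e : ∀ t : ℝ, shrink (y, t) = y := fun t => by simp [shrink, hy0']
      simp only [e]
      rw [intervalIntegral.integral_const, sub_zero, one_smul]
      have : c = (O ∩ halfSpace n) ∩ Metric.ball x ε := by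
        ext z
        exact ⟨fun hz => ⟨hcs hz, hz.1⟩, fun hz => ⟨hz.2, hz.1.2⟩⟩
      rw [this, fderivWithin_inter (Metric.isOpen_ball.mem_nhds hy.1)]
  exact (((h2 x hxc).congr (fun y hy => h3 hy) (h3 hxc)).mono_of_mem_nhdsWithin hcn)

end Hadamard

/-! ### Functions on the open half space that extend regularly to the boundary. -/

section Extension

open Filter Topology Matrix

variable {n : ℕ} {O : Set (Coord n)} {p : ℕ∞ω} {f g : Coord n → ℝ}
  {A B : Coord n → Matrix (Fin (n + 1)) (Fin (n + 1)) ℝ}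

/-- The restriction of `f` to the interior extends to a `C^p` function up to the boundary. -/
def ExtendsOn (O : Set (Coord n)) (p : ℕ∞ω) (f : Coord n → ℝ) : Prop :=
  ∃ F, ContDiffOn ℝ p F (O ∩ halfSpace n) ∧ EqOn f F (O ∩ openHalfSpace n)

theorem inter_openHalfSpace_subset : O ∩ openHalfSpace n ⊆ O ∩ halfSpace n :=
  inter_subset_inter_right _ openHalfSpace_subset

theorem inter_halfSpace_mem_nhds (hO : IsOpen O) {y : Coord n} (hy : y ∈ O ∩ openHalfSpace n) :
    O ∩ halfSpace n ∈ 𝓝 y :=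
  mem_of_superset ((hO.inter isOpen_openHalfSpace).mem_nhds hy) inter_openHalfSpace_subset

theorem extendsOn_of_contDiffOn (h : ContDiffOn ℝ p f (O ∩ halfSpace n)) : ExtendsOn O p f :=
  ⟨f, h, fun _ _ => rfl⟩

namespace ExtendsOn

theorem congr (h : ExtendsOn O p f) (hfg : EqOn g f (O ∩ openHalfSpace n)) : ExtendsOn O p g := by
  obtain ⟨F, hF, hf⟩ := h
  exact ⟨F, hF, hfg.trans hf⟩

theorem of_le {q : ℕ∞ω} (h : ExtendsOn O p f) (hq : q ≤ p) : ExtendsOn O q f := by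
  obtain ⟨F, hF, hf⟩ := h
  exact ⟨F, hF.of_le hq, hf⟩

theorem const (c : ℝ) : ExtendsOn O p fun _ => c := extendsOn_of_contDiffOn contDiffOn_const

theorem add (hf : ExtendsOn O p f) (hg : ExtendsOn O p g) : ExtendsOn O p fun y => f y + g y := by
  obtain ⟨F, hF, hf⟩ := hf
  obtain ⟨F', hF', hg⟩ := hg
  exact ⟨_, hF.add hF', fun y hy => congr_arg₂ (· + ·) (hf hy) (hg hy)⟩

theorem mul (hf : ExtendsOn O p f) (hg : ExtendsOn O p g) : ExtendsOn O p fun y => f y * g y := by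
  obtain ⟨F, hF, hf⟩ := hf
  obtain ⟨F', hF', hg⟩ := hg
  exact ⟨_, hF.mul hF', fun y hy => congr_arg₂ (· * ·) (hf hy) (hg hy)⟩

theorem neg (hf : ExtendsOn O p f) : ExtendsOn O p fun y => -f y := by
  simpa using (const (O := O) (-1)).mul hf

theorem sub (hf : ExtendsOn O p f) (hg : ExtendsOn O p g) : ExtendsOn O p fun y => f y - g y := by
  simpa only [sub_eq_add_neg] using hf.add hg.neg

theorem pow (hf : ExtendsOn O p f) (k : ℕ) : ExtendsOn O p fun y => f y ^ k := by
  obtain ⟨F, hF, hf⟩ := hf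
  exact ⟨_, hF.pow k, fun y hy => congr_arg (· ^ k) (hf hy)⟩

theorem sum {ι : Type*} {t : Finset ι} {f : ι → Coord n → ℝ}
    (hf : ∀ i ∈ t, ExtendsOn O p (f i)) : ExtendsOn O p fun y => ∑ i ∈ t, f i y := by
  classical
  induction t using Finset.induction_on with
  | empty => simpa using const (O := O) 0
  | insert a t ha ih =>
    simp only [Finset.sum_insert ha]
    exact (hf a (by simp)).add (ih fun i hi => hf i (by simp [hi]))

/-- The partial derivative uses the full derivative, which carries no information at boundary
points. In the open half space it equals `fderivWithin` of the extension, and that is regular up to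
the boundary. -/
theorem pderiv (hO : IsOpen O) (hf : ExtendsOn O (p + 1) f) (i : Fin (n + 1)) :
    ExtendsOn O p (ConformallyCompact.pderiv i f) := by
  obtain ⟨F, hF, hf⟩ := hf
  refine ⟨fun y => fderivWithin ℝ F (O ∩ halfSpace n) y (basisVec i),
    (hF.fderivWithin (uniqueDiffOn_inter_halfSpace hO) le_rfl).clm_apply contDiffOn_const,
    fun y hy => ?_⟩
  have : f =ᶠ[𝓝 y] F := by
    filter_upwards [(hO.inter isOpen_openHalfSpace).mem_nhds hy] with z hz using hf hz
  simp only [ConformallyCompact.pderiv]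
  rw [this.fderiv_eq, fderivWithin_of_mem_nhds (inter_halfSpace_mem_nhds hO hy)]

end ExtendsOn

/-- The entries of the matrix extend up to the boundary. -/
def MatrixExtendsOn (O : Set (Coord n)) (p : ℕ∞ω)
    (A : Coord n → Matrix (Fin (n + 1)) (Fin (n + 1)) ℝ) : Prop :=
  ∀ i j, ExtendsOn O p fun y => A y i j

namespace MatrixExtendsOn

theorem exists_extension (h : MatrixExtendsOn O p A) :
    ∃ F : Coord n → Matrix (Fin (n + 1)) (Fin (n + 1)) ℝ,
      (∀ i j, ContDiffOn ℝ p (fun y => F y i j) (O ∩ halfSpace n)) ∧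
        EqOn A F (O ∩ openHalfSpace n) := by
  choose F hF hA using h
  exact ⟨fun y => of fun i j => F i j y, hF, fun y hy => ext fun i j => hA i j hy⟩

theorem congr (h : MatrixExtendsOn O p A) (hAB : EqOn B A (O ∩ openHalfSpace n)) :
    MatrixExtendsOn O p B := fun i j => (h i j).congr fun y hy => by rw [hAB hy]

theorem of_le {q : ℕ∞ω} (h : MatrixExtendsOn O p A) (hq : q ≤ p) : MatrixExtendsOn O q A :=
  fun i j => (h i j).of_le hq

theorem const (C : Matrix (Fin (n + 1)) (Fin (n + 1)) ℝ) : MatrixExtendsOn O p fun _ => C :=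
  fun _ _ => .const _

theorem add (hA : MatrixExtendsOn O p A) (hB : MatrixExtendsOn O p B) :
    MatrixExtendsOn O p fun y => A y + B y := fun i j => (hA i j).add (hB i j)

theorem sub (hA : MatrixExtendsOn O p A) (hB : MatrixExtendsOn O p B) :
    MatrixExtendsOn O p fun y => A y - B y := fun i j => (hA i j).sub (hB i j)

theorem smul (hf : ExtendsOn O p f) (hA : MatrixExtendsOn O p A) :
    MatrixExtendsOn O p fun y => f y • A y := fun i j => hf.mul (hA i j)

theorem mul (hA : MatrixExtendsOn O p A) (hB : MatrixExtendsOn O p B) :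
    MatrixExtendsOn O p fun y => A y * B y := fun i j => by
  simp only [mul_apply]
  exact ExtendsOn.sum fun a _ => (hA i a).mul (hB a j)

theorem trace (hA : MatrixExtendsOn O p A) : ExtendsOn O p fun y => (A y).trace :=
  ExtendsOn.sum fun a _ => hA a a

theorem sum {ι : Type*} {t : Finset ι} {A : ι → Coord n → Matrix (Fin (n + 1)) (Fin (n + 1)) ℝ}
    (hA : ∀ i ∈ t, MatrixExtendsOn O p (A i)) : MatrixExtendsOn O p fun y => ∑ i ∈ t, A i y :=
  fun a b => by
    simp only [Matrix.sum_apply]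
    exact ExtendsOn.sum fun i hi => hA i hi a b

theorem sigma (hA : MatrixExtendsOn O p A) (k : ℕ) :
    ExtendsOn O p fun y => sigma k (A y) := by
  obtain ⟨F, hF, hAF⟩ := hA.exists_extension
  exact ⟨_, fun y hy => contDiffWithinAt_sigma k fun i j => hF i j y hy,
    fun y hy => congr_arg (ConformallyCompact.sigma k) (hAF hy)⟩

theorem newton (hA : MatrixExtendsOn O p A) (k : ℕ) :
    MatrixExtendsOn O p fun y => newton k (A y) := by
  obtain ⟨F, hF, hAF⟩ := hA.exists_extension
  exact fun i j => ⟨_, fun y hy => contDiffWithinAt_newton k (fun i j => hF i j y hy) i j,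
    fun y hy => by simp only [hAF hy]⟩

theorem sigmaRemainder (k : ℕ) (c : ℝ) (hf : ExtendsOn O p f) (hA : MatrixExtendsOn O p A) :
    ExtendsOn O p fun y => sigmaRemainder k c (f y) (A y) :=
  ExtendsOn.sum fun j _ => (ExtendsOn.const _).mul ((hf.pow _).mul (hA.sigma j))

theorem newtonRemainder (k : ℕ) (c : ℝ) (hf : ExtendsOn O p f) (hA : MatrixExtendsOn O p A) :
    MatrixExtendsOn O p fun y => newtonRemainder k c (f y) (A y) :=
  MatrixExtendsOn.sum fun j _ => smul ((ExtendsOn.const _).mul (hf.pow _)) (hA.newton j)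

end MatrixExtendsOn

/-- The vector field, in components, extends up to the boundary. -/
theorem MatrixExtendsOn.mulVec (hA : MatrixExtendsOn O p A) {v : Coord n → Fin (n + 1) → ℝ}
    (hv : ∀ i, ExtendsOn O p fun y => v y i) (i : Fin (n + 1)) :
    ExtendsOn O p fun y => (A y *ᵥ v y) i := by
  simp only [Matrix.mulVec, dotProduct]
  exact ExtendsOn.sum fun a _ => (hA i a).mul (hv a)

end Extension

/-! ### Boundary regularity of the geometric quantities of the compactified metric. -/

section ExtensionCurvature

open Filter Topology Matrix

variable {n : ℕ} {O : Set (Coord n)} {p : ℕ∞ω} {f : Coord n → ℝ}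
  {G : Coord n → Matrix (Fin (n + 1)) (Fin (n + 1)) ℝ}

theorem extendsOn_christoffel (hO : IsOpen O) (hG : MatrixExtendsOn O (p + 1) G)
    (hG' : MatrixExtendsOn O p fun y => (G y)⁻¹) (l i j : Fin (n + 1)) :
    ExtendsOn O p (christoffel G l i j) :=
  (ExtendsOn.const _).mul (ExtendsOn.sum fun _ _ => (hG' _ _).mul
    ((((hG _ _).pderiv hO _).add ((hG _ _).pderiv hO _)).sub ((hG _ _).pderiv hO _)))

theorem matrixExtendsOn_ricci (hO : IsOpen O) (hG : MatrixExtendsOn O (p + 2) G)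
    (hG' : MatrixExtendsOn O (p + 2) fun y => (G y)⁻¹) : MatrixExtendsOn O p (ricci G) := by
  have e : p + 2 = p + 1 + 1 := by rw [add_assoc, one_add_one_eq_two]
  have h1 : ∀ l i j, ExtendsOn O (p + 1) (christoffel G l i j) :=
    fun l i j => extendsOn_christoffel hO (e ▸ hG) (hG'.of_le (e ▸ le_self_add)) l i j
  have h2 : ∀ l i j, ExtendsOn O p (christoffel G l i j) := fun l i j => (h1 l i j).of_le le_self_add
  exact fun i j => (ExtendsOn.sum fun l _ => ((h1 _ _ _).pderiv hO _).sub
    ((h1 _ _ _).pderiv hO _)).add (ExtendsOn.sum fun _ _ => ExtendsOn.sum fun _ _ =>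
      ((h2 _ _ _).mul (h2 _ _ _)).sub ((h2 _ _ _).mul (h2 _ _ _)))

theorem matrixExtendsOn_schouten (hO : IsOpen O) (hG : MatrixExtendsOn O (p + 2) G)
    (hG' : MatrixExtendsOn O (p + 2) fun y => (G y)⁻¹) : MatrixExtendsOn O p (schouten G) := by
  have hR := matrixExtendsOn_ricci hO hG hG'
  have hS : ExtendsOn O p (scalarCurvature G) :=
    ExtendsOn.sum fun _ _ => ExtendsOn.sum fun _ _ =>
      (hG'.of_le le_self_add _ _).mul (hR _ _)
  refine MatrixExtendsOn.smul (.const _) (hR.sub (MatrixExtendsOn.smul ?_ (hG.of_le le_self_add)))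
  simpa only [div_eq_mul_inv] using hS.mul (.const _)

theorem matrixExtendsOn_hessian (hO : IsOpen O) (hG : MatrixExtendsOn O (p + 1) G)
    (hG' : MatrixExtendsOn O p fun y => (G y)⁻¹) (hf : ExtendsOn O (p + 2) f) :
    MatrixExtendsOn O p (hessian G f) := by
  have e : p + 2 = p + 1 + 1 := by rw [add_assoc, one_add_one_eq_two]
  have h1 : ∀ i, ExtendsOn O (p + 1) (pderiv i f) := fun i => (e ▸ hf).pderiv hO i
  exact fun i j => ((h1 j).pderiv hO i).sub (ExtendsOn.sum fun _ _ =>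
    (extendsOn_christoffel hO hG hG' _ _ _).mul ((h1 _).of_le le_self_add))

end ExtensionCurvature

/-! ### The boundary value a₀ of |dρ|² and the constants of the theorem. -/

section Constants

/-- The boundary value of `|dρ|²`. -/
def boundaryGradSq (k n : ℕ) (β : ℝ) : ℝ := (β / betaHyp k n) ^ ((1 : ℝ) / k)

variable {k n : ℕ} {β : ℝ}

theorem betaHyp_pos (hk : k ≤ n + 1) : 0 < betaHyp k n :=
  mul_pos (by positivity) (by exact_mod_cast Nat.choose_pos hk)

theorem boundaryGradSq_pos (hk : k ≤ n + 1) (hβ : 0 < β) : 0 < boundaryGradSq k n β :=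
  Real.rpow_pos_of_pos (div_pos hβ (betaHyp_pos hk)) _

theorem boundaryGradSq_pow (hk : k ≤ n + 1) (hβ : 0 < β) (j : ℕ) :
    boundaryGradSq k n β ^ j = (β / betaHyp k n) ^ ((j : ℝ) / k) := by
  rw [boundaryGradSq, ← Real.rpow_natCast, ← Real.rpow_mul (div_pos hβ (betaHyp_pos hk)).le]
  congr 1
  ring

theorem choose_mul_pow_boundaryGradSq (hk1 : 1 ≤ k) (hk : k ≤ n + 1) (hβ : 0 < β) :
    ((n + 1).choose k : ℝ) * (boundaryGradSq k n β / 2) ^ k = β := by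
  have hk0 : (k : ℝ) ≠ 0 := by exact_mod_cast (by omega : k ≠ 0)
  have hc : ((n + 1).choose k : ℝ) ≠ 0 := by exact_mod_cast (Nat.choose_pos hk).ne'
  rw [div_pow, boundaryGradSq_pow hk hβ, div_self hk0, Real.rpow_one, betaHyp, zpow_neg,
    zpow_natCast]
  field_simp

theorem eq_boundaryGradSq (hk1 : 1 ≤ k) (hk : k ≤ n + 1) (hβ : 0 < β) {a : ℝ} (ha : 0 ≤ a)
    (h : ((n + 1).choose k : ℝ) * (a / 2) ^ k = β) : a = boundaryGradSq k n β := by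
  have hc : ((n + 1).choose k : ℝ) ≠ 0 := by exact_mod_cast (Nat.choose_pos hk).ne'
  have h1 := mul_left_cancel₀ hc (h.trans (choose_mul_pow_boundaryGradSq hk1 hk hβ).symm)
  have h2 := (pow_left_inj₀ (by positivity)
    (div_nonneg (boundaryGradSq_pos hk hβ).le zero_le_two) (by omega)).1 h1
  linarith

/-- (β/β⁰)^{(k-1)/k} is a₀^{k-1}, and 2^{1-k} turns a₀ into a₀/2. The right side is the form in
which the constant appears in the expansion of T_{k-1}. -/
theorem cConst_mul_rpow (hk1 : 1 ≤ k) (hk : k ≤ n + 1) (hβ : 0 < β) :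
    cConst k n * (β / betaHyp k n) ^ (((k : ℝ) - 1) / k) =
      (n.choose (k - 1) : ℝ) * (boundaryGradSq k n β / 2) ^ (k - 1) := by
  obtain ⟨j, rfl⟩ := Nat.exists_eq_add_of_le hk1
  have e1 : (((1 + j : ℕ) : ℝ) - 1) = (j : ℝ) := by push_cast; ring
  have e2 : (1 : ℤ) - ((1 + j : ℕ) : ℤ) = -(j : ℤ) := by push_cast; ring
  rw [div_pow, Nat.add_sub_cancel_left, boundaryGradSq_pow hk hβ, cConst, e1, e2, zpow_neg,
    zpow_natCast, Nat.add_sub_cancel_left]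
  field_simp

end Constants

/-! ### The Hessian applied to the gradient. -/

section GradientIdentity

open Filter Topology Matrix

variable {n : ℕ} {G : Coord n → Matrix (Fin (n + 1)) (Fin (n + 1)) ℝ} {y : Coord n}
  {u : Coord n → ℝ}

/-- The gradient of `u`. -/
def gradient (G : Coord n → Matrix (Fin (n + 1)) (Fin (n + 1)) ℝ) (u : Coord n → ℝ) (y : Coord n) :
    Coord n := WithLp.toLp 2 ((G y)⁻¹ *ᵥ gradVec u y)

theorem metricForm_gradient (h : (G y).PosDef) (v : Coord n) :
    metricForm G y (gradient G u y) v = fderiv ℝ u y v := by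
  have hu : IsUnit (G y).det := (isUnit_iff_isUnit_det _).1 h.isUnit
  refine basisVec_induction (p := fun v => metricForm G y (gradient G u y) v = fderiv ℝ u y v)
    (fun v w hv hw => ?_) (fun c v hv => ?_) (fun i => ?_) v
  · rw [map_add, map_add, hv, hw]
  · rw [map_smul, map_smul, hv]
  · rw [isSymmForm_metricForm (isSymm_of_posDef h), metricForm_basisVec_left]
    have : ((gradient G u y : Coord n) : Fin (n + 1) → ℝ) = (G y)⁻¹ *ᵥ gradVec u y := rfl
    rw [this, mulVec_mulVec, mul_nonsing_inv _ hu, one_mulVec]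
    rfl

theorem fderiv_gradient : fderiv ℝ u y (gradient G u y) = gradSq G u y := by
  rw [gradSq_eq, linear_eq_sum, dotProduct_comm]
  rfl

theorem contDiffAt_gradient (h : IsMetricAt G y) (hu : ContDiffAt ℝ 2 u y) :
    ContDiffAt ℝ 1 (gradient G u) y := by
  rw [contDiffAt_euclidean]
  intro l
  change ContDiffAt ℝ 1 (fun z => ∑ m, (G z)⁻¹ l m * pderiv m u z) y
  exact ContDiffAt.sum fun m _ => ((h.contDiffAt_inv l m).of_le (by norm_num)).mul
    (contDiffAt_pderiv hu (by norm_num) m)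

/-- `∇²u (∇u, ·) = ½ d|∇u|²`. -/
theorem hessian_mulVec_gradient (h : IsMetricAt G y) (hu : ContDiffAt ℝ 2 u y) :
    hessian G u y *ᵥ ((G y)⁻¹ *ᵥ gradVec u y) = (1 / 2 : ℝ) • gradVec (gradSq G u) y := by
  have hX := ((contDiffAt_gradient h hu).differentiableAt (by norm_num)).hasFDerivAt
  have hd := ((contDiffAt_fderiv_of_two hu).differentiableAt (by norm_num)).hasFDerivAt
  have hg := h.differentiableAt_metricForm.hasFDerivAt
  set X := gradient G u with hXdef
  funext l
  -- With X = ∇u, differentiate |∇u|² = du(X), and separately du = g(X, ·) evaluated on the frozen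
  -- vector X(y). Metric compatibility replaces the derivative of g by twice the Christoffel term,
  -- so d|∇u|² becomes twice the Hessian contracted with X.
  have h1 : fderiv ℝ (gradSq G u) y (basisVec l) =
      fderiv ℝ (fderiv ℝ u) y (basisVec l) (X y) + fderiv ℝ u y (fderiv ℝ X y (basisVec l)) := by
    have e : gradSq G u =ᶠ[𝓝 y] fun z => fderiv ℝ u z (X z) := 
      Eventually.of_forall fun z => fderiv_gradient.symm
    rw [e.fderiv_eq, (hd.clm_apply hX).fderiv]
    simp
    ring
  have h2 : fderiv ℝ (fderiv ℝ u) y (basisVec l) (X y) =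
      fderiv ℝ (metricForm G) y (basisVec l) (X y) (X y) +
        metricForm G y (fderiv ℝ X y (basisVec l)) (X y) := by
    have e : (fun z => fderiv ℝ u z (X y)) =ᶠ[𝓝 y] fun z => metricForm G z (X z) (X y) := by
      filter_upwards [h.posDef] with z hz using (metricForm_gradient hz _).symm
    have e1 := e.fderiv_eq (𝕜 := ℝ)
    rw [(hd.clm_apply (hasFDerivAt_const (X y) y)).fderiv,
      ((hg.clm_apply hX).clm_apply (hasFDerivAt_const (X y) y)).fderiv] at e1
    have e2 := congrArg (fun L => L (basisVec l)) e1
    simp at e2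
    linarith
  have h3 := h.isKoszul.fderiv_eq h.differentiableAt_metricForm h.isSymmForm (basisVec l) (X y) (X y)
  have hs := isSymmForm_metricForm (isSymm_of_posDef h.posDef_self)
  rw [hs (christoffelForm G y (basisVec l) (X y)) (X y), metricForm_gradient h.posDef_self] at h3
  rw [hs (fderiv ℝ X y (basisVec l)) (X y), metricForm_gradient h.posDef_self] at h2
  have h4 : (hessian G u y *ᵥ ((G y)⁻¹ *ᵥ gradVec u y)) l =
      fderiv ℝ (fderiv ℝ u) y (basisVec l) (X y) -
        fderiv ℝ u y (christoffelForm G y (basisVec l) (X y)) := by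
    have := sum_mul_map_basisVec (fderiv ℝ (fderiv ℝ u) y (basisVec l) -
      (fderiv ℝ u y).comp (christoffelForm G y (basisVec l))) (X y)
    simp only [_root_.sub_apply, ContinuousLinearMap.comp_apply] at this
    rw [← this]
    simp only [mulVec, dotProduct, ConformallyCompact.hessian_eq hu]
    rfl
  rw [h4, Pi.smul_apply, gradVec, pderiv, h1, smul_eq_mul]
  linarith

end GradientIdentity

/-! ### A boundary chart: the endomorphism -G⁻¹A and the boundary value of |dr|². -/

section Chart

open Filter Topology Matrix

variable {n : ℕ} {O : Set (Coord n)} {p : ℕ∞} {k : ℕ} {β : ℝ} {r : Coord n → ℝ}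
  {Gb G : Coord n → Matrix (Fin (n + 1)) (Fin (n + 1)) ℝ} {y : Coord n}

/-- In coordinates, the metric `G` is conformally compact and solves the `σ_k`-Yamabe equation. -/
structure IsSolutionChart (p : ℕ∞) (k : ℕ) (β : ℝ) (O : Set (Coord n)) (r : Coord n → ℝ)
    (Gb G : Coord n → Matrix (Fin (n + 1)) (Fin (n + 1)) ℝ) : Prop where
  isOpen : IsOpen O
  contDiffOn : ContDiffOn ℝ (p + 3) r (O ∩ halfSpace n)
  contDiffOn_metric : ∀ i j, ContDiffOn ℝ (p + 2) (fun y => Gb y i j) (O ∩ halfSpace n)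
  posDef : ∀ y ∈ O ∩ halfSpace n, (Gb y).PosDef
  pos : ∀ y ∈ O ∩ openHalfSpace n, 0 < r y
  eq_zero : ∀ y ∈ O, y 0 = 0 → r y = 0
  fderivWithin_ne_zero : ∀ y ∈ O, y 0 = 0 → fderivWithin ℝ r (O ∩ halfSpace n) y ≠ 0
  conformal : ∀ y ∈ O ∩ openHalfSpace n, G y = ((r y) ^ 2)⁻¹ • Gb y
  sigma_eq : ∀ y ∈ O ∩ openHalfSpace n, sigma k ((G y)⁻¹ * (-schouten G y)) = β

namespace IsSolutionChart

theorem inter_mem_nhds (h : IsSolutionChart p k β O r Gb G) (hy : y ∈ O ∩ openHalfSpace n) :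
    O ∩ openHalfSpace n ∈ 𝓝 y := (h.isOpen.inter isOpen_openHalfSpace).mem_nhds hy

theorem isConformalAt (h : IsSolutionChart p k β O r Gb G) (hy : y ∈ O ∩ openHalfSpace n) :
    IsConformalAt r Gb G y := by
  have hs := inter_halfSpace_mem_nhds h.isOpen hy
  have hn := h.inter_mem_nhds hy
  refine ⟨((h.contDiffOn y (inter_openHalfSpace_subset hy)).contDiffAt hs).of_le ?_, h.pos y hy,
    ⟨fun i j => ((h.contDiffOn_metric i j y (inter_openHalfSpace_subset hy)).contDiffAt
      hs).of_le le_add_self, ?_⟩, ?_⟩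
  · exact le_trans (by norm_num) (le_add_self (a := (3 : ℕ∞ω)))
  · filter_upwards [hn] with z hz using h.posDef z (inter_openHalfSpace_subset hz)
  · filter_upwards [hn] with z hz using h.conformal z hz

theorem extendsOn_r (h : IsSolutionChart p k β O r Gb G) : ExtendsOn O (p + 3) r :=
  extendsOn_of_contDiffOn h.contDiffOn

theorem extendsOn_metric (h : IsSolutionChart p k β O r Gb G) : MatrixExtendsOn O (p + 2) Gb :=
  fun i j => extendsOn_of_contDiffOn (h.contDiffOn_metric i j)

theorem contDiffOn_inv (h : IsSolutionChart p k β O r Gb G) (i j : Fin (n + 1)) :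
    ContDiffOn ℝ (p + 2) (fun y => (Gb y)⁻¹ i j) (O ∩ halfSpace n) := fun y hy =>
  contDiffWithinAt_matrix_inv (fun i j => h.contDiffOn_metric i j y hy)
    (((isUnit_iff_isUnit_det _).1 (h.posDef y hy).isUnit).ne_zero) i j

theorem extendsOn_inv (h : IsSolutionChart p k β O r Gb G) :
    MatrixExtendsOn O (p + 2) fun y => (Gb y)⁻¹ :=
  fun i j => extendsOn_of_contDiffOn (h.contDiffOn_inv i j)

end IsSolutionChart

/-- The regular part of the endomorphism `-G⁻¹ A_G`. -/
def schoutenPart (r : Coord n → ℝ) (Gb : Coord n → Matrix (Fin (n + 1)) (Fin (n + 1)) ℝ)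
    (y : Coord n) : Matrix (Fin (n + 1)) (Fin (n + 1)) ℝ :=
  (-1 : ℝ) • ((Gb y)⁻¹ * hessian Gb r y) - r y • ((Gb y)⁻¹ * schouten Gb y)

/-- Raising an index multiplies by r², which clears the negative powers in `schouten_eq`. The part
that does not vanish at the boundary is scalar. -/
theorem IsConformalAt.inv_mul_neg_schouten (hn : 2 ≤ n) (h : IsConformalAt r Gb G y) :
    (G y)⁻¹ * (-schouten G y) = (gradSq Gb r y / 2) • 1 + r y • schoutenPart r Gb y := by
  have h0 := h.pos.ne'
  rw [h.schouten_eq hn, h.inv_eq, schoutenPart]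
  simp only [mul_neg, mul_sub, mul_add, smul_mul_assoc, mul_smul_comm, smul_smul,
    nonsing_inv_mul _ h.metric.isUnit_det, smul_sub, neg_sub]
  ext i j
  simp only [Matrix.sub_apply, Matrix.add_apply, Matrix.smul_apply, smul_eq_mul]
  field_simp
  ring

namespace IsSolutionChart

theorem extendsOn_schoutenPart (h : IsSolutionChart p k β O r Gb G) :
    MatrixExtendsOn O p (schoutenPart r Gb) := by
  have hi := h.extendsOn_inv.of_le (q := (p : ℕ∞ω)) le_self_add
  have hH := matrixExtendsOn_hessian h.isOpen (h.extendsOn_metric.of_le (by gcongr; norm_num)) hi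
    (h.extendsOn_r.of_le (by gcongr; norm_num))
  exact (MatrixExtendsOn.smul (.const _) (hi.mul hH)).sub
    (MatrixExtendsOn.smul (h.extendsOn_r.of_le le_self_add)
      (hi.mul (matrixExtendsOn_schouten h.isOpen h.extendsOn_metric h.extendsOn_inv)))

/-- The extension of `|dr|²` up to the boundary. -/
theorem exists_gradSq_extension (h : IsSolutionChart p k β O r Gb G) :
    ∃ A, ContDiffOn ℝ (p + 2) A (O ∩ halfSpace n) ∧ EqOn (gradSq Gb r) A (O ∩ openHalfSpace n) ∧
      ∀ y ∈ O, y 0 = 0 → 0 < A y := by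
  have hd : ∀ i, ContDiffOn ℝ (p + 2) (fun y => fderivWithin ℝ r (O ∩ halfSpace n) y (basisVec i))
      (O ∩ halfSpace n) := fun i =>
    ((h.contDiffOn.fderivWithin (uniqueDiffOn_inter_halfSpace h.isOpen)
      (by rw [add_assoc]; gcongr; norm_num)).clm_apply contDiffOn_const)
  refine ⟨fun y => ∑ i, ∑ j, (Gb y)⁻¹ i j * fderivWithin ℝ r (O ∩ halfSpace n) y (basisVec i) *
    fderivWithin ℝ r (O ∩ halfSpace n) y (basisVec j), ?_, fun y hy => ?_, fun y hy hy0 => ?_⟩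
  · exact ContDiffOn.sum fun i _ => ContDiffOn.sum fun j _ =>
      ((h.contDiffOn_inv i j).mul (hd i)).mul (hd j)
  · simp only [gradSq, pderiv, fderivWithin_of_mem_nhds (inter_halfSpace_mem_nhds h.isOpen hy)]
  · have hp := (h.posDef y ⟨hy, hy0.ge⟩).inv
    set L := fderivWithin ℝ r (O ∩ halfSpace n) y with hL
    have hne : (fun i => L (basisVec i)) ≠ 0 := by
      intro h0
      refine h.fderivWithin_ne_zero y hy hy0 (ContinuousLinearMap.ext fun v => ?_)
      rw [← hL, linear_eq_sum]
      simp [congrFun h0]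
    have := hp.dotProduct_mulVec_pos hne
    refine this.trans_eq ?_
    simp only [dotProduct, mulVec, Pi.star_apply, star_trivial, Finset.mul_sum]
    refine Finset.sum_congr rfl fun i _ => Finset.sum_congr rfl fun j _ => ?_
    ring

/-- σ_k of the extended endomorphism is continuous up to the boundary and equals β inside. At r = 0
the endomorphism is the scalar A/2, and the resulting equation for A has only one positive solution.
-/
theorem gradSq_boundary (hn : 2 ≤ n) (hk1 : 1 ≤ k) (hk : k ≤ n + 1) (hβ : 0 < β)
    (h : IsSolutionChart p k β O r Gb G) {A : Coord n → ℝ}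
    (hA : ContDiffOn ℝ (p + 2) A (O ∩ halfSpace n))
    (hAeq : EqOn (gradSq Gb r) A (O ∩ openHalfSpace n)) (hy : y ∈ O) (hy0 : y 0 = 0)
    (hpos : 0 < A y) : A y = boundaryGradSq k n β := by
  obtain ⟨F, hF, hFeq⟩ := h.extendsOn_schoutenPart.exists_extension
  have hcont : ContinuousOn (fun z => sigma k ((A z / 2) • 1 + r z • F z)) (O ∩ halfSpace n) := by
    have : ContDiffOn ℝ p (fun z => sigma k ((A z / 2) • 1 + r z • F z)) (O ∩ halfSpace n) := by
      refine fun z hz => contDiffWithinAt_sigma k fun i j => ?_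
      simp only [Matrix.add_apply, Matrix.smul_apply, smul_eq_mul]
      exact ((((hA z hz).of_le le_self_add).div_const 2).mul contDiffWithinAt_const).add
        (((h.contDiffOn z hz).of_le le_self_add).mul (hF i j z hz))
    exact this.continuousOn
  have := eqOn_of_eqOn_interior h.isOpen hcont (continuousOn_const (c := β)) (fun z hz => by
    simp only []
    rw [← hAeq hz, ← hFeq hz, ← (h.isConformalAt hz).inv_mul_neg_schouten hn, h.sigma_eq z hz])
    (⟨hy, hy0.ge⟩ : y ∈ O ∩ halfSpace n)
  simp only [h.eq_zero y hy hy0, zero_smul, add_zero] at this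
  refine eq_boundaryGradSq hk1 hk hβ hpos.le ?_
  -- With r = 0 and N = 0 the expansion evaluates σ_k on a scalar matrix.
  have h1 := sigma_expansion (d := n + 1) hk1 hk (A y / 2) 0 0
  simp at h1
  rw [← h1, this]

/-- `r = y₀ q` with `q` positive up to the boundary. -/
theorem boundaryQuotient_pos (h : IsSolutionChart p k β O r Gb G) (hy : y ∈ O ∩ halfSpace n) :
    ContDiffOn ℝ (p + 1) (boundaryQuotient (O ∩ halfSpace n) r) (O ∩ halfSpace n) ∧
      0 < boundaryQuotient (O ∩ halfSpace n) r y := by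
  set q := boundaryQuotient (O ∩ halfSpace n) r with hq
  have hqc : ContDiffOn ℝ (p + 1) q (O ∩ halfSpace n) := by
    have := contDiffOn_boundaryQuotient (p := p + 1) h.isOpen (f := r) (h.contDiffOn.of_le (by
      push_cast; rw [add_assoc]; gcongr; norm_num)) h.eq_zero
    exact_mod_cast this
  have hpos : ∀ z ∈ O ∩ openHalfSpace n, 0 < q z := by
    intro z hz
    have hz0 : 0 < z 0 := hz.2
    rw [hq, boundaryQuotient, if_pos hz0]
    exact div_pos (h.pos z hz) hz0
  refine ⟨hqc, ?_⟩
  by_cases hy0 : 0 < y 0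
  · exact hpos y ⟨hy.1, hy0⟩
  have hy0 : y 0 = 0 := le_antisymm (not_lt.1 hy0) hy.2
  have hge : 0 ≤ q y := by
    have hc := (hqc.continuousOn y hy).mono (inter_openHalfSpace_subset)
    have hcl := mem_closure_inter h.isOpen hy
    exact closure_minimal (fun t ht => by
      obtain ⟨z, hz, rfl⟩ := ht
      exact (hpos z hz).le) isClosed_Ici (hc.mem_closure_image hcl)
  -- If q(y) = 0 at a boundary point, then dr = q dy₀ + y₀ dq vanishes there, contrary to the
  -- assumption on r.
  refine lt_of_le_of_ne hge fun h0 => ?_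
  refine h.fderivWithin_ne_zero y hy.1 hy0 ?_
  have hu := uniqueDiffOn_inter_halfSpace h.isOpen y hy
  have hqd := (hqc.differentiableOn (by simp) y hy).hasFDerivWithinAt
  have hp0 : HasFDerivWithinAt (fun z : Coord n => z 0)
      (EuclideanSpace.proj (0 : Fin (n + 1)) : Coord n →L[ℝ] ℝ) (O ∩ halfSpace n) y :=
    (EuclideanSpace.proj (0 : Fin (n + 1)) : Coord n →L[ℝ] ℝ).hasFDerivWithinAt
  have h1 := hp0.mul hqd
  have h2 := h1.congr (f₁ := r) (fun z hz => (mul_boundaryQuotient h.eq_zero hz).symm)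
    (mul_boundaryQuotient h.eq_zero hy).symm
  rw [h2.fderivWithin hu, hy0, ← h0]
  simp

/-- `|dr|² = a₀ + r f` with `f` regular up to the boundary. -/
theorem exists_gradSq_eq (hn : 2 ≤ n) (hk1 : 1 ≤ k) (hk : k ≤ n + 1) (hβ : 0 < β)
    (h : IsSolutionChart p k β O r Gb G) : ∃ f, ExtendsOn O (p + 1) f ∧
      ∀ y ∈ O ∩ openHalfSpace n, gradSq Gb r y = boundaryGradSq k n β + r y * f y := by
  obtain ⟨A, hA, hAeq, hApos⟩ := h.exists_gradSq_extension
  have h0 : ∀ y ∈ O, y 0 = 0 → A y - boundaryGradSq k n β = 0 := fun y hy hy0 =>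
    sub_eq_zero.2 (h.gradSq_boundary hn hk1 hk hβ hA hAeq hy hy0 (hApos y hy hy0))
  have h1 := contDiffOn_boundaryQuotient (p := p + 1) h.isOpen
    (f := fun y => A y - boundaryGradSq k n β) ((hA.sub contDiffOn_const).of_le (by
      push_cast; rw [add_assoc]; gcongr; norm_num)) h0
  -- Dividing by r = y₀q means dividing by y₀ and then by the positive function q. The first
  -- division costs one derivative, from p + 2 to p + 1.
  refine ⟨fun y => boundaryQuotient (O ∩ halfSpace n) (fun y => A y - boundaryGradSq k n β) y /
    boundaryQuotient (O ∩ halfSpace n) r y, extendsOn_of_contDiffOn fun y hy => ?_, fun y hy => ?_⟩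
  · refine ContDiffWithinAt.div ?_ ((h.boundaryQuotient_pos hy).1 y hy)
      (h.boundaryQuotient_pos hy).2.ne'
    exact_mod_cast h1 y hy
  · have hq := h.boundaryQuotient_pos (inter_openHalfSpace_subset hy)
    have e1 := mul_boundaryQuotient h.eq_zero (inter_openHalfSpace_subset hy)
    have e2 := mul_boundaryQuotient h0 (inter_openHalfSpace_subset hy)
    have hq2 := hq.2.ne'
    rw [hAeq hy]
    change A y = _ + r y * (_ / _)
    generalize boundaryQuotient (O ∩ halfSpace n) r y = q at *
    rw [← e1]
    field_simp
    linarith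

end IsSolutionChart

end Chart

/-! ### The expansion of the linearized operator in a chart. -/

section ChartExpansion

open Filter Topology Matrix

variable {n : ℕ} {O : Set (Coord n)} {p : ℕ∞} {k : ℕ} {β : ℝ} {r φ : Coord n → ℝ}
  {Gb G : Coord n → Matrix (Fin (n + 1)) (Fin (n + 1)) ℝ} {y : Coord n}

/-- The second order operator with leading coefficients `R` acting on a conformal Hessian. -/
theorem IsConformalAt.trace_mul_inv_mul_hessian (h : IsConformalAt r Gb G y)
    (hφ : ContDiffAt ℝ 2 φ y) {S : Matrix (Fin (n + 1)) (Fin (n + 1)) ℝ} {Z : Fin (n + 1) → ℝ}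
    {τ : ℝ} (hS : (S * (Gb y)⁻¹).IsSymm) (hZ : S *ᵥ ((Gb y)⁻¹ *ᵥ gradVec r y) = r y • Z)
    (hτ : S.trace = r y * τ) :
    (S * ((G y)⁻¹ * hessian G φ y)).trace =
      (r y) ^ 2 * (∑ i, ∑ j, (S * (Gb y)⁻¹) i j * pderiv i (pderiv j φ) y +
        ∑ l, (2 * Z l - τ * ((Gb y)⁻¹ *ᵥ gradVec r y) l -
          ∑ i, ∑ j, (S * (Gb y)⁻¹) i j * christoffel Gb l i j y) * pderiv l φ y) := by
  have h0 := h.pos.ne'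
  have hs := hS
  set P := S * (Gb y)⁻¹ with hP
  have e1 : P *ᵥ gradVec r y = r y • Z := by rw [hP, ← mulVec_mulVec, hZ]
  have e2 : (P * hessian Gb φ y).trace = ∑ i, ∑ j, P i j * pderiv i (pderiv j φ) y -
      ∑ l, (∑ i, ∑ j, P i j * christoffel Gb l i j y) * pderiv l φ y := by
    rw [← sum_mul_eq_trace hs]
    simp only [hessian, of_apply, mul_sub, Finset.sum_sub_distrib, Finset.mul_sum, Finset.sum_mul]
    congr 1
    rw [Finset.sum_comm_cycle]
    refine Finset.sum_congr rfl fun i _ => Finset.sum_congr rfl fun j _ =>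
      Finset.sum_congr rfl fun l _ => by ring
  have e3 : (P * vecMulVec (gradVec r y) (gradVec φ y)).trace = r y * (Z ⬝ᵥ gradVec φ y) := by
    rw [trace_mul_vecMulVec, e1, dotProduct_smul, dotProduct_comm, smul_eq_mul]
  have e4 : (P * vecMulVec (gradVec φ y) (gradVec r y)).trace = r y * (Z ⬝ᵥ gradVec φ y) := by
    rw [trace_mul_vecMulVec, dotProduct_mulVec, ← mulVec_transpose, hs.eq, e1, smul_dotProduct,
      smul_eq_mul]
  have e5 : (P * Gb y).trace = r y * τ := by
    rw [hP, mul_assoc, nonsing_inv_mul _ h.metric.isUnit_det, mul_one, hτ]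
  have e6 : S * ((G y)⁻¹ * hessian G φ y) = (r y) ^ 2 • (P * hessian G φ y) := by
    rw [h.inv_eq, hP, ← mul_assoc, mul_smul_comm, smul_mul_assoc]
  -- The inverse metric contributes r². The conformal Hessian has first order terms of size r⁻¹,
  -- contracted with S only through S∇r and tr S; by `hZ` and `hτ` both supply a factor r that
  -- cancels it.
  rw [e6, h.hessian_eq hφ]
  simp only [mul_sub, mul_add, mul_smul_comm, trace_smul, trace_sub, trace_add, smul_eq_mul, e2, e3,
    e4, e5]
  have e7 : ∑ l, (2 * Z l - τ * ((Gb y)⁻¹ *ᵥ gradVec r y) l -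
      ∑ i, ∑ j, P i j * christoffel Gb l i j y) * pderiv l φ y = 2 * (Z ⬝ᵥ gradVec φ y) -
        τ * ((Gb y)⁻¹ *ᵥ gradVec r y ⬝ᵥ gradVec φ y) -
        ∑ l, (∑ i, ∑ j, P i j * christoffel Gb l i j y) * pderiv l φ y := by
    simp only [sub_mul, Finset.sum_sub_distrib, dotProduct, Finset.mul_sum, gradVec]
    congr 2 <;> exact Finset.sum_congr rfl fun l _ => by ring
  rw [e7]
  field_simp
  ring

/-- The expansion of the linearized operator at the boundary, in coordinates. -/
theorem IsSolutionChart.exists_coefficients (hn : 2 ≤ n) (hk1 : 1 ≤ k) (hk : k ≤ n + 1)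
    (hβ : 0 < β) (h : IsSolutionChart p k β O r Gb G) :
    ∃ (a : Fin (n + 1) → Fin (n + 1) → Coord n → ℝ) (b : Fin (n + 1) → Coord n → ℝ),
      (∀ i j, ContDiffOn ℝ p (a i j) (O ∩ halfSpace n)) ∧
      (∀ i, ContDiffOn ℝ p (b i) (O ∩ halfSpace n)) ∧
      ∀ y ∈ O ∩ openHalfSpace n, ∀ φ : Coord n → ℝ, ContDiffAt ℝ 2 φ y →
        (newton (k - 1) ((G y)⁻¹ * (-schouten G y)) * ((G y)⁻¹ * hessian G φ y)).trace =
          cConst k n * (β / betaHyp k n) ^ (((k : ℝ) - 1) / k) *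
            ((G y)⁻¹ * hessian G φ y).trace +
          r y ^ 3 * (∑ i, ∑ j, a i j y * pderiv i (pderiv j φ) y + ∑ i, b i y * pderiv i φ y) := by
  obtain ⟨f, hf, hrf⟩ := h.exists_gradSq_eq hn hk1 hk hβ
  set c : ℝ := boundaryGradSq k n β / 2 with hc
  have hcpos : 0 < c := half_pos (boundaryGradSq_pos hk hβ)
  -- κ is both the scalar part of T_{k-1}(c + rN) and the coefficient of r tr N in σ_k(c + rN).
  set κ : ℝ := (n.choose (k - 1) : ℝ) * c ^ (k - 1) with hκ
  have hκpos : 0 < κ := mul_pos (by exact_mod_cast Nat.choose_pos (by omega)) (by positivity)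
  -- N is the quotient (B - c)/r: the summand f/2 comes from |dr|²/2 = c + rf/2.
  set N : Coord n → Matrix (Fin (n + 1)) (Fin (n + 1)) ℝ :=
    fun y => (f y * (1 / 2)) • 1 + schoutenPart r Gb y with hN
  have extr : ExtendsOn O p r := h.extendsOn_r.of_le le_self_add
  have exti : MatrixExtendsOn O p fun y => (Gb y)⁻¹ := h.extendsOn_inv.of_le le_self_add
  have extN : MatrixExtendsOn O p N :=
    (MatrixExtendsOn.smul ((hf.of_le le_self_add).mul (.const _)) (.const _)).add
      h.extendsOn_schoutenPart
  have extdr : ∀ i, ExtendsOn O p fun y => gradVec r y i := fun i =>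
    (h.extendsOn_r.of_le (by gcongr; norm_num)).pderiv h.isOpen i
  have extdf : ∀ i, ExtendsOn O p fun y => gradVec f y i := fun i => hf.pderiv h.isOpen i
  set X : Coord n → Fin (n + 1) → ℝ := fun y => (Gb y)⁻¹ *ᵥ gradVec r y with hX
  have extX : ∀ i, ExtendsOn O p fun y => X y i := exti.mulVec extdr
  -- w is the quotient of N∇r by r (see `hNX`), and ν below is that of tr N (see `htr`). The
  -- derivative of f in w is where the last derivative of r is spent.
  set w : Coord n → Fin (n + 1) → ℝ := fun y => (-(1 / 2 : ℝ)) • ((Gb y)⁻¹ *ᵥ gradVec f y) -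
    ((Gb y)⁻¹ * schouten Gb y) *ᵥ X y with hw
  have extw : ∀ i, ExtendsOn O p fun y => w y i := fun i =>
    ((ExtendsOn.const _).mul (exti.mulVec extdf i)).sub ((exti.mul
      (matrixExtendsOn_schouten h.isOpen h.extendsOn_metric h.extendsOn_inv)).mulVec extX i)
  set ν : Coord n → ℝ := fun y => -(κ⁻¹ * sigmaRemainder k c (r y) (N y)) with hν
  have extν : ExtendsOn O p ν :=
    ((ExtendsOn.const _).mul (MatrixExtendsOn.sigmaRemainder k c extr extN)).neg
  set Q : Coord n → Matrix (Fin (n + 1)) (Fin (n + 1)) ℝ :=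
    fun y => newtonRemainder (k - 1) c (r y) (N y) with hQ
  have extQ : MatrixExtendsOn O p Q := MatrixExtendsOn.newtonRemainder (k - 1) c extr extN
  -- The coefficient of tr N - N in T_{k-1}; it is zero when k = 1, where T_0 is the identity.
  set c' : ℝ := if 1 ≤ k - 1 then ((n - 1).choose (k - 1 - 1) : ℝ) * c ^ (k - 1 - 1) else 0 with hc'
  set S : Coord n → Matrix (Fin (n + 1)) (Fin (n + 1)) ℝ :=
    fun y => c' • ((N y).trace • 1 - N y) + r y • Q y with hS
  have extS : MatrixExtendsOn O p S :=
    (MatrixExtendsOn.smul (.const _) ((MatrixExtendsOn.smul extN.trace (.const _)).sub extN)).add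
      (MatrixExtendsOn.smul extr extQ)
  -- Z and τ are S∇r and tr S divided by r, computed from `htr` and `hNX`. In τ the factor n is the
  -- trace of the identity in dimension n + 1, minus 1.
  set Z : Coord n → Fin (n + 1) → ℝ := fun y => c' • (ν y • X y - w y) + Q y *ᵥ X y with hZ
  have extZ : ∀ i, ExtendsOn O p fun y => Z y i := fun i =>
    ((ExtendsOn.const _).mul ((extν.mul (extX i)).sub (extw i))).add (extQ.mulVec extX i)
  set τ : Coord n → ℝ := fun y => c' * (n * ν y) + (Q y).trace with hτ
  have extτ : ExtendsOn O p τ :=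
    ((ExtendsOn.const _).mul ((ExtendsOn.const _).mul extν)).add extQ.trace
  choose a ha hSa using extS.mul exti
  have extb : ∀ l, ExtendsOn O p fun y => 2 * Z y l - τ y * X y l -
      ∑ i, ∑ j, (S y * (Gb y)⁻¹) i j * christoffel Gb l i j y := fun l =>
    (((ExtendsOn.const _).mul (extZ l)).sub (extτ.mul (extX l))).sub
      (ExtendsOn.sum fun i _ => ExtendsOn.sum fun j _ => ((extS.mul exti) i j).mul
        (extendsOn_christoffel h.isOpen (h.extendsOn_metric.of_le (by gcongr; norm_num)) exti l i j))
  choose b hb hSb using extb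
  refine ⟨a, b, ha, hb, fun y hy φ hφ => ?_⟩
  have hcf := h.isConformalAt hy
  have h0 := hcf.pos.ne'
  have hB : (G y)⁻¹ * (-schouten G y) = c • 1 + r y • N y := by
    rw [hcf.inv_mul_neg_schouten hn, hrf y hy, hN, hc]
    simp only [smul_add, smul_smul, ← add_assoc, ← add_smul]
    congr 2
    ring
  -- First cancellation: the zeroth order term of σ_k(c + rN) is already β, so r(κ tr N + r(…)) = 0,
  -- and one may divide by r.
  have htr : (N y).trace = r y * ν y := by
    have h1 := h.sigma_eq y hy
    rw [hB, sigma_expansion (d := n + 1) hk1 hk, choose_mul_pow_boundaryGradSq hk1 hk hβ,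
      Nat.add_sub_cancel, ← hκ] at h1
    have h2 : r y * (κ * (N y).trace + r y * sigmaRemainder k c (r y) (N y)) = 0 := by linarith
    have h3 := (mul_eq_zero.1 h2).resolve_left h0
    have h4 := hκpos.ne'
    simp only [hν]
    field_simp
    linarith
  -- Second cancellation: Gb⁻¹∇²r(∇r) is half the gradient of a₀ + rf, that is ½(r∇f + f∇r). The
  -- term ½f∇r is removed by the scalar part f/2 of N.
  have hNX : N y *ᵥ X y = r y • w y := by
    have h1 : (fun z => gradSq Gb r z) =ᶠ[𝓝 y] fun z => boundaryGradSq k n β + r z * f z := by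
      filter_upwards [h.inter_mem_nhds hy] with z hz using hrf z hz
    have hrd := (hcf.contDiffAt.differentiableAt (by norm_num)).hasFDerivAt
    have hfd : HasFDerivAt f (fderiv ℝ f y) y := by
      obtain ⟨F, hF, hfF⟩ := hf
      have hFd := ((hF.differentiableOn (by simp)) y
        (inter_openHalfSpace_subset hy)).differentiableAt (inter_halfSpace_mem_nhds h.isOpen hy)
      refine (hFd.congr_of_eventuallyEq ?_).hasFDerivAt
      filter_upwards [h.inter_mem_nhds hy] with z hz using hfF hz
    have h2 : gradVec (gradSq Gb r) y = r y • gradVec f y + f y • gradVec r y := by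
      funext i
      have := h1.fderiv_eq (𝕜 := ℝ)
      rw [((hrd.fun_mul hfd).const_add _).fderiv] at this
      have h3 := congrArg (fun L => L (basisVec i)) this
      exact h3
    have h3 := hessian_mulVec_gradient hcf.metric hcf.contDiffAt
    rw [h2] at h3
    simp only [hN, schoutenPart, add_mulVec, sub_mulVec, smul_mulVec, one_mulVec]
    have h4 : ((Gb y)⁻¹ * hessian Gb r y) *ᵥ X y =
        (1 / 2 : ℝ) • (r y • ((Gb y)⁻¹ *ᵥ gradVec f y) + f y • X y) := by
      rw [← mulVec_mulVec, hX, h3, mulVec_smul, mulVec_add, mulVec_smul, mulVec_smul]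
    rw [h4, hw]
    funext i
    simp only [Pi.add_apply, Pi.sub_apply, Pi.smul_apply, smul_eq_mul]
    ring
  have hT : newton (k - 1) ((G y)⁻¹ * (-schouten G y)) = κ • 1 + r y • S y := by
    rw [hB, newton_expansion (d := n + 1) (by omega)]
    rfl
  have hSX : S y *ᵥ ((Gb y)⁻¹ *ᵥ gradVec r y) = r y • Z y := by
    change S y *ᵥ X y = _
    rw [hS, hZ]
    simp only [add_mulVec, sub_mulVec, smul_mulVec, one_mulVec, hNX, htr]
    funext i
    simp only [Pi.add_apply, Pi.sub_apply, Pi.smul_apply, smul_eq_mul]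
    ring
  have hStr : (S y).trace = r y * τ y := by
    rw [hS, hτ]
    simp only [trace_add, trace_smul, trace_sub, trace_one, smul_eq_mul, htr, Fintype.card_fin]
    push_cast
    ring
  -- S is recovered from T_{k-1}(B) = κ + rS, so its symmetry follows from `newton_mul_isSymm` by
  -- subtracting the scalar part and dividing by r.
  have hSs : (S y * (Gb y)⁻¹).IsSymm := by
    have hGs := isSymm_inv (isSymm_of_posDef hcf.isMetricAt.posDef_self)
    have hGbs := isSymm_inv (isSymm_of_posDef hcf.metric.posDef_self)
    have h1 := newton_mul_isSymm (k - 1) hGs hcf.isMetricAt.schouten_isSymm.neg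
    rw [hT, hcf.inv_eq, mul_smul_comm, add_mul, smul_mul_assoc, smul_mul_assoc, one_mul] at h1
    have h2 : S y * (Gb y)⁻¹ = (r y)⁻¹ • (((r y) ^ 2)⁻¹ •
        (r y ^ 2 • (κ • (Gb y)⁻¹ + r y • (S y * (Gb y)⁻¹))) - κ • (Gb y)⁻¹) := by
      rw [smul_smul, inv_mul_cancel₀ (pow_ne_zero 2 h0), one_smul, add_sub_cancel_left, smul_smul,
        inv_mul_cancel₀ h0, one_smul]
    rw [h2]
    exact ((h1.smul _).sub (hGbs.smul _)).smul _
  rw [hT, add_mul, smul_mul_assoc, smul_mul_assoc, one_mul, trace_add, trace_smul, trace_smul,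
    hcf.trace_mul_inv_mul_hessian hφ hSs hSX hStr, cConst_mul_rpow hk1 hk hβ, smul_eq_mul,
    smul_eq_mul]
  have e1 : ∑ i, ∑ j, a i j y * pderiv i (pderiv j φ) y =
      ∑ i, ∑ j, (S y * (Gb y)⁻¹) i j * pderiv i (pderiv j φ) y :=
    Finset.sum_congr rfl fun i _ => Finset.sum_congr rfl fun j _ => by rw [← hSa i j hy]
  have e2 : ∑ l, b l y * pderiv l φ y = ∑ l, (2 * Z y l - τ y * ((Gb y)⁻¹ *ᵥ gradVec r y) l -
      ∑ i, ∑ j, (S y * (Gb y)⁻¹) i j * christoffel Gb l i j y) * pderiv l φ y :=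
    Finset.sum_congr rfl fun l _ => by rw [← hSb l hy]
  rw [e1, e2]
  ring

end ChartExpansion

/-! ### Boundary behaviour of the endomorphism and of the barrier -log r. -/

section ChartContinuity

open Filter Topology Matrix

variable {n : ℕ} {O : Set (Coord n)} {p : ℕ∞} {k : ℕ} {β : ℝ} {r : Coord n → ℝ}
  {Gb G : Coord n → Matrix (Fin (n + 1)) (Fin (n + 1)) ℝ} {y : Coord n}

/-- The endomorphism `-G⁻¹ A_G` extends continuously by a multiple of the identity. -/
theorem IsSolutionChart.exists_endomorphism_extension (hn : 2 ≤ n) (hk1 : 1 ≤ k) (hk : k ≤ n + 1)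
    (hβ : 0 < β) (h : IsSolutionChart p k β O r Gb G) :
    ∃ F : Coord n → Matrix (Fin (n + 1)) (Fin (n + 1)) ℝ,
      (∀ i j, ContDiffOn ℝ p (fun y => F y i j) (O ∩ halfSpace n)) ∧
      (∀ y ∈ O ∩ openHalfSpace n, F y = (G y)⁻¹ * (-schouten G y)) ∧
      ∀ y ∈ O, y 0 = 0 → F y = (boundaryGradSq k n β / 2) • 1 := by
  obtain ⟨f, hf, hrf⟩ := h.exists_gradSq_eq hn hk1 hk hβ
  have extN : MatrixExtendsOn O p fun y => (f y * (1 / 2)) • 1 + schoutenPart r Gb y :=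
    (MatrixExtendsOn.smul ((hf.of_le le_self_add).mul (.const _)) (.const _)).add
      h.extendsOn_schoutenPart
  obtain ⟨N, hN, hNeq⟩ := extN.exists_extension
  refine ⟨fun y => (boundaryGradSq k n β / 2) • 1 + r y • N y, fun i j => ?_, fun y hy => ?_,
    fun y hy hy0 => ?_⟩
  · simp only [Matrix.add_apply, Matrix.smul_apply, smul_eq_mul]
    exact contDiffOn_const.add ((h.contDiffOn.of_le le_self_add).mul (hN i j))
  · rw [(h.isConformalAt hy).inv_mul_neg_schouten hn, hrf y hy]
    beta_reduce
    rw [← hNeq hy]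
    simp only [smul_add, smul_smul, ← add_assoc, ← add_smul]
    congr 2
    ring
  · simp [h.eq_zero y hy hy0]

theorem IsConformalAt.hessian_neg_log (h : IsConformalAt r Gb G y) :
    hessian Gb (fun z => -Real.log (r z)) y = logHessian r Gb y := by
  have hu : ContDiffAt ℝ 2 (fun z => -Real.log (r z)) y :=
    (h.contDiffAt.log h.pos.ne').neg
  have e : fderiv ℝ (fun z => -Real.log (r z)) =ᶠ[𝓝 y] conformalOneForm r := by
    filter_upwards [h.eventually] with z hz
    have := (((hz.contDiffAt.differentiableAt (by norm_num)).hasFDerivAt.log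
      hz.pos.ne').fun_neg).fderiv
    rw [this]; rfl
  ext i j
  rw [ConformallyCompact.hessian_eq hu, h.logHessian_apply, e.fderiv_eq, e.self_of_nhds]

/-- The Hessian of -log r for G has size r⁻², exactly compensated by the inverse metric. Hence the
barrier is unbounded while its Hessian endomorphism is regular up to the boundary. -/
theorem IsConformalAt.inv_mul_hessian_neg_log (h : IsConformalAt r Gb G y) :
    (G y)⁻¹ * hessian G (fun z => -Real.log (r z)) y =
      gradSq Gb r y • 1 - r y • ((Gb y)⁻¹ * hessian Gb r y) -
        (Gb y)⁻¹ * vecMulVec (gradVec r y) (gradVec r y) := by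
  have hu : ContDiffAt ℝ 2 (fun z => -Real.log (r z)) y := (h.contDiffAt.log h.pos.ne').neg
  have h0 := h.pos.ne'
  have e : gradVec (fun z => -Real.log (r z)) y = (-(r y)⁻¹) • gradVec r y := by
    funext i
    have := (((h.contDiffAt.differentiableAt (by norm_num)).hasFDerivAt.log
      h.pos.ne').fun_neg).fderiv
    rw [gradVec, pderiv, this]
    simp [gradVec, pderiv]
  rw [h.hessian_eq hu, h.hessian_neg_log, h.inv_eq, logHessian, e, dotProduct_smul,
    dotProduct_comm, ← gradSq_eq]
  simp only [vecMulVec_smul, smul_vecMulVec, smul_mul_assoc, mul_sub, mul_add, mul_smul_comm,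
    nonsing_inv_mul _ h.metric.isUnit_det]
  ext i j
  simp only [Matrix.sub_apply, Matrix.add_apply, Matrix.smul_apply, smul_eq_mul]
  field_simp
  ring

theorem IsSolutionChart.extendsOn_hessian_neg_log (h : IsSolutionChart p k β O r Gb G) :
    MatrixExtendsOn O p fun y => (G y)⁻¹ * hessian G (fun z => -Real.log (r z)) y := by
  have hi := h.extendsOn_inv.of_le (q := (p : ℕ∞ω)) le_self_add
  have hH := matrixExtendsOn_hessian h.isOpen (h.extendsOn_metric.of_le (by gcongr; norm_num)) hi
    (h.extendsOn_r.of_le (by gcongr; norm_num))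
  have hd : ∀ i, ExtendsOn O p (pderiv i r) := fun i =>
    (h.extendsOn_r.of_le (by gcongr; norm_num)).pderiv h.isOpen i
  have hg : ExtendsOn O p (gradSq Gb r) := ExtendsOn.sum fun i _ => ExtendsOn.sum fun j _ =>
    ((hi i j).mul (hd i)).mul (hd j)
  have hv : MatrixExtendsOn O p fun y => vecMulVec (gradVec r y) (gradVec r y) :=
    fun i j => (hd i).mul (hd j)
  exact (((MatrixExtendsOn.smul hg (.const _)).sub (MatrixExtendsOn.smul
    (h.extendsOn_r.of_le le_self_add) (hi.mul hH))).sub (hi.mul hv)).congr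
      fun y hy => (h.isConformalAt hy).inv_mul_hessian_neg_log

/-- The linearized operator applied to `-log r` is regular up to the boundary. -/
theorem IsSolutionChart.extendsOn_trace_neg_log (hn : 2 ≤ n) (hk1 : 1 ≤ k) (hk : k ≤ n + 1)
    (hβ : 0 < β) (h : IsSolutionChart p k β O r Gb G) :
    ExtendsOn O p fun y => (newton (k - 1) ((G y)⁻¹ * (-schouten G y)) *
      ((G y)⁻¹ * hessian G (fun z => -Real.log (r z)) y)).trace := by
  obtain ⟨F, hF, hFeq, -⟩ := h.exists_endomorphism_extension hn hk1 hk hβ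
  have hF' : MatrixExtendsOn O p F := fun i j => extendsOn_of_contDiffOn (hF i j)
  have hB : MatrixExtendsOn O p fun y => (G y)⁻¹ * (-schouten G y) :=
    hF'.congr fun y hy => (hFeq y hy).symm
  exact ((hB.newton (k - 1)).mul h.extendsOn_hessian_neg_log).trace

end ChartContinuity

/-! ### The linearization of the σ_k-operator at u = 0. -/

section Linearization

open Filter Topology Matrix

variable {n : ℕ} {G : Coord n → Matrix (Fin (n + 1)) (Fin (n + 1)) ℝ} {y : Coord n}
  {φ : Coord n → ℝ}

theorem pderiv_const_mul (ε : ℝ) (φ : Coord n → ℝ) (i : Fin (n + 1)) :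
    pderiv i (fun z => ε * φ z) = fun z => ε * pderiv i φ z := by
  funext z
  have : (fun z => ε * φ z) = ε • φ := rfl
  rw [pderiv, this, fderiv_const_smul_field]
  rfl

/-- The gradient terms are quadratic in u and enter only with ε², so the Hessian alone contributes
to the derivative at 0. -/
theorem negSchoutenConf_const_mul (ε : ℝ) :
    negSchoutenConf G (fun z => ε * φ z) y = -schouten G y + ε • hessian G φ y +
      ε ^ 2 • (((1 / 2) * gradSq G φ y) • G y - vecMulVec (gradVec φ y) (gradVec φ y)) := by
  ext i j
  have h1 : hessian G (fun z => ε * φ z) y i j = ε * hessian G φ y i j := by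
    simp only [hessian, of_apply, pderiv_const_mul, mul_sub, Finset.mul_sum]
    congr 1
    exact Finset.sum_congr rfl fun l _ => by ring
  have h2 : gradSq G (fun z => ε * φ z) y = ε ^ 2 * gradSq G φ y := by
    simp only [gradSq, pderiv_const_mul, Finset.mul_sum]
    exact Finset.sum_congr rfl fun i _ => Finset.sum_congr rfl fun j _ => by ring
  simp only [negSchoutenConf, Matrix.sub_apply, Matrix.add_apply, Matrix.smul_apply, smul_eq_mul,
    h1, h2, of_apply, pderiv_const_mul, vecMulVec, gradVec, Matrix.neg_apply]
  ring

/-- The derivative of the `σ_k`-operator in the direction of `φ`. -/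
theorem hasDerivAt_sigma_negSchoutenConf {k : ℕ} (hk1 : 1 ≤ k) :
    HasDerivAt (fun ε : ℝ => sigma k ((G y)⁻¹ * negSchoutenConf G (fun z => ε * φ z) y))
      (newton (k - 1) ((G y)⁻¹ * (-schouten G y)) * ((G y)⁻¹ * hessian G φ y)).trace 0 := by
  obtain ⟨j, rfl⟩ := Nat.exists_eq_add_of_le' hk1
  set D := ((1 / 2) * gradSq G φ y) • G y - vecMulVec (gradVec φ y) (gradVec φ y) with hD
  have e : ∀ ε : ℝ, (G y)⁻¹ * negSchoutenConf G (fun z => ε * φ z) y =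
      (G y)⁻¹ * (-schouten G y) + ε • ((G y)⁻¹ * hessian G φ y) + ε ^ 2 • ((G y)⁻¹ * D) := by
    intro ε
    rw [negSchoutenConf_const_mul, mul_add, mul_add, mul_smul_comm, mul_smul_comm]
  simp only [e]
  have h := hasDerivAt_sigma j (x := (0 : ℝ))
    (A := fun ε : ℝ => (G y)⁻¹ * (-schouten G y) + ε • ((G y)⁻¹ * hessian G φ y) +
      ε ^ 2 • ((G y)⁻¹ * D)) (A' := (G y)⁻¹ * hessian G φ y) (fun a b => by
    simp only [Matrix.add_apply, Matrix.smul_apply, smul_eq_mul]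
    have h1 := (((hasDerivAt_id (0 : ℝ)).mul_const (((G y)⁻¹ * hessian G φ y) a b)).const_add
      (((G y)⁻¹ * (-schouten G y)) a b)).add
        (((hasDerivAt_id (0 : ℝ)).pow 2).mul_const (((G y)⁻¹ * D) a b))
    exact h1.congr_deriv (by simp))
  simpa using h

end Linearization

end ConformallyCompact

set_option linter.unusedSectionVars false

namespace ConformallyCompact

/-! ### Charts of a manifold with boundary. -/

section Charts

open Filter Topology

variable {n : ℕ} {M : Type*} [TopologicalSpace M] [ChartedSpace (EuclideanHalfSpace (n + 1)) M]
  {e e' : OpenPartialHomeomorph M (EuclideanHalfSpace (n + 1))} {x : M} {y : Coord n}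

/-- An open set whose trace on the half space is the image of the chart. -/
def chartDomain (e : OpenPartialHomeomorph M (EuclideanHalfSpace (n + 1))) : Set (Coord n) :=
  (𝓡∂ (n + 1)).symm ⁻¹' e.target

theorem isOpen_chartDomain : IsOpen (chartDomain e) :=
  e.open_target.preimage (𝓡∂ (n + 1)).continuous_symm

theorem range_model : range (𝓡∂ (n + 1)) = halfSpace n := range_modelWithCornersEuclideanHalfSpace _

theorem interior_halfSpace_eq : interior (halfSpace n) = openHalfSpace n := by
  rw [← range_model]
  exact interior_range_modelWithCornersEuclideanHalfSpace _

theorem extend_target_eq : (e.extend (𝓡∂ (n + 1))).target = chartDomain e ∩ halfSpace n := by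
  rw [e.extend_target, range_model]
  rfl

theorem extend_mem (hx : x ∈ e.source) :
    e.extend (𝓡∂ (n + 1)) x ∈ chartDomain e ∩ halfSpace n := by
  rw [← extend_target_eq]
  exact (e.extend (𝓡∂ (n + 1))).map_source (e.extend_source (I := 𝓡∂ (n + 1)) ▸ hx)

theorem extend_symm_mem (hy : y ∈ chartDomain e ∩ halfSpace n) :
    (e.extend (𝓡∂ (n + 1))).symm y ∈ e.source := by
  rw [← extend_target_eq] at hy
  have := (e.extend (𝓡∂ (n + 1))).map_target hy
  rwa [e.extend_source] at this

theorem extend_extend_symm (hy : y ∈ chartDomain e ∩ halfSpace n) :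
    e.extend (𝓡∂ (n + 1)) ((e.extend (𝓡∂ (n + 1))).symm y) = y :=
  (e.extend (𝓡∂ (n + 1))).right_inv (extend_target_eq (e := e) ▸ hy)

/-- The coordinate change from `e` to `e'`. -/
def coordChange (e e' : OpenPartialHomeomorph M (EuclideanHalfSpace (n + 1))) (y : Coord n) :
    Coord n := e'.extend (𝓡∂ (n + 1)) ((e.extend (𝓡∂ (n + 1))).symm y)

/-- The open set on whose trace on the half space `coordChange e e'` is defined. -/
def overlapDomain (e e' : OpenPartialHomeomorph M (EuclideanHalfSpace (n + 1))) : Set (Coord n) :=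
  (𝓡∂ (n + 1)).symm ⁻¹' (e.symm.trans e').source

theorem isOpen_overlapDomain : IsOpen (overlapDomain e e') :=
  (e.symm.trans e').open_source.preimage (𝓡∂ (n + 1)).continuous_symm

theorem overlapDomain_subset : overlapDomain e e' ⊆ chartDomain e := by
  intro y hy
  have : (𝓡∂ (n + 1)).symm y ∈ e.symm.source ∩ e.symm ⁻¹' e'.source := by
    rw [← e.symm.trans_source]; exact hy
  exact this.1

theorem mem_overlapDomain (hy : y ∈ chartDomain e) :
    y ∈ overlapDomain e e' ↔ (e.extend (𝓡∂ (n + 1))).symm y ∈ e'.source := by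
  change (𝓡∂ (n + 1)).symm y ∈ (e.symm.trans e').source ↔ _
  rw [e.symm.trans_source]
  exact ⟨fun h => h.2, fun h => ⟨hy, h⟩⟩

theorem extend_mem_overlapDomain (hx : x ∈ e.source) (hx' : x ∈ e'.source) :
    e.extend (𝓡∂ (n + 1)) x ∈ overlapDomain e e' := by
  rw [mem_overlapDomain (extend_mem hx).1, e.extend_left_inv hx]
  exact hx'

theorem extendCoordChange_source_eq :
    ((𝓡∂ (n + 1)).extendCoordChange e e').source = overlapDomain e e' ∩ halfSpace n := by
  ext y
  rw [← range_model, ModelWithCorners.extendCoordChange_source, ModelWithCorners.image_eq]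
  rfl

variable [IsManifold (𝓡∂ (n + 1)) ∞ M]

theorem contDiffOn_coordChange (he : e ∈ IsManifold.maximalAtlas (𝓡∂ (n + 1)) ∞ M)
    (he' : e' ∈ IsManifold.maximalAtlas (𝓡∂ (n + 1)) ∞ M) :
    ContDiffOn ℝ ∞ (coordChange e e') (overlapDomain e e' ∩ halfSpace n) := by
  rw [← extendCoordChange_source_eq]
  exact ModelWithCorners.contDiffOn_extendCoordChange he he'

theorem isInvertible_fderivWithin_coordChange
    (he : e ∈ IsManifold.maximalAtlas (𝓡∂ (n + 1)) ∞ M)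
    (he' : e' ∈ IsManifold.maximalAtlas (𝓡∂ (n + 1)) ∞ M)
    (hy : y ∈ overlapDomain e e' ∩ halfSpace n) :
    (fderivWithin ℝ (coordChange e e') (overlapDomain e e' ∩ halfSpace n) y).IsInvertible := by
  rw [← extendCoordChange_source_eq] at hy ⊢
  exact ModelWithCorners.isInvertible_fderivWithin_extendCoordChange (by simp) he he' hy

/-- The coordinate change maps into the half space and has surjective derivative at an interior
point. A map into a convex set cannot send such a point to its boundary, where the image would lie
on one side of a hyperplane. -/
theorem pos_of_pos (he : e ∈ IsManifold.maximalAtlas (𝓡∂ (n + 1)) ∞ M)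
    (he' : e' ∈ IsManifold.maximalAtlas (𝓡∂ (n + 1)) ∞ M) (hx : x ∈ e.source) (hx' : x ∈ e'.source)
    (h : 0 < (e.extend (𝓡∂ (n + 1)) x) 0) : 0 < (e'.extend (𝓡∂ (n + 1)) x) 0 := by
  set y := e.extend (𝓡∂ (n + 1)) x with hy
  have hyo : y ∈ overlapDomain e e' ∩ openHalfSpace n := ⟨extend_mem_overlapDomain hx hx', h⟩
  have hnhds := inter_halfSpace_mem_nhds isOpen_overlapDomain hyo
  have hys := inter_openHalfSpace_subset hyo
  have hinv := isInvertible_fderivWithin_coordChange he he' hys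
  rw [fderivWithin_of_mem_nhds hnhds] at hinv
  have hd := ((contDiffOn_coordChange he he').differentiableOn (by simp) y hys).differentiableAt
    hnhds
  have hcl : IsClosed (halfSpace n) := range_model (n := n) ▸ (𝓡∂ (n + 1)).isClosed_range
  have hmaps : MapsTo (coordChange e e') (overlapDomain e e' ∩ halfSpace n) (halfSpace n) := by
    intro z hz
    exact (extend_mem (e := e') ((mem_overlapDomain (overlapDomain_subset hz.1)).1 hz.1)).2
  have := hd.mem_interior_convex_of_surjective_fderiv hnhds convex_halfSpace hcl
    nonempty_interior_halfSpace hmaps hinv.surjective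
  rw [interior_halfSpace_eq, coordChange, hy, e.extend_left_inv hx] at this
  exact this

theorem mem_interior_iff (he : e ∈ IsManifold.maximalAtlas (𝓡∂ (n + 1)) ∞ M) (hx : x ∈ e.source) :
    x ∈ (𝓡∂ (n + 1)).interior M ↔ 0 < (e.extend (𝓡∂ (n + 1)) x) 0 := by
  have h1 : x ∈ (𝓡∂ (n + 1)).interior M ↔ 0 < (extChartAt (𝓡∂ (n + 1)) x x) 0 := by
    change extChartAt (𝓡∂ (n + 1)) x x ∈ interior (range (𝓡∂ (n + 1))) ↔ _
    rw [range_model, interior_halfSpace_eq]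
    rfl
  rw [h1]
  have hc := IsManifold.chart_mem_maximalAtlas (I := 𝓡∂ (n + 1)) (n := ∞) x
  have hm := mem_chart_source (EuclideanHalfSpace (n + 1)) x
  exact ⟨pos_of_pos hc he hm hx, pos_of_pos he hc hx hm⟩

theorem mem_boundary_iff (he : e ∈ IsManifold.maximalAtlas (𝓡∂ (n + 1)) ∞ M) (hx : x ∈ e.source) :
    x ∈ (𝓡∂ (n + 1)).boundary M ↔ (e.extend (𝓡∂ (n + 1)) x) 0 = 0 := by
  rw [← ModelWithCorners.compl_interior, mem_compl_iff, mem_interior_iff he hx, not_lt]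
  exact ⟨fun h => le_antisymm h (extend_mem hx).2, fun h => h.le⟩

theorem extend_symm_mem_interior (he : e ∈ IsManifold.maximalAtlas (𝓡∂ (n + 1)) ∞ M)
    (hy : y ∈ chartDomain e ∩ openHalfSpace n) :
    (e.extend (𝓡∂ (n + 1))).symm y ∈ (𝓡∂ (n + 1)).interior M := by
  have hy' := inter_openHalfSpace_subset hy
  rw [mem_interior_iff he (extend_symm_mem hy'), extend_extend_symm hy']
  exact hy.2

theorem extend_mem_interior (he : e ∈ IsManifold.maximalAtlas (𝓡∂ (n + 1)) ∞ M)
    (hx : x ∈ e.source) (hxi : x ∈ (𝓡∂ (n + 1)).interior M) :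
    e.extend (𝓡∂ (n + 1)) x ∈ chartDomain e ∩ openHalfSpace n :=
  ⟨(extend_mem hx).1, (mem_interior_iff he hx).1 hxi⟩

theorem contMDiffOn_chart_symm (he : e ∈ IsManifold.maximalAtlas (𝓡∂ (n + 1)) ∞ M) :
    ContMDiffOn 𝓘(ℝ, Coord n) (𝓡∂ (n + 1)) ∞ (e.extend (𝓡∂ (n + 1))).symm
      (chartDomain e ∩ halfSpace n) := by
  rw [← extend_target_eq, e.extend_target']
  exact contMDiffOn_extend_symm he

end Charts

/-! ### The matrix of a metric in an arbitrary chart. -/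

section Gram

open Filter Topology Matrix

variable {n : ℕ} {M : Type*} [TopologicalSpace M] [ChartedSpace (EuclideanHalfSpace (n + 1)) M]
  {e e' : OpenPartialHomeomorph M (EuclideanHalfSpace (n + 1))} {x : M} {y : Coord n}

/-- The differential of the inverse of the chart `e`. -/
def chartSymmDeriv (e : OpenPartialHomeomorph M (EuclideanHalfSpace (n + 1))) (y : Coord n) :
    Coord n →L[ℝ] TangentSpace (𝓡∂ (n + 1)) ((e.extend (𝓡∂ (n + 1))).symm y) :=
  mfderivWithin 𝓘(ℝ, Coord n) (𝓡∂ (n + 1)) (e.extend (𝓡∂ (n + 1))).symm (range (𝓡∂ (n + 1))) y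

/-- The matrix of a field of bilinear forms in the coordinates of an arbitrary chart. -/
def gramIn (e : OpenPartialHomeomorph M (EuclideanHalfSpace (n + 1)))
    (g : (x : M) → TangentSpace (𝓡∂ (n + 1)) x →L[ℝ] TangentSpace (𝓡∂ (n + 1)) x →L[ℝ] ℝ)
    (y : Coord n) : Matrix (Fin (n + 1)) (Fin (n + 1)) ℝ :=
  of fun i j => g ((e.extend (𝓡∂ (n + 1))).symm y) (chartSymmDeriv e y (basisVec i))
    (chartSymmDeriv e y (basisVec j))

variable [IsManifold (𝓡∂ (n + 1)) ∞ M]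

theorem hasMFDerivWithinAt_extend_symm (he : e ∈ IsManifold.maximalAtlas (𝓡∂ (n + 1)) ∞ M)
    (hy : y ∈ chartDomain e ∩ halfSpace n) :
    HasMFDerivWithinAt 𝓘(ℝ, Coord n) (𝓡∂ (n + 1)) (e.extend (𝓡∂ (n + 1))).symm
      (chartDomain e ∩ halfSpace n) y (chartSymmDeriv e y) := by
  have h := ((contMDiffOn_chart_symm he y hy).mdifferentiableWithinAt
    (by simp)).hasMFDerivWithinAt
  have h' : chartSymmDeriv e y = mfderivWithin 𝓘(ℝ, Coord n) (𝓡∂ (n + 1))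
      (e.extend (𝓡∂ (n + 1))).symm (chartDomain e ∩ halfSpace n) y := by
    rw [inter_comm, mfderivWithin_inter (isOpen_chartDomain.mem_nhds hy.1), chartSymmDeriv,
      range_model]
  rwa [h']

theorem uniqueMDiffWithinAt_inter {O : Set (Coord n)} (hO : IsOpen O) (hy : y ∈ O ∩ halfSpace n) :
    UniqueMDiffWithinAt 𝓘(ℝ, Coord n) (O ∩ halfSpace n) y :=
  (uniqueDiffOn_inter_halfSpace hO).uniqueMDiffOn y hy

theorem injective_chartSymmDeriv (he : e ∈ IsManifold.maximalAtlas (𝓡∂ (n + 1)) ∞ M)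
    (hy : y ∈ chartDomain e ∩ halfSpace n) : Function.Injective (chartSymmDeriv e y) := by
  have h1 := (e.contMDiffAt_extend he (extend_symm_mem hy)).mdifferentiableAt
    (by simp) |>.hasMFDerivAt
  have h2 := h1.comp_hasMFDerivWithinAt y (hasMFDerivWithinAt_extend_symm he hy)
  have h3 := (hasMFDerivWithinAt_id (I := 𝓘(ℝ, Coord n)) (chartDomain e ∩ halfSpace n)
    y).congr_mono (f₁ := e.extend (𝓡∂ (n + 1)) ∘ (e.extend (𝓡∂ (n + 1))).symm)
    (fun z hz => extend_extend_symm hz) (extend_extend_symm hy) subset_rfl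
  have h4 := (uniqueMDiffWithinAt_inter isOpen_chartDomain hy).eq h2 h3
  intro v w hvw
  have hv := congrArg (fun L => L v) h4
  have hw := congrArg (fun L => L w) h4
  change mfderiv (𝓡∂ (n + 1)) 𝓘(ℝ, Coord n) (e.extend (𝓡∂ (n + 1))) _ (chartSymmDeriv e y v) = v at hv
  change mfderiv (𝓡∂ (n + 1)) 𝓘(ℝ, Coord n) (e.extend (𝓡∂ (n + 1))) _ (chartSymmDeriv e y w) = w at hw
  rw [← hv, ← hw, hvw]

theorem hasMFDerivWithinAt_coordChange (he : e ∈ IsManifold.maximalAtlas (𝓡∂ (n + 1)) ∞ M)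
    (he' : e' ∈ IsManifold.maximalAtlas (𝓡∂ (n + 1)) ∞ M)
    (hy : y ∈ overlapDomain e e' ∩ openHalfSpace n) :
    HasMFDerivWithinAt 𝓘(ℝ, Coord n) 𝓘(ℝ, Coord n) (coordChange e e')
      (overlapDomain e e' ∩ halfSpace n) y (fderiv ℝ (coordChange e e') y) := by
  have hn := inter_halfSpace_mem_nhds isOpen_overlapDomain hy
  exact (((contDiffOn_coordChange he he').differentiableOn (by simp) y
    (inter_openHalfSpace_subset hy)).differentiableAt
      hn).hasFDerivAt.hasMFDerivAt.hasMFDerivWithinAt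

theorem coordChange_mem (hy : y ∈ overlapDomain e e' ∩ halfSpace n) :
    coordChange e e' y ∈ chartDomain e' ∩ halfSpace n :=
  extend_mem ((mem_overlapDomain (overlapDomain_subset hy.1)).1 hy.1)

theorem extend_symm_coordChange (hy : y ∈ overlapDomain e e' ∩ halfSpace n) :
    (e'.extend (𝓡∂ (n + 1))).symm (coordChange e e' y) = (e.extend (𝓡∂ (n + 1))).symm y :=
  e'.extend_left_inv ((mem_overlapDomain (overlapDomain_subset hy.1)).1 hy.1)

theorem chartSymmDeriv_comp (he : e ∈ IsManifold.maximalAtlas (𝓡∂ (n + 1)) ∞ M)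
    (he' : e' ∈ IsManifold.maximalAtlas (𝓡∂ (n + 1)) ∞ M)
    (hy : y ∈ overlapDomain e e' ∩ openHalfSpace n) (v : Coord n) :
    (chartSymmDeriv e y v : Coord n) = (chartSymmDeriv e' (coordChange e e' y)
      (fderiv ℝ (coordChange e e') y v) : Coord n) := by
  have hy' := inter_openHalfSpace_subset hy
  have h1 := (hasMFDerivWithinAt_extend_symm he' (coordChange_mem hy')).comp y
    (hasMFDerivWithinAt_coordChange he he' hy) (fun z hz => coordChange_mem hz)
  have h2 := h1.congr_mono (f₁ := (e.extend (𝓡∂ (n + 1))).symm)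
    (fun z hz => (extend_symm_coordChange hz).symm) (extend_symm_coordChange hy').symm subset_rfl
  have h3 := (hasMFDerivWithinAt_extend_symm he ⟨overlapDomain_subset hy'.1, hy'.2⟩).mono
    (inter_subset_inter_left _ (overlapDomain_subset (e := e) (e' := e')))
  have h4 := (uniqueMDiffWithinAt_inter isOpen_overlapDomain hy').eq h3 h2
  exact congrArg (fun L : Coord n →L[ℝ] Coord n => L v) h4

/-- A field of bilinear forms in a chart, as a bilinear form. -/
def formIn (e : OpenPartialHomeomorph M (EuclideanHalfSpace (n + 1)))
    (g : (x : M) → TangentSpace (𝓡∂ (n + 1)) x →L[ℝ] TangentSpace (𝓡∂ (n + 1)) x →L[ℝ] ℝ)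
    (y : Coord n) : Coord n →L[ℝ] Coord n →L[ℝ] ℝ :=
  ContinuousLinearMap.bilinearComp (E' := Coord n) (F' := Coord n) (E := Coord n) (F := Coord n)
    (G := ℝ) (g ((e.extend (𝓡∂ (n + 1))).symm y)) (chartSymmDeriv e y) (chartSymmDeriv e y)

theorem gramIn_comp
    (g : (x : M) → TangentSpace (𝓡∂ (n + 1)) x →L[ℝ] TangentSpace (𝓡∂ (n + 1)) x →L[ℝ] ℝ)
    (he : e ∈ IsManifold.maximalAtlas (𝓡∂ (n + 1)) ∞ M)
    (he' : e' ∈ IsManifold.maximalAtlas (𝓡∂ (n + 1)) ∞ M)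
    (hy : y ∈ overlapDomain e e' ∩ openHalfSpace n) :
    gramIn e g y = (jacobian (coordChange e e') y)ᵀ * gramIn e' g (coordChange e e' y) *
      jacobian (coordChange e e') y := by
  ext i j
  rw [transpose_jacobian_mul_mul_apply]
  have h1 : gramIn e g y i j = formIn e' g (coordChange e e' y)
      (fderiv ℝ (coordChange e e') y (basisVec i)) (fderiv ℝ (coordChange e e') y (basisVec j)) := by
    -- The two base points are equal only propositionally; reading all tangent spaces as the model
    -- space allows one to be rewritten to the other.
    let g' : M → Coord n →L[ℝ] Coord n →L[ℝ] ℝ := g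
    change g' ((e.extend (𝓡∂ (n + 1))).symm y) (chartSymmDeriv e y (basisVec i) : Coord n)
      (chartSymmDeriv e y (basisVec j) : Coord n) =
      g' ((e'.extend (𝓡∂ (n + 1))).symm (coordChange e e' y))
        (chartSymmDeriv e' (coordChange e e' y) (fderiv ℝ (coordChange e e') y (basisVec i)))
        (chartSymmDeriv e' (coordChange e e' y) (fderiv ℝ (coordChange e e') y (basisVec j)))
    rw [chartSymmDeriv_comp he he' hy, chartSymmDeriv_comp he he' hy,
      extend_symm_coordChange (inter_openHalfSpace_subset hy)]
  rw [h1, clm_bilinear_basisVec]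
  rfl

theorem posDef_gramIn
    {g : (x : M) → TangentSpace (𝓡∂ (n + 1)) x →L[ℝ] TangentSpace (𝓡∂ (n + 1)) x →L[ℝ] ℝ}
    (hs : ∀ x v w, g x v w = g x w v) (hp : ∀ x v, v ≠ 0 → 0 < g x v v)
    (he : e ∈ IsManifold.maximalAtlas (𝓡∂ (n + 1)) ∞ M) (hy : y ∈ chartDomain e ∩ halfSpace n) :
    (gramIn e g y).PosDef := by
  refine Matrix.PosDef.of_dotProduct_mulVec_pos ?_ fun v hv => ?_
  · ext i j
    exact hs _ _ _
  · have h1 : star v ⬝ᵥ gramIn e g y *ᵥ v = formIn e g y (WithLp.toLp 2 v) (WithLp.toLp 2 v) := by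
      rw [clm_bilinear_basisVec]
      simp only [dotProduct, mulVec, Pi.star_apply, star_trivial, Finset.mul_sum]
      exact Finset.sum_congr rfl fun i _ => Finset.sum_congr rfl fun j _ => (mul_assoc _ _ _).symm
    rw [h1]
    refine hp _ _ fun h0 => hv ?_
    have h2 := injective_chartSymmDeriv he hy (h0.trans (map_zero (chartSymmDeriv e y)).symm)
    exact (WithLp.toLp_eq_zero 2).1 h2

/-- The coordinate frame is the tangent map of the inverse chart applied to constant vector fields,
hence smooth along the inverse chart. Evaluating the section g on two such fields preserves its
class. -/
theorem contDiffOn_gramIn {m : ℕ∞ω} (hm : m ≤ ∞)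
    {g : (x : M) → TangentSpace (𝓡∂ (n + 1)) x →L[ℝ] TangentSpace (𝓡∂ (n + 1)) x →L[ℝ] ℝ}
    (hg : ContMDiff (𝓡∂ (n + 1))
      ((𝓡∂ (n + 1)).prod 𝓘(ℝ, EuclideanSpace ℝ (Fin (n + 1)) →L[ℝ]
        EuclideanSpace ℝ (Fin (n + 1)) →L[ℝ] ℝ)) m
      (fun x : M => Bundle.TotalSpace.mk' (EuclideanSpace ℝ (Fin (n + 1)) →L[ℝ]
        EuclideanSpace ℝ (Fin (n + 1)) →L[ℝ] ℝ)
        (E := fun x : M => TangentSpace (𝓡∂ (n + 1)) x →L[ℝ] TangentSpace (𝓡∂ (n + 1)) x →L[ℝ] ℝ)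
        x (g x)))
    (he : e ∈ IsManifold.maximalAtlas (𝓡∂ (n + 1)) ∞ M) (i j : Fin (n + 1)) :
    ContDiffOn ℝ m (fun y => gramIn e g y i j) (chartDomain e ∩ halfSpace n) := by
  have hsymm := contMDiffOn_chart_symm he
  have hu : UniqueMDiffOn 𝓘(ℝ, Coord n) (chartDomain e ∩ halfSpace n) :=
    (uniqueDiffOn_inter_halfSpace isOpen_chartDomain).uniqueMDiffOn
  have ht := hsymm.contMDiffOn_tangentMapWithin (m := ∞) (by simp) hu
  have hv : ∀ i : Fin (n + 1), ContMDiffOn 𝓘(ℝ, Coord n) ((𝓡∂ (n + 1)).prod 𝓘(ℝ, Coord n)) m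
      (fun y => Bundle.TotalSpace.mk' (Coord n) (E := fun x : M => TangentSpace (𝓡∂ (n + 1)) x)
        ((e.extend (𝓡∂ (n + 1))).symm y) (chartSymmDeriv e y (basisVec i)))
      (chartDomain e ∩ halfSpace n) := by
    intro i
    have hc := (contMDiff_vectorSpace_iff_contDiff (𝕜 := ℝ) (n := ∞)
      (V := fun _ : Coord n => (basisVec i : Coord n))).2 contDiff_const
    have := (ht.comp hc.contMDiffOn fun y hy => hy).of_le hm
    refine this.congr fun y hy => ?_
    have h1 := (hasMFDerivWithinAt_extend_symm he hy).mfderivWithin (hu y hy)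
    simp only [Function.comp, tangentMapWithin]
    rw [h1]
    rfl
  have h := ContMDiffOn.clm_bundle_apply₂ (F₁ := Coord n) (F₂ := Coord n) (F₃ := ℝ)
    (E₁ := fun x : M => TangentSpace (𝓡∂ (n + 1)) x)
    (E₂ := fun x : M => TangentSpace (𝓡∂ (n + 1)) x) (E₃ := fun _ : M => ℝ)
    (hg.comp_contMDiffOn (hsymm.of_le hm)) (hv i) (hv j)
  rw [← contMDiffOn_iff_contDiffOn]
  intro y hy
  have h1 := h y hy
  simp only [Bundle.contMDiffWithinAt_totalSpace] at h1
  exact h1.2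

end Gram

end ConformallyCompact

namespace ConformallyCompact

/-! ### Computing the operators in a fixed chart. -/

section Manifold

open Filter Topology Matrix

variable {n : ℕ} {M : Type*} [TopologicalSpace M] [ChartedSpace (EuclideanHalfSpace (n + 1)) M]
  [IsManifold (𝓡∂ (n + 1)) ∞ M]
  {e e' : OpenPartialHomeomorph M (EuclideanHalfSpace (n + 1))} {x : M} {y : Coord n}
  {k : ℕ} {β : ℝ} {ρ φ : M → ℝ}
  {gbar : Bundle.ContMDiffRiemannianMetric (𝓡∂ (n + 1)) 2 (EuclideanSpace ℝ (Fin (n + 1)))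
      (fun x : M => TangentSpace (𝓡∂ (n + 1)) x)}
  {g : (x : M) → TangentSpace (𝓡∂ (n + 1)) x →L[ℝ] TangentSpace (𝓡∂ (n + 1)) x →L[ℝ] ℝ}

theorem contMDiffAt_chart_symm (he : e ∈ IsManifold.maximalAtlas (𝓡∂ (n + 1)) ∞ M)
    (hy : y ∈ chartDomain e ∩ openHalfSpace n) :
    ContMDiffAt 𝓘(ℝ, Coord n) (𝓡∂ (n + 1)) ∞ (e.extend (𝓡∂ (n + 1))).symm y :=
  (contMDiffOn_chart_symm he y (inter_openHalfSpace_subset hy)).contMDiffAt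
    (inter_halfSpace_mem_nhds isOpen_chartDomain hy)

theorem isOpen_interior : IsOpen ((𝓡∂ (n + 1)).interior M) :=
  ModelWithCorners.isOpen_interior (n := ∞) (by simp)

/-- A function of class `C²` in the interior, read in a chart. -/
theorem contDiffAt_comp_chart_symm
    (hφ : ContMDiffOn (𝓡∂ (n + 1)) 𝓘(ℝ, ℝ) 2 φ ((𝓡∂ (n + 1)).interior M))
    (he : e ∈ IsManifold.maximalAtlas (𝓡∂ (n + 1)) ∞ M)
    (hy : y ∈ chartDomain e ∩ openHalfSpace n) :
    ContDiffAt ℝ 2 (φ ∘ (e.extend (𝓡∂ (n + 1))).symm) y := by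
  have h1 := (hφ.contMDiffAt (isOpen_interior.mem_nhds (extend_symm_mem_interior he hy)))
  exact (h1.comp y ((contMDiffAt_chart_symm he hy).of_le (by norm_cast))).contDiffAt

theorem contDiffOn_comp_chart_symm {m : ℕ∞ω} (hm : m ≤ ∞)
    (hφ : ContMDiff (𝓡∂ (n + 1)) 𝓘(ℝ, ℝ) m φ)
    (he : e ∈ IsManifold.maximalAtlas (𝓡∂ (n + 1)) ∞ M) :
    ContDiffOn ℝ m (φ ∘ (e.extend (𝓡∂ (n + 1))).symm) (chartDomain e ∩ halfSpace n) :=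
  (hφ.comp_contMDiffOn ((contMDiffOn_chart_symm he).of_le hm)).contDiffOn

/-- The metric `g = ρ⁻² gbar` is conformally compact. -/
structure IsConformallyCompact (ρ : M → ℝ)
    (gbar : Bundle.ContMDiffRiemannianMetric (𝓡∂ (n + 1)) 2 (EuclideanSpace ℝ (Fin (n + 1)))
      (fun x : M => TangentSpace (𝓡∂ (n + 1)) x))
    (g : (x : M) → TangentSpace (𝓡∂ (n + 1)) x →L[ℝ] TangentSpace (𝓡∂ (n + 1)) x →L[ℝ] ℝ) :
    Prop where
  isDefiningFunction : IsDefiningFunction (n := n) ρ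
  eq_smul : ∀ x ∈ (𝓡∂ (n + 1)).interior M, g x = ((ρ x) ^ 2)⁻¹ • gbar.inner x

namespace IsConformallyCompact

theorem gramIn_eq (h : IsConformallyCompact ρ gbar g)
    (he : e ∈ IsManifold.maximalAtlas (𝓡∂ (n + 1)) ∞ M)
    (hy : y ∈ chartDomain e ∩ openHalfSpace n) :
    gramIn e g y = (((ρ ∘ (e.extend (𝓡∂ (n + 1))).symm) y) ^ 2)⁻¹ • gramIn e gbar.inner y := by
  ext i j
  simp only [gramIn, of_apply, Matrix.smul_apply, h.eq_smul _ (extend_symm_mem_interior he hy)]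
  rfl

theorem isConformalAt (h : IsConformallyCompact ρ gbar g)
    (he : e ∈ IsManifold.maximalAtlas (𝓡∂ (n + 1)) ∞ M)
    (hy : y ∈ chartDomain e ∩ openHalfSpace n) :
    IsConformalAt (ρ ∘ (e.extend (𝓡∂ (n + 1))).symm) (gramIn e gbar.inner) (gramIn e g) y := by
  have hn := (isOpen_chartDomain (e := e).inter isOpen_openHalfSpace).mem_nhds hy
  refine ⟨?_, h.isDefiningFunction.pos _ (extend_symm_mem_interior he hy), ⟨fun i j => ?_, ?_⟩, ?_⟩
  · exact contDiffAt_comp_chart_symm (h.isDefiningFunction.contMDiff.of_le (by norm_num)).contMDiffOn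
      he hy
  · exact ((contDiffOn_gramIn (by norm_cast) gbar.contMDiff he i j) y
      (inter_openHalfSpace_subset hy)).contDiffAt (inter_halfSpace_mem_nhds isOpen_chartDomain hy)
  · filter_upwards [hn] with z hz
    exact posDef_gramIn gbar.symm gbar.pos he (inter_openHalfSpace_subset hz)
  · filter_upwards [hn] with z hz using h.gramIn_eq he hz

theorem isMetricAt (h : IsConformallyCompact ρ gbar g)
    (he : e ∈ IsManifold.maximalAtlas (𝓡∂ (n + 1)) ∞ M)
    (hy : y ∈ chartDomain e ∩ openHalfSpace n) : IsMetricAt (gramIn e g) y :=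
  (h.isConformalAt he hy).isMetricAt

theorem isCoordChangeAt (h : IsConformallyCompact ρ gbar g)
    (he : e ∈ IsManifold.maximalAtlas (𝓡∂ (n + 1)) ∞ M)
    (he' : e' ∈ IsManifold.maximalAtlas (𝓡∂ (n + 1)) ∞ M) (hx : x ∈ e.source) (hx' : x ∈ e'.source)
    (hxi : x ∈ (𝓡∂ (n + 1)).interior M) :
    IsCoordChangeAt (coordChange e e') (gramIn e g) (gramIn e' g) (e.extend (𝓡∂ (n + 1)) x) := by
  have hy : e.extend (𝓡∂ (n + 1)) x ∈ overlapDomain e e' ∩ openHalfSpace n :=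
    ⟨extend_mem_overlapDomain hx hx', (mem_interior_iff he hx).1 hxi⟩
  have hn := inter_halfSpace_mem_nhds isOpen_overlapDomain hy
  have hys := inter_openHalfSpace_subset hy
  have e1 : coordChange e e' (e.extend (𝓡∂ (n + 1)) x) = e'.extend (𝓡∂ (n + 1)) x := by
    rw [coordChange, e.extend_left_inv hx]
  refine ⟨?_, ?_, ?_, h.isMetricAt he (extend_mem_interior he hx hxi), ?_⟩
  · exact ((contDiffOn_coordChange he he' _ hys).contDiffAt hn).of_le (by norm_cast)
  · rw [← fderivWithin_of_mem_nhds hn]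
    exact isInvertible_fderivWithin_coordChange he he' hys
  · rw [e1]
    exact h.isMetricAt he' (extend_mem_interior he' hx' hxi)
  · filter_upwards [(isOpen_overlapDomain (e := e) (e' := e').inter
      isOpen_openHalfSpace).mem_nhds hy] with z hz using gramIn_comp g he he' hz

theorem eventually_comp_coordChange (φ : M → ℝ)
    (he : e ∈ IsManifold.maximalAtlas (𝓡∂ (n + 1)) ∞ M)
    (hx : x ∈ e.source) (hx' : x ∈ e'.source) (hxi : x ∈ (𝓡∂ (n + 1)).interior M) :
    φ ∘ (e.extend (𝓡∂ (n + 1))).symm =ᶠ[𝓝 (e.extend (𝓡∂ (n + 1)) x)]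
      (φ ∘ (e'.extend (𝓡∂ (n + 1))).symm) ∘ coordChange e e' := by
  have hy : e.extend (𝓡∂ (n + 1)) x ∈ overlapDomain e e' ∩ openHalfSpace n :=
    ⟨extend_mem_overlapDomain hx hx', (mem_interior_iff he hx).1 hxi⟩
  filter_upwards [(isOpen_overlapDomain (e := e) (e' := e').inter
    isOpen_openHalfSpace).mem_nhds hy] with z hz
  exact congrArg φ (extend_symm_coordChange (inter_openHalfSpace_subset hz)).symm

/-- The operator is defined through the preferred chart at x, which varies with x. Invariance of σ_k
under coordinate changes permits any chart, and so a single one for a whole boundary neighbourhood.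
-/
theorem yamabe_eq (h : IsConformallyCompact ρ gbar g)
    (he : e ∈ IsManifold.maximalAtlas (𝓡∂ (n + 1)) ∞ M) (hx : x ∈ e.source)
    (hxi : x ∈ (𝓡∂ (n + 1)).interior M)
    (hφ : ContMDiffOn (𝓡∂ (n + 1)) 𝓘(ℝ, ℝ) 2 φ ((𝓡∂ (n + 1)).interior M)) (C : ℝ) :
    yamabe k g φ C x = sigma k ((gramIn e g (e.extend (𝓡∂ (n + 1)) x))⁻¹ *
      negSchoutenConf (gramIn e g) (φ ∘ (e.extend (𝓡∂ (n + 1))).symm)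
        (e.extend (𝓡∂ (n + 1)) x)) - C * Real.exp (2 * k * φ x) := by
  have hc := IsManifold.chart_mem_maximalAtlas (I := 𝓡∂ (n + 1)) (n := ∞) x
  have hm := mem_chart_source (EuclideanHalfSpace (n + 1)) x
  have hcc := h.isCoordChangeAt he hc hx hm hxi
  have e1 : coordChange e (chartAt (EuclideanHalfSpace (n + 1)) x) (e.extend (𝓡∂ (n + 1)) x) =
      extChartAt (𝓡∂ (n + 1)) x x := by
    rw [coordChange, e.extend_left_inv hx]
    rfl
  have hd := contDiffAt_comp_chart_symm hφ hc (extend_mem_interior hc hm hxi)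
  rw [hcc.negSchoutenConf_comp (by rw [e1]; exact hd)
    (eventually_comp_coordChange φ he hx hm hxi), hcc.inv_mul, sigma_conj _ hcc.isUnit_det, e1]
  rfl

theorem yamabe_zero_eq (h : IsConformallyCompact ρ gbar g)
    (he : e ∈ IsManifold.maximalAtlas (𝓡∂ (n + 1)) ∞ M) (hx : x ∈ e.source)
    (hxi : x ∈ (𝓡∂ (n + 1)).interior M) (j : ℕ) (C : ℝ) :
    yamabe j g (fun _ => 0) C x = sigma j ((gramIn e g (e.extend (𝓡∂ (n + 1)) x))⁻¹ *
      (-schouten (gramIn e g) (e.extend (𝓡∂ (n + 1)) x))) - C := by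
  rw [h.yamabe_eq he hx hxi contMDiffOn_const]
  -- Written as ε times a function with ε = 0, the constant 0 falls under
  -- `negSchoutenConf_const_mul`.
  have e1 : (fun _ : M => (0 : ℝ)) ∘ (e.extend (𝓡∂ (n + 1))).symm =
      fun z => (0 : ℝ) * (0 : Coord n → ℝ) z := by
    funext z; simp
  rw [e1, negSchoutenConf_const_mul]
  simp

theorem laplacian_eq (h : IsConformallyCompact ρ gbar g)
    (he : e ∈ IsManifold.maximalAtlas (𝓡∂ (n + 1)) ∞ M) (hx : x ∈ e.source)
    (hxi : x ∈ (𝓡∂ (n + 1)).interior M)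
    (hφ : ContMDiffOn (𝓡∂ (n + 1)) 𝓘(ℝ, ℝ) 2 φ ((𝓡∂ (n + 1)).interior M)) :
    laplacian g φ x = ((gramIn e g (e.extend (𝓡∂ (n + 1)) x))⁻¹ *
      hessian (gramIn e g) (φ ∘ (e.extend (𝓡∂ (n + 1))).symm) (e.extend (𝓡∂ (n + 1)) x)).trace := by
  have hc := IsManifold.chart_mem_maximalAtlas (I := 𝓡∂ (n + 1)) (n := ∞) x
  have hm := mem_chart_source (EuclideanHalfSpace (n + 1)) x
  have hcc := h.isCoordChangeAt he hc hx hm hxi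
  have e1 : coordChange e (chartAt (EuclideanHalfSpace (n + 1)) x) (e.extend (𝓡∂ (n + 1)) x) =
      extChartAt (𝓡∂ (n + 1)) x x := by
    rw [coordChange, e.extend_left_inv hx]
    rfl
  have hd := contDiffAt_comp_chart_symm hφ hc (extend_mem_interior hc hm hxi)
  rw [hcc.hessian_comp (by rw [e1]; exact hd)
    (eventually_comp_coordChange φ he hx hm hxi), hcc.trace_inv_mul, e1]
  have hG := (h.isMetricAt hc (extend_mem_interior hc hm hxi)).posDef_self
  exact sum_mul_eq_trace (isSymm_inv (isSymm_of_posDef hG)) _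

theorem hasDerivAt_yamabe (h : IsConformallyCompact ρ gbar g) (hk1 : 1 ≤ k)
    (he : e ∈ IsManifold.maximalAtlas (𝓡∂ (n + 1)) ∞ M) (hx : x ∈ e.source)
    (hxi : x ∈ (𝓡∂ (n + 1)).interior M)
    (hφ : ContMDiffOn (𝓡∂ (n + 1)) 𝓘(ℝ, ℝ) 2 φ ((𝓡∂ (n + 1)).interior M)) (C : ℝ) :
    HasDerivAt (fun ε : ℝ => yamabe k g (fun z => ε * φ z) C x)
      ((newton (k - 1) ((gramIn e g (e.extend (𝓡∂ (n + 1)) x))⁻¹ *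
          (-schouten (gramIn e g) (e.extend (𝓡∂ (n + 1)) x))) *
        ((gramIn e g (e.extend (𝓡∂ (n + 1)) x))⁻¹ * hessian (gramIn e g)
          (φ ∘ (e.extend (𝓡∂ (n + 1))).symm) (e.extend (𝓡∂ (n + 1)) x))).trace -
        2 * k * C * φ x) 0 := by
  have e1 : ∀ ε : ℝ, yamabe k g (fun z => ε * φ z) C x =
      sigma k ((gramIn e g (e.extend (𝓡∂ (n + 1)) x))⁻¹ *
        negSchoutenConf (gramIn e g) (fun z => ε * (φ ∘ (e.extend (𝓡∂ (n + 1))).symm) z)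
        (e.extend (𝓡∂ (n + 1)) x)) - C * Real.exp (2 * k * (ε * φ x)) := fun ε =>
    h.yamabe_eq he hx hxi (contMDiffOn_const.mul hφ) C
  simp only [e1]
  refine (hasDerivAt_sigma_negSchoutenConf hk1).sub ?_
  have h1 := ((((hasDerivAt_id (0 : ℝ)).mul_const (φ x)).const_mul (2 * (k : ℝ))).exp).const_mul C
  refine h1.congr_deriv ?_
  simp
  ring

end IsConformallyCompact

end Manifold

end ConformallyCompact

namespace ConformallyCompact

/-! ### The remainder operator and the regularity of its coefficients. -/

section Manifold

open Filter Topology Matrix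

variable {n : ℕ} {M : Type*} [TopologicalSpace M] [ChartedSpace (EuclideanHalfSpace (n + 1)) M]
  [IsManifold (𝓡∂ (n + 1)) ∞ M]
  {e : OpenPartialHomeomorph M (EuclideanHalfSpace (n + 1))} {x : M} {y : Coord n}
  {k : ℕ} {β : ℝ} {ρ φ : M → ℝ}
  {gbar : Bundle.ContMDiffRiemannianMetric (𝓡∂ (n + 1)) 2 (EuclideanSpace ℝ (Fin (n + 1)))
      (fun x : M => TangentSpace (𝓡∂ (n + 1)) x)}
  {g : (x : M) → TangentSpace (𝓡∂ (n + 1)) x →L[ℝ] TangentSpace (𝓡∂ (n + 1)) x →L[ℝ] ℝ}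

/-- A conformally compact solution of the `σ_k`-Yamabe equation. -/
structure IsYamabeSolution (k : ℕ) (β : ℝ) (ρ : M → ℝ)
    (gbar : Bundle.ContMDiffRiemannianMetric (𝓡∂ (n + 1)) 2 (EuclideanSpace ℝ (Fin (n + 1)))
      (fun x : M => TangentSpace (𝓡∂ (n + 1)) x))
    (g : (x : M) → TangentSpace (𝓡∂ (n + 1)) x →L[ℝ] TangentSpace (𝓡∂ (n + 1)) x →L[ℝ] ℝ) :
    Prop extends IsConformallyCompact ρ gbar g where
  two_le : 2 ≤ n
  one_le : 1 ≤ k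
  le : k ≤ n + 1
  beta_pos : 0 < β
  yamabe_eq_zero : ∀ x ∈ (𝓡∂ (n + 1)).interior M, yamabe k g (fun _ => 0) β x = 0

namespace IsYamabeSolution

theorem sigma_eq (h : IsYamabeSolution k β ρ gbar g)
    (he : e ∈ IsManifold.maximalAtlas (𝓡∂ (n + 1)) ∞ M)
    (hy : y ∈ chartDomain e ∩ openHalfSpace n) :
    sigma k ((gramIn e g y)⁻¹ * (-schouten (gramIn e g) y)) = β := by
  have hy' := inter_openHalfSpace_subset hy
  have h1 := h.yamabe_eq_zero _ (extend_symm_mem_interior he hy)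
  rw [h.yamabe_zero_eq he (extend_symm_mem hy') (extend_symm_mem_interior he hy),
    extend_extend_symm hy'] at h1
  linarith

theorem fderivWithin_ne_zero (h : IsYamabeSolution k β ρ gbar g)
    (he : e ∈ IsManifold.maximalAtlas (𝓡∂ (n + 1)) ∞ M)
    (hy : y ∈ chartDomain e) (hy0 : y 0 = 0) :
    fderivWithin ℝ (ρ ∘ (e.extend (𝓡∂ (n + 1))).symm) (chartDomain e ∩ halfSpace n) y ≠ 0 := by
  intro h0
  have hy' : y ∈ chartDomain e ∩ halfSpace n := ⟨hy, hy0.ge⟩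
  have hx := extend_symm_mem hy'
  set x := (e.extend (𝓡∂ (n + 1))).symm y with hxdef
  have hyx : e.extend (𝓡∂ (n + 1)) x = y := extend_extend_symm hy'
  have hb : x ∈ (𝓡∂ (n + 1)).boundary M := by rw [mem_boundary_iff he hx, hyx, hy0]
  refine h.isDefiningFunction.mfderiv_ne_zero x hb ?_
  have hd : HasFDerivWithinAt (ρ ∘ (e.extend (𝓡∂ (n + 1))).symm) (0 : Coord n →L[ℝ] ℝ)
      (chartDomain e ∩ halfSpace n) (e.extend (𝓡∂ (n + 1)) x) := by
    rw [hyx, ← h0]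
    exact (((contDiffOn_comp_chart_symm (by norm_cast) h.isDefiningFunction.contMDiff
      he).differentiableOn (by simp)) y hy').hasFDerivWithinAt
  have h1 := ((e.contMDiffAt_extend he hx).mdifferentiableAt
    (by simp)).hasMFDerivAt.hasMFDerivWithinAt (s := e.source)
  have h2 := hd.hasMFDerivWithinAt.comp x h1 fun z hz => extend_mem hz
  have h3 := h2.congr_mono (f₁ := ρ) (fun z hz => congrArg ρ (e.extend_left_inv hz).symm)
    (congrArg ρ (e.extend_left_inv hx).symm) subset_rfl
  rw [(h3.hasMFDerivAt (e.open_source.mem_nhds hx)).mfderiv]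
  exact ContinuousLinearMap.zero_comp _

theorem isSolutionChart_of_contDiffOn (h : IsYamabeSolution k β ρ gbar g) {p : ℕ∞}
    (he : e ∈ IsManifold.maximalAtlas (𝓡∂ (n + 1)) ∞ M)
    (hr : ContDiffOn ℝ (p + 3) (ρ ∘ (e.extend (𝓡∂ (n + 1))).symm) (chartDomain e ∩ halfSpace n))
    (hG : ∀ i j, ContDiffOn ℝ (p + 2) (fun y => gramIn e gbar.inner y i j)
      (chartDomain e ∩ halfSpace n)) :
    IsSolutionChart p k β (chartDomain e) (ρ ∘ (e.extend (𝓡∂ (n + 1))).symm)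
      (gramIn e gbar.inner) (gramIn e g) where
  isOpen := isOpen_chartDomain
  contDiffOn := hr
  contDiffOn_metric := hG
  posDef y hy := posDef_gramIn gbar.symm gbar.pos he hy
  pos y hy := h.isDefiningFunction.pos _ (extend_symm_mem_interior he hy)
  eq_zero y hy hy0 := by
    refine h.isDefiningFunction.eq_zero _ ?_
    have hy' : y ∈ chartDomain e ∩ halfSpace n := ⟨hy, hy0.ge⟩
    rw [mem_boundary_iff he (extend_symm_mem hy'), extend_extend_symm hy', hy0]
  fderivWithin_ne_zero y hy hy0 := h.fderivWithin_ne_zero he hy hy0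
  conformal y hy := h.gramIn_eq he hy
  sigma_eq y hy := h.sigma_eq he hy

theorem isSolutionChart (h : IsYamabeSolution k β ρ gbar g)
    (he : e ∈ IsManifold.maximalAtlas (𝓡∂ (n + 1)) ∞ M) :
    IsSolutionChart 0 k β (chartDomain e) (ρ ∘ (e.extend (𝓡∂ (n + 1))).symm)
      (gramIn e gbar.inner) (gramIn e g) := by
  refine h.isSolutionChart_of_contDiffOn he ?_ fun i j => ?_
  · simpa using contDiffOn_comp_chart_symm (by norm_cast) h.isDefiningFunction.contMDiff he
  · simpa using contDiffOn_gramIn (by norm_cast) gbar.contMDiff he i j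

theorem isSolutionChart_top (h : IsYamabeSolution k β ρ gbar g)
    (hρ : ContMDiff (𝓡∂ (n + 1)) 𝓘(ℝ, ℝ) ∞ ρ) (hg : IsSmoothMetric gbar)
    (he : e ∈ IsManifold.maximalAtlas (𝓡∂ (n + 1)) ∞ M) :
    IsSolutionChart ⊤ k β (chartDomain e) (ρ ∘ (e.extend (𝓡∂ (n + 1))).symm)
      (gramIn e gbar.inner) (gramIn e g) :=
  h.isSolutionChart_of_contDiffOn he (contDiffOn_comp_chart_symm le_rfl hρ he)
    fun i j => contDiffOn_gramIn le_rfl hg he i j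

/-- The remainder operator in the expansion of the linearization. -/
def remainder (k : ℕ) (β : ℝ) (ρ : M → ℝ)
    (g : (x : M) → TangentSpace (𝓡∂ (n + 1)) x →L[ℝ] TangentSpace (𝓡∂ (n + 1)) x →L[ℝ] ℝ)
    (φ : M → ℝ) (x : M) : ℝ :=
  (ρ x ^ 3)⁻¹ * (linearization k g β φ x -
    cConst k n * (β / betaHyp k n) ^ (((k : ℝ) - 1) / k) * laplacian g φ x + 2 * k * β * φ x)

/-- True by the choice of `remainder`, as ρ > 0 inside. The substance of the expansion is
`exists_hasCoefficients`. -/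
theorem linearization_eq (h : IsYamabeSolution k β ρ gbar g)
    (hx : x ∈ (𝓡∂ (n + 1)).interior M) :
    linearization k g β φ x =
      cConst k n * (β / betaHyp k n) ^ (((k : ℝ) - 1) / k) * laplacian g φ x
        - 2 * k * β * φ x + ρ x ^ 3 * remainder k β ρ g φ x := by
  have h0 := (pow_pos (h.isDefiningFunction.pos x hx) 3).ne'
  rw [remainder, mul_inv_cancel_left₀ h0]
  ring

/-- Serves both regularity claims: p = 0 gives continuous coefficients, hence bounded on compact
sets, and p = ⊤ gives smooth ones. -/
theorem exists_hasCoefficients (h : IsYamabeSolution k β ρ gbar g) {p : ℕ∞}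
    (he : e ∈ IsManifold.maximalAtlas (𝓡∂ (n + 1)) ∞ M)
    (hc : IsSolutionChart p k β (chartDomain e) (ρ ∘ (e.extend (𝓡∂ (n + 1))).symm)
      (gramIn e gbar.inner) (gramIn e g)) :
    ∃ a b, HasCoefficients (remainder k β ρ g) e a b ∧
      (∀ i j, ContDiffOn ℝ p (a i j) (e.extend (𝓡∂ (n + 1))).target) ∧
      ∀ i, ContDiffOn ℝ p (b i) (e.extend (𝓡∂ (n + 1))).target := by
  obtain ⟨a, b, ha, hb, hab⟩ := hc.exists_coefficients h.two_le h.one_le h.le h.beta_pos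
  rw [extend_target_eq]
  refine ⟨a, b, fun φ hφ x hx => ?_, ha, hb⟩
  have hy := extend_mem_interior he hx.1 hx.2
  have h0 := (pow_pos (h.isDefiningFunction.pos x hx.2) 3).ne'
  have h1 := (h.hasDerivAt_yamabe h.one_le he hx.1 hx.2 hφ β).deriv
  have e1 : (ρ ∘ (e.extend (𝓡∂ (n + 1))).symm) (e.extend (𝓡∂ (n + 1)) x) = ρ x :=
    congrArg ρ (e.extend_left_inv hx.1)
  rw [hab _ hy _ (contDiffAt_comp_chart_symm hφ he hy), e1, ← h.laplacian_eq he hx.1 hx.2 hφ] at h1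
  have h2 : ∀ L S c : ℝ, (ρ x ^ 3)⁻¹ * (c * L + ρ x ^ 3 * S - 2 * k * β * φ x - c * L +
      2 * k * β * φ x) = S := by
    intro L S c
    rw [← inv_mul_cancel_left₀ h0 S, mul_inv_cancel_left₀ h0]
    ring
  rw [remainder, linearization, h1]
  exact h2 _ _ _

theorem isSmoothSecondOrder_remainder (h : IsYamabeSolution k β ρ gbar g)
    (hρ : ContMDiff (𝓡∂ (n + 1)) 𝓘(ℝ, ℝ) ∞ ρ) (hg : IsSmoothMetric gbar) :
    IsSmoothSecondOrder (n := n) (remainder k β ρ g) := fun _ he =>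
  h.exists_hasCoefficients he (h.isSolutionChart_top hρ hg he)

theorem isBoundedSecondOrder_remainder (h : IsYamabeSolution k β ρ gbar g) :
    IsBoundedSecondOrder (n := n) (remainder k β ρ g) := by
  intro e he
  obtain ⟨a, b, hab, ha, hb⟩ := h.exists_hasCoefficients he (h.isSolutionChart he)
  refine ⟨a, b, hab, fun K hK hKc => ?_⟩
  choose A hA using fun i j => hKc.exists_bound_of_continuousOn ((ha i j).continuousOn.mono hK)
  choose B hB using fun i => hKc.exists_bound_of_continuousOn ((hb i).continuousOn.mono hK)
  refine ⟨∑ i, ∑ j, |A i j| + ∑ i, |B i|, fun y hy => ⟨fun i j => ?_, fun i => ?_⟩⟩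
  · have h1 : |A i j| ≤ ∑ i, ∑ j, |A i j| :=
      (Finset.single_le_sum (f := fun j => |A i j|) (fun _ _ => abs_nonneg _)
        (Finset.mem_univ j)).trans (Finset.single_le_sum (f := fun i => ∑ j, |A i j|)
          (fun _ _ => Finset.sum_nonneg fun _ _ => abs_nonneg _) (Finset.mem_univ i))
    have h2 : 0 ≤ ∑ i, |B i| := Finset.sum_nonneg fun _ _ => abs_nonneg _
    have h3 := hA i j y hy
    have h4 := le_abs_self (A i j)
    rw [Real.norm_eq_abs] at h3
    linarith
  · have h1 : |B i| ≤ ∑ i, |B i| :=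
      Finset.single_le_sum (f := fun i => |B i|) (fun _ _ => abs_nonneg _) (Finset.mem_univ i)
    have h2 : 0 ≤ ∑ i, ∑ j, |A i j| :=
      Finset.sum_nonneg fun _ _ => Finset.sum_nonneg fun _ _ => abs_nonneg _
    have h3 := hB i y hy
    have h4 := le_abs_self (B i)
    rw [Real.norm_eq_abs] at h3
    linarith

end IsYamabeSolution

end Manifold

end ConformallyCompact

namespace ConformallyCompact

/-! ### The second derivative test at a local maximum. -/

section SecondDerivativeTest

open Filter Topology Matrix

variable {n : ℕ} {G : Coord n → Matrix (Fin (n + 1)) (Fin (n + 1)) ℝ} {y : Coord n}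
  {u w : Coord n → ℝ}

theorem sigma_smul_one {d k : ℕ} (hk : k ≤ d) (c : ℝ) :
    sigma k (c • (1 : Matrix (Fin d) (Fin d) ℝ)) = (d.choose k : ℝ) * c ^ k := by
  rw [← add_zero (c • (1 : Matrix (Fin d) (Fin d) ℝ)), sigma_smul_one_add hk,
    Finset.sum_eq_single 0 ?_ (by simp)]
  · simp [sigma_zero]
  · intro j _ hj
    have := sigma_smul (d := d) j 0 1
    rw [zero_smul, zero_pow hj, zero_mul] at this
    rw [this, mul_zero]

/-- A positive second derivative would make the point a local minimum too, so f would be locally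
constant and its second derivative zero. -/
theorem deriv_deriv_nonpos_of_isLocalMax {f : ℝ → ℝ} {t : ℝ} (hc : ContinuousAt f t)
    (hf : IsLocalMax f t) : deriv (deriv f) t ≤ 0 := by
  by_contra! h
  have hmin := isLocalMin_of_deriv_deriv_pos h hf.deriv_eq_zero hc
  have he : f =ᶠ[𝓝 t] fun _ => f t := by
    filter_upwards [hf, hmin] with s h1 h2 using le_antisymm h1 h2
  have h1 := he.deriv.deriv_eq
  simp at h1
  exact h.ne' h1

theorem fderiv_fderiv_nonpos_of_isLocalMax (hu : ContDiffAt ℝ 2 u y) (hmax : IsLocalMax u y)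
    (v : Coord n) : fderiv ℝ (fderiv ℝ u) y v v ≤ 0 := by
  have hline : ∀ t : ℝ, HasDerivAt (fun t : ℝ => y + t • v) v t := fun t => by
    simpa using ((hasDerivAt_id t).smul_const v).const_add y
  have hline0 : Tendsto (fun t : ℝ => y + t • v) (𝓝 0) (𝓝 y) := by
    simpa using (hline 0).continuousAt.tendsto
  have hdiff : ∀ᶠ z in 𝓝 y, DifferentiableAt ℝ u z := by
    filter_upwards [hu.eventually (by simp)] with z hz using hz.differentiableAt (by simp)
  have h1 : deriv (fun t : ℝ => u (y + t • v)) =ᶠ[𝓝 0] fun t => fderiv ℝ u (y + t • v) v := by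
    filter_upwards [hline0.eventually hdiff] with t ht
    exact (ht.hasFDerivAt.comp_hasDerivAt t (hline t)).deriv
  have hd : HasFDerivAt (fderiv ℝ u) (fderiv ℝ (fderiv ℝ u) y) (y + (0 : ℝ) • v) := by
    rw [zero_smul, add_zero]
    exact ((hu.fderiv_right (m := 1) (by norm_num)).differentiableAt (by norm_num)).hasFDerivAt
  have h2 : deriv (deriv fun t : ℝ => u (y + t • v)) 0 = fderiv ℝ (fderiv ℝ u) y v v := by
    rw [h1.deriv_eq]
    have hc : HasDerivAt (fun t : ℝ => fderiv ℝ u (y + t • v)) (fderiv ℝ (fderiv ℝ u) y v) 0 :=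
      hd.comp_hasDerivAt (0 : ℝ) (hline 0)
    have := ((ContinuousLinearMap.apply ℝ ℝ v).hasFDerivAt
      (x := fderiv ℝ u (y + (0 : ℝ) • v))).comp_hasDerivAt (0 : ℝ) hc
    exact this.deriv
  rw [← h2]
  have hu0 : ContinuousAt u (y + (0 : ℝ) • v) := by
    rw [zero_smul, add_zero]
    exact hu.continuousAt
  refine deriv_deriv_nonpos_of_isLocalMax
    (ContinuousAt.comp (f := fun t : ℝ => y + t • v) hu0 (hline 0).continuousAt) ?_
  filter_upwards [hline0.eventually hmax] with t ht
  simpa using ht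

/-- At a critical point the Christoffel term drops out and the covariant Hessian is the ordinary
one. -/
theorem posSemidef_neg_hessian_of_isLocalMax (hG : IsMetricAt G y) (hu : ContDiffAt ℝ 2 u y)
    (hmax : IsLocalMax u y) : (-hessian G u y).PosSemidef := by
  have h0 : ∀ i j, hessian G u y i j = fderiv ℝ (fderiv ℝ u) y (basisVec i) (basisVec j) :=
    fun i j => by simp [hessian_eq hu, hmax.fderiv_eq_zero]
  refine Matrix.PosSemidef.of_dotProduct_mulVec_nonneg ?_ fun v => ?_
  · have := (hessian_isSymm hG hu).neg
    rw [IsHermitian, conjTranspose_eq_transpose_of_trivial, this.eq]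
  · have h1 : star v ⬝ᵥ (-hessian G u y) *ᵥ v =
        -fderiv ℝ (fderiv ℝ u) y (WithLp.toLp 2 v) (WithLp.toLp 2 v) := by
      rw [clm_bilinear_basisVec, neg_mulVec, dotProduct_neg]
      simp only [dotProduct, mulVec, Pi.star_apply, star_trivial, Finset.mul_sum, h0]
      exact congrArg _ (Finset.sum_congr rfl fun i _ => Finset.sum_congr rfl fun j _ =>
        (mul_assoc _ _ _).symm)
    rw [h1]
    exact neg_nonneg.2 (fderiv_fderiv_nonpos_of_isLocalMax hu hmax _)

theorem hessian_sub_const_mul (hu : ContDiffAt ℝ 2 u y) (hw : ContDiffAt ℝ 2 w y) (c : ℝ) :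
    hessian G (fun z => u z - c * w z) y = hessian G u y - c • hessian G w y := by
  have h1 : ∀ u w : Coord n → ℝ, DifferentiableAt ℝ u y → DifferentiableAt ℝ w y → ∀ i,
      pderiv i (fun z => u z - c * w z) y = pderiv i u y - c * pderiv i w y := by
    intro u w hu hw i
    rw [pderiv, (hu.hasFDerivAt.fun_sub (hw.hasFDerivAt.const_mul c)).fderiv]
    rfl
  have hev : ∀ j, pderiv j (fun z => u z - c * w z) =ᶠ[𝓝 y]
      fun z => pderiv j u z - c * pderiv j w z := by
    intro j
    filter_upwards [hu.eventually (by simp), hw.eventually (by simp)] with z hz hz'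
    rw [pderiv, ((hz.differentiableAt (by simp)).hasFDerivAt.fun_sub
      ((hz'.differentiableAt (by simp)).hasFDerivAt.const_mul c)).fderiv]
    rfl
  have hd : ∀ {u : Coord n → ℝ}, ContDiffAt ℝ 2 u y → ∀ j, DifferentiableAt ℝ (pderiv j u) y :=
    fun hu j => ((hu.fderiv_right (m := 1) (by norm_num)).differentiableAt
      (by norm_num)).clm_apply (differentiableAt_const _)
  ext i j
  have h2 : pderiv i (pderiv j fun z => u z - c * w z) y =
      pderiv i (pderiv j u) y - c * pderiv i (pderiv j w) y := by
    rw [← h1 _ _ (hd hu j) (hd hw j), pderiv, (hev j).fderiv_eq (𝕜 := ℝ)]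
    rfl
  simp only [hessian, of_apply, Matrix.sub_apply, Matrix.smul_apply, smul_eq_mul, h2,
    h1 _ _ (hu.differentiableAt (by simp)) (hw.differentiableAt (by simp)), mul_sub,
    Finset.mul_sum, Finset.sum_sub_distrib]
  have h3 : ∀ l, christoffel G l i j y * (c * pderiv l w y) =
      c * (christoffel G l i j y * pderiv l w y) := fun l => by ring
  simp only [h3]
  ring

end SecondDerivativeTest

/-! ### The positive cone condition on the whole manifold. -/

section Positivity

open Filter Topology Matrix

variable {n : ℕ} {M : Type*} [TopologicalSpace M] [ChartedSpace (EuclideanHalfSpace (n + 1)) M]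
  [IsManifold (𝓡∂ (n + 1)) ∞ M]
  {e : OpenPartialHomeomorph M (EuclideanHalfSpace (n + 1))} {x : M} {y : Coord n}
  {k : ℕ} {β : ℝ} {ρ φ : M → ℝ}
  {gbar : Bundle.ContMDiffRiemannianMetric (𝓡∂ (n + 1)) 2 (EuclideanSpace ℝ (Fin (n + 1)))
      (fun x : M => TangentSpace (𝓡∂ (n + 1)) x)}
  {g : (x : M) → TangentSpace (𝓡∂ (n + 1)) x →L[ℝ] TangentSpace (𝓡∂ (n + 1)) x →L[ℝ] ℝ}

/-- The points where `-A_g` lies in the positive cone `σ_1 > 0, …, σ_k > 0`, and the boundary. -/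
def positiveSet (k : ℕ)
    (g : (x : M) → TangentSpace (𝓡∂ (n + 1)) x →L[ℝ] TangentSpace (𝓡∂ (n + 1)) x →L[ℝ] ℝ) :
    Set M :=
  {x | x ∈ (𝓡∂ (n + 1)).interior M → ∀ j ≤ k, 0 < yamabe j g (fun _ => 0) 0 x}

namespace IsYamabeSolution

/-- T j is σ_j of the continuous extension of -g⁻¹A_g. The strict inequalities make the set open and
the weak ones make it closed; they agree because σ_k = β > 0 inside, and because the extension is a
positive scalar on the boundary. -/
theorem exists_continuousOn_mem_positiveSet_iff (h : IsYamabeSolution k β ρ gbar g)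
    (he : e ∈ IsManifold.maximalAtlas (𝓡∂ (n + 1)) ∞ M) :
    ∃ T : ℕ → M → ℝ, (∀ j, ContinuousOn (T j) e.source) ∧ ∀ x ∈ e.source,
      (x ∈ positiveSet k g ↔ ∀ j ≤ k, 0 < T j x) ∧ (x ∈ positiveSet k g ↔ ∀ j ≤ k, 0 ≤ T j x) := by
  obtain ⟨F, hF, hFi, hFb⟩ := (h.isSolutionChart he).exists_endomorphism_extension h.two_le
    h.one_le h.le h.beta_pos
  refine ⟨fun j x => sigma j (F (e.extend (𝓡∂ (n + 1)) x)), fun j => ?_, fun x hx => ?_⟩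
  · have h1 : ContinuousOn (fun y => sigma j (F y)) (chartDomain e ∩ halfSpace n) := fun y hy =>
      (contDiffWithinAt_sigma j fun a b => hF a b y hy).continuousWithinAt
    exact h1.comp (e.extend_source (I := 𝓡∂ (n + 1)) ▸ e.continuousOn_extend) fun x hx => extend_mem hx
  · by_cases hxi : x ∈ (𝓡∂ (n + 1)).interior M
    · have hy := extend_mem_interior he hx hxi
      have hG := h.isMetricAt he hy
      have e1 : x ∈ positiveSet k g ↔ ∀ j ≤ k, 0 < sigma j (F (e.extend (𝓡∂ (n + 1)) x)) := by
        simp only [positiveSet, mem_ofPred_eq, hxi, true_imp_iff, h.yamabe_zero_eq he hx hxi,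
          sub_zero, hFi _ hy]
      refine ⟨e1, e1.trans ⟨fun hp j hj => (hp j hj).le, fun hp j hj => ?_⟩⟩
      have hk := h.sigma_eq he hy
      simp only [hFi _ hy] at hp ⊢
      exact sigma_pos_of_nonneg hG.posDef_self hG.schouten_isSymm.neg h.le hp
        (hk ▸ h.beta_pos) hj
    · have hb : (e.extend (𝓡∂ (n + 1)) x) 0 = 0 := by
        rw [← mem_boundary_iff he hx, ← ModelWithCorners.compl_interior]
        exact hxi
      have hpos : ∀ j ≤ k, 0 < sigma j (F (e.extend (𝓡∂ (n + 1)) x)) := fun j hj => by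
        rw [hFb _ (extend_mem hx).1 hb, sigma_smul_one (hj.trans h.le)]
        exact mul_pos (by exact_mod_cast Nat.choose_pos (hj.trans h.le))
          (pow_pos (half_pos (boundaryGradSq_pos h.le h.beta_pos)) _)
      have hmem : x ∈ positiveSet k g := fun hx' => absurd hx' hxi
      exact ⟨⟨fun _ => hpos, fun _ => hmem⟩, ⟨fun _ j hj => (hpos j hj).le, fun _ => hmem⟩⟩

theorem isClopen_positiveSet (h : IsYamabeSolution k β ρ gbar g) :
    IsClopen (positiveSet (M := M) k g) := by
  constructor
  · rw [← isOpen_compl_iff, isOpen_iff_mem_nhds]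
    intro x hx
    obtain ⟨T, hT, hTx⟩ := h.exists_continuousOn_mem_positiveSet_iff
      (IsManifold.chart_mem_maximalAtlas (I := 𝓡∂ (n + 1)) (n := ∞) x)
    have hm := mem_chart_source (EuclideanHalfSpace (n + 1)) x
    have hs := (chartAt (EuclideanHalfSpace (n + 1)) x).open_source.mem_nhds hm
    have h1 : ¬ ∀ j ≤ k, 0 ≤ T j x := fun h1 => hx ((hTx x hm).2.2 h1)
    push Not at h1
    obtain ⟨j, hj, hneg⟩ := h1
    filter_upwards [hs, ((hT j).continuousAt hs).eventually (gt_mem_nhds hneg)] with z hz hz'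
    exact fun hzp => absurd ((hTx z hz).2.1 hzp j hj) (not_le.2 hz')
  · rw [isOpen_iff_mem_nhds]
    intro x hx
    obtain ⟨T, hT, hTx⟩ := h.exists_continuousOn_mem_positiveSet_iff
      (IsManifold.chart_mem_maximalAtlas (I := 𝓡∂ (n + 1)) (n := ∞) x)
    have hm := mem_chart_source (EuclideanHalfSpace (n + 1)) x
    have hs := (chartAt (EuclideanHalfSpace (n + 1)) x).open_source.mem_nhds hm
    have h1 : ∀ j ∈ Iic k, ∀ᶠ z in 𝓝 x, 0 < T j z := fun j hj =>
      ((hT j).continuousAt hs).eventually (lt_mem_nhds ((hTx x hm).1.1 hx j hj))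
    filter_upwards [hs, (finite_Iic k).eventually_all.2 h1] with z hz hz'
    exact (hTx z hz).1.2 hz'

/-- `positiveSet` is clopen and contains the boundary, which meets every component. -/
theorem yamabe_pos (h : IsYamabeSolution k β ρ gbar g)
    (hbdry : ∀ x : M, (connectedComponent x ∩ (𝓡∂ (n + 1)).boundary M).Nonempty)
    (hx : x ∈ (𝓡∂ (n + 1)).interior M) {j : ℕ} (hj : j ≤ k) :
    0 < yamabe j g (fun _ => 0) 0 x := by
  obtain ⟨z, hz, hzb⟩ := hbdry x
  have hzp : z ∈ positiveSet k g := fun hz' => by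
    rw [← ModelWithCorners.compl_interior] at hzb
    exact absurd hz' hzb
  have h1 := h.isClopen_positiveSet.connectedComponent_subset hzp
  rw [← connectedComponent_eq hz] at h1
  exact h1 mem_connectedComponent hx j hj

end IsYamabeSolution

end Positivity

end ConformallyCompact

namespace ConformallyCompact

/-! ### Uniqueness by the maximum principle. -/

section MaximumPrinciple

open Filter Topology Matrix

variable {n : ℕ} {M : Type*} [TopologicalSpace M] [ChartedSpace (EuclideanHalfSpace (n + 1)) M]
  [IsManifold (𝓡∂ (n + 1)) ∞ M]
  {e : OpenPartialHomeomorph M (EuclideanHalfSpace (n + 1))} {x : M} {y : Coord n}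
  {k : ℕ} {β : ℝ} {ρ φ : M → ℝ}
  {gbar : Bundle.ContMDiffRiemannianMetric (𝓡∂ (n + 1)) 2 (EuclideanSpace ℝ (Fin (n + 1)))
      (fun x : M => TangentSpace (𝓡∂ (n + 1)) x)}
  {g : (x : M) → TangentSpace (𝓡∂ (n + 1)) x →L[ℝ] TangentSpace (𝓡∂ (n + 1)) x →L[ℝ] ℝ}

theorem IsDefiningFunction.contMDiffOn_neg_log (h : IsDefiningFunction (n := n) ρ) :
    ContMDiffOn (𝓡∂ (n + 1)) 𝓘(ℝ, ℝ) 2 (fun x => -Real.log (ρ x))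
      ((𝓡∂ (n + 1)).interior M) := by
  intro x hx
  have h1 : ContMDiffWithinAt (𝓡∂ (n + 1)) 𝓘(ℝ, ℝ) 2 ρ ((𝓡∂ (n + 1)).interior M) x :=
    (h.contMDiff.of_le (by norm_num)).contMDiffOn x hx
  have h2 : ContDiffAt ℝ 2 (fun t : ℝ => -Real.log t) (ρ x) :=
    (Real.contDiffAt_log.2 (h.pos x hx).ne').neg
  exact h2.contMDiffAt.comp_contMDiffWithinAt x h1

theorem IsConformallyCompact.linearization_eq_trace (h : IsConformallyCompact ρ gbar g)
    (hk1 : 1 ≤ k) (he : e ∈ IsManifold.maximalAtlas (𝓡∂ (n + 1)) ∞ M) (hx : x ∈ e.source)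
    (hxi : x ∈ (𝓡∂ (n + 1)).interior M)
    (hφ : ContMDiffOn (𝓡∂ (n + 1)) 𝓘(ℝ, ℝ) 2 φ ((𝓡∂ (n + 1)).interior M)) (C : ℝ) :
    linearization k g C φ x =
      (newton (k - 1) ((gramIn e g (e.extend (𝓡∂ (n + 1)) x))⁻¹ *
          (-schouten (gramIn e g) (e.extend (𝓡∂ (n + 1)) x))) *
        ((gramIn e g (e.extend (𝓡∂ (n + 1)) x))⁻¹ * hessian (gramIn e g)
          (φ ∘ (e.extend (𝓡∂ (n + 1))).symm) (e.extend (𝓡∂ (n + 1)) x))).trace -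
        2 * k * C * φ x :=
  (h.hasDerivAt_yamabe hk1 he hx hxi hφ C).deriv

namespace IsYamabeSolution

/-- The second order part of the linearization, applied to `-log ρ`, is bounded. -/
theorem exists_abs_linearization_neg_log_le [CompactSpace M] (h : IsYamabeSolution k β ρ gbar g) :
    ∃ C, ∀ x ∈ (𝓡∂ (n + 1)).interior M,
      |linearization k g 0 (fun x => -Real.log (ρ x)) x| ≤ C := by
  have key : ∃ C, ∀ x ∈ univ ∩ (𝓡∂ (n + 1)).interior M,
      |linearization k g 0 (fun x => -Real.log (ρ x)) x| ≤ C := by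
    -- Local bounds from the continuous extension in a chart, patched by compactness. The constant 0
    -- in `linearization` drops the zeroth order term, so that only the second order part is applied
    -- to -log ρ.
    refine isCompact_univ.induction_on (p := fun s => ∃ C, ∀ x ∈ s ∩ (𝓡∂ (n + 1)).interior M,
      |linearization k g 0 (fun x => -Real.log (ρ x)) x| ≤ C) ⟨0, by simp⟩ ?_ ?_ ?_
    · rintro s t hst ⟨C, hC⟩
      exact ⟨C, fun x hx => hC x ⟨hst hx.1, hx.2⟩⟩
    · rintro s t ⟨C, hC⟩ ⟨D, hD⟩
      exact ⟨max C D, fun x hx => hx.1.elim (fun hs => (hC x ⟨hs, hx.2⟩).trans (le_max_left _ _))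
        fun ht => (hD x ⟨ht, hx.2⟩).trans (le_max_right _ _)⟩
    · intro x _
      set e := chartAt (EuclideanHalfSpace (n + 1)) x
      have he : e ∈ IsManifold.maximalAtlas (𝓡∂ (n + 1)) ∞ M := IsManifold.chart_mem_maximalAtlas x
      have hm : x ∈ e.source := mem_chart_source (EuclideanHalfSpace (n + 1)) x
      have hs := e.open_source.mem_nhds hm
      obtain ⟨F, hF, hFeq⟩ := (h.isSolutionChart he).extendsOn_trace_neg_log h.two_le h.one_le
        h.le h.beta_pos
      have hc : ContinuousOn (fun z => |F (e.extend (𝓡∂ (n + 1)) z)|) e.source :=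
        (hF.continuousOn.comp (e.extend_source (I := 𝓡∂ (n + 1)) ▸ e.continuousOn_extend)
          fun z hz => extend_mem hz).abs
      have hlt := (hc.continuousAt hs).eventually
        (gt_mem_nhds (lt_add_one |F (e.extend (𝓡∂ (n + 1)) x)|))
      refine ⟨_, mem_nhdsWithin_of_mem_nhds (hlt.and hs), |F (e.extend (𝓡∂ (n + 1)) x)| + 1,
        fun z hz => ?_⟩
      obtain ⟨⟨hz1, hz2⟩, hzi⟩ := hz
      have h1 := hFeq (extend_mem_interior he hz2 hzi)
      rw [h.linearization_eq_trace h.one_le he hz2 hzi h.isDefiningFunction.contMDiffOn_neg_log]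
      simp only [mul_zero, zero_mul, sub_zero]
      refine le_trans (le_of_eq ?_) hz1.le
      exact congrArg abs h1
  simpa using key

/-- Maximum principle at an interior maximum of `φ - c w`. -/
theorem le_of_forall_le (h : IsYamabeSolution k β ρ gbar g)
    (hbdry : ∀ x : M, (connectedComponent x ∩ (𝓡∂ (n + 1)).boundary M).Nonempty)
    (hφ : ContMDiffOn (𝓡∂ (n + 1)) 𝓘(ℝ, ℝ) 2 φ ((𝓡∂ (n + 1)).interior M)) {w : M → ℝ}
    (hw : ContMDiffOn (𝓡∂ (n + 1)) 𝓘(ℝ, ℝ) 2 w ((𝓡∂ (n + 1)).interior M)) {c : ℝ}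
    (hx : x ∈ (𝓡∂ (n + 1)).interior M)
    (hmax : ∀ z ∈ (𝓡∂ (n + 1)).interior M, φ z - c * w z ≤ φ x - c * w x) :
    linearization k g 0 φ x ≤ c * linearization k g 0 w x := by
  set e := chartAt (EuclideanHalfSpace (n + 1)) x
  have he : e ∈ IsManifold.maximalAtlas (𝓡∂ (n + 1)) ∞ M := IsManifold.chart_mem_maximalAtlas x
  have hm : x ∈ e.source := mem_chart_source (EuclideanHalfSpace (n + 1)) x
  have hy := extend_mem_interior he hm hx
  have hG := h.isMetricAt he hy
  have hφ' := contDiffAt_comp_chart_symm hφ he hy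
  have hw' := contDiffAt_comp_chart_symm hw he hy
  rw [h.linearization_eq_trace h.one_le he hm hx hφ, h.linearization_eq_trace h.one_le he hm hx hw]
  have hloc : IsLocalMax (fun z => (φ ∘ (e.extend (𝓡∂ (n + 1))).symm) z -
      c * (w ∘ (e.extend (𝓡∂ (n + 1))).symm) z) (e.extend (𝓡∂ (n + 1)) x) := by
    filter_upwards [(isOpen_chartDomain.inter isOpen_openHalfSpace).mem_nhds hy] with z hz
    simp only [Function.comp, e.extend_left_inv hm]
    exact hmax _ (extend_symm_mem_interior he hz)
  have hpsd := posSemidef_neg_hessian_of_isLocalMax hG (hφ'.sub (contDiffAt_const.mul hw')) hloc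
  -- Nonnegativity of T_{k-1} requires positivity up to σ_k, one index more.
  have hpos : ∀ j ≤ (k - 1) + 1, 0 < sigma j ((gramIn e g (e.extend (𝓡∂ (n + 1)) x))⁻¹ *
      (-schouten (gramIn e g) (e.extend (𝓡∂ (n + 1)) x))) := by
    intro j hj
    have := h.yamabe_pos hbdry hx (j := j) (by have := h.one_le; omega)
    rwa [h.yamabe_zero_eq he hm hx, sub_zero] at this
  have h1 := trace_newton_mul_nonneg hG.posDef_self hG.schouten_isSymm.neg
    (by have := h.one_le; have := h.le; omega) hpos hpsd
  rw [hessian_sub_const_mul hφ' hw'] at h1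
  simp only [mul_neg, mul_sub, mul_smul_comm, trace_neg, trace_sub, trace_smul, smul_eq_mul] at h1 ⊢
  linarith

/-- The function f = φ + ε log ρ tends to -∞ at the boundary, so it has a maximum z inside. There
2kβφ(z), the second order part of the linearization at φ, is at most ε times the bounded value at
-log ρ. Comparing f(x) with f(z) bounds φ(x) by a multiple of ε. -/
theorem nonpos_of_linearization_eq_zero [CompactSpace M] (h : IsYamabeSolution k β ρ gbar g)
    (hbdry : ∀ x : M, (connectedComponent x ∩ (𝓡∂ (n + 1)).boundary M).Nonempty)
    (hφ : ContMDiffOn (𝓡∂ (n + 1)) 𝓘(ℝ, ℝ) 2 φ ((𝓡∂ (n + 1)).interior M))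
    (h0 : ∀ x ∈ (𝓡∂ (n + 1)).interior M, linearization k g β φ x = 0) {B : ℝ}
    (hB : ∀ x ∈ (𝓡∂ (n + 1)).interior M, φ x ≤ B) (hx : x ∈ (𝓡∂ (n + 1)).interior M) :
    φ x ≤ 0 := by
  have hρ := h.isDefiningFunction
  have hρc : Continuous ρ := hρ.contMDiff.continuous
  obtain ⟨C, hC⟩ := h.exists_abs_linearization_neg_log_le
  obtain ⟨L, hL⟩ : ∃ L, ∀ z ∈ (𝓡∂ (n + 1)).interior M, Real.log (ρ z) ≤ L := by
    obtain ⟨R, hR⟩ := (isCompact_univ.image hρc).bddAbove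
    exact ⟨Real.log R, fun z hz => Real.log_le_log (hρ.pos z hz) (hR ⟨z, mem_univ z, rfl⟩)⟩
  have hkβ : 0 < 2 * k * β := by
    have : (0 : ℝ) < k := by exact_mod_cast h.one_le
    have := h.beta_pos
    positivity
  have key : ∀ ε > 0, φ x ≤ ε * (C / (2 * k * β) + L - Real.log (ρ x)) := by
    intro ε hε
    set f : M → ℝ := fun z => φ z - ε * -Real.log (ρ z) with hf
    -- Where ρ < δ one has f ≤ B + ε log ρ < f(x), so the maximum is sought on the compact set ρ ≥
    -- δ, which avoids the boundary and contains x.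
    set δ := Real.exp ((f x - B) / ε) with hδ
    have hlow : ∀ z ∈ (𝓡∂ (n + 1)).interior M, ρ z < δ → f z < f x := by
      intro z hz hzδ
      have h1 : Real.log (ρ z) < (f x - B) / ε := by
        rw [← Real.log_exp ((f x - B) / ε)]
        exact Real.log_lt_log (hρ.pos z hz) hzδ
      rw [lt_div_iff₀ hε] at h1
      have h2 := hB z hz
      have h3 : f z = φ z + Real.log (ρ z) * ε := by rw [hf]; ring
      linarith
    set K : Set M := {z | δ ≤ ρ z} with hK
    have hKi : K ⊆ (𝓡∂ (n + 1)).interior M := by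
      intro z hz
      by_contra hzi
      have hzb : z ∈ (𝓡∂ (n + 1)).boundary M := by
        rw [← ModelWithCorners.compl_interior]
        exact hzi
      have h1 : δ ≤ ρ z := hz
      rw [hρ.eq_zero z hzb] at h1
      exact absurd h1 (not_le.2 (Real.exp_pos _))
    have hxK : x ∈ K := by
      by_contra hxK
      exact lt_irrefl _ (hlow x hx (not_le.1 hxK))
    have hfc : ContinuousOn f K :=
      (hφ.continuousOn.sub (continuousOn_const.mul hρ.contMDiffOn_neg_log.continuousOn)).mono hKi
    obtain ⟨z, hzK, hz⟩ := (isClosed_le continuous_const hρc).isCompact.exists_isMaxOn ⟨x, hxK⟩ hfc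
    have hzi := hKi hzK
    have hmax : ∀ z' ∈ (𝓡∂ (n + 1)).interior M, f z' ≤ f z := by
      intro z' hz'
      by_cases hz'K : z' ∈ K
      · exact hz hz'K
      · exact (hlow z' hz' (not_le.1 hz'K)).le.trans (hz hxK)
    have h1 := h.le_of_forall_le hbdry hφ hρ.contMDiffOn_neg_log hzi hmax
    have hm := mem_chart_source (EuclideanHalfSpace (n + 1)) z
    have he := IsManifold.chart_mem_maximalAtlas (I := 𝓡∂ (n + 1)) (n := ∞) z
    have h2 : linearization k g 0 φ z = 2 * k * β * φ z := by
      have h3 := h0 z hzi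
      rw [h.linearization_eq_trace h.one_le he hm hzi hφ] at h3 ⊢
      linarith
    have h4 := (abs_le.1 (hC z hzi)).2
    have h5 : φ z ≤ ε * (C / (2 * k * β)) := by
      rw [← mul_div_assoc, le_div_iff₀ hkβ]
      have := mul_le_mul_of_nonneg_left h4 hε.le
      linarith
    have h6 : φ x - ε * -Real.log (ρ x) ≤ φ z - ε * -Real.log (ρ z) := hmax x hx
    have h7 := mul_le_mul_of_nonneg_left (hL z hzi) hε.le
    linarith
  refine le_of_forall_pos_le_add fun η hη => ?_
  set D := C / (2 * k * β) + L - Real.log (ρ x) with hD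
  have hpos : 0 < |D| + 1 := by positivity
  -- This ε makes εD ≤ η without knowing the sign of D.
  have h1 := key (η / (|D| + 1)) (div_pos hη hpos)
  have h2 : η / (|D| + 1) * D ≤ η := by
    rw [div_mul_eq_mul_div, div_le_iff₀ hpos]
    exact mul_le_mul_of_nonneg_left ((le_abs_self D).trans (by linarith)) hη.le
  linarith

/-- The curve for -φ is the curve for φ run backwards in ε. This lets the one-sided estimate be
applied to -φ. -/
theorem linearization_neg (h : IsYamabeSolution k β ρ gbar g)
    (hφ : ContMDiffOn (𝓡∂ (n + 1)) 𝓘(ℝ, ℝ) 2 φ ((𝓡∂ (n + 1)).interior M))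
    (hx : x ∈ (𝓡∂ (n + 1)).interior M) (C : ℝ) :
    linearization k g C (fun z => -φ z) x = -linearization k g C φ x := by
  have hm := mem_chart_source (EuclideanHalfSpace (n + 1)) x
  have he := IsManifold.chart_mem_maximalAtlas (I := 𝓡∂ (n + 1)) (n := ∞) x
  have h1 := h.hasDerivAt_yamabe h.one_le he hm hx hφ C
  have h2 : HasDerivAt (fun ε : ℝ => yamabe k g (fun z => ε * -φ z) C x)
      (-linearization k g C φ x) 0 := by
    rw [linearization, h1.deriv]
    rw [← neg_zero] at h1
    have h3 := h1.scomp (0 : ℝ) (hasDerivAt_neg (0 : ℝ))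
    simpa [Function.comp_def] using h3
  exact h2.deriv

theorem eq_zero_of_linearization_eq_zero [CompactSpace M] (h : IsYamabeSolution k β ρ gbar g)
    (hbdry : ∀ x : M, (connectedComponent x ∩ (𝓡∂ (n + 1)).boundary M).Nonempty)
    (hφ : ContMDiffOn (𝓡∂ (n + 1)) 𝓘(ℝ, ℝ) 2 φ ((𝓡∂ (n + 1)).interior M))
    (h0 : ∀ x ∈ (𝓡∂ (n + 1)).interior M, linearization k g β φ x = 0) {B : ℝ}
    (hB : ∀ x ∈ (𝓡∂ (n + 1)).interior M, |φ x| ≤ B) (hx : x ∈ (𝓡∂ (n + 1)).interior M) :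
    φ x = 0 := by
  refine le_antisymm (h.nonpos_of_linearization_eq_zero hbdry hφ h0
    (fun z hz => (abs_le.1 (hB z hz)).2) hx) ?_
  have h1 := h.nonpos_of_linearization_eq_zero (φ := fun z => -φ z) hbdry hφ.neg
    (fun z hz => by rw [h.linearization_neg hφ hz, h0 z hz, neg_zero])
    (fun z hz => neg_le.1 (abs_le.1 (hB z hz)).1) hx
  exact neg_nonpos.1 h1

end IsYamabeSolution

end MaximumPrinciple

end ConformallyCompact

end

theorem proposition2 {n : ℕ} (hn : 2 ≤ n) {M : Type*} [TopologicalSpace M] [T2Space M]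
    [CompactSpace M] [ChartedSpace (EuclideanHalfSpace (n + 1)) M]
    [IsManifold (𝓡∂ (n + 1)) ∞ M]
    (hbdry : ∀ x : M, (connectedComponent x ∩ (𝓡∂ (n + 1)).boundary M).Nonempty)
    (ρ : M → ℝ) (hρ : ConformallyCompact.IsDefiningFunction (n := n) ρ)
    (gbar : Bundle.ContMDiffRiemannianMetric (𝓡∂ (n + 1)) 2 (EuclideanSpace ℝ (Fin (n + 1)))
      (fun x : M => TangentSpace (𝓡∂ (n + 1)) x))
    (g : (x : M) → TangentSpace (𝓡∂ (n + 1)) x →L[ℝ] TangentSpace (𝓡∂ (n + 1)) x →L[ℝ] ℝ)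
    (hg : ∀ x ∈ (𝓡∂ (n + 1)).interior M, g x = ((ρ x) ^ 2)⁻¹ • gbar.inner x)
    (k : ℕ) (hk1 : 1 ≤ k) (hk2 : k ≤ n + 1) (β : ℝ) (hβ : 0 < β)
    (hsol : ∀ x ∈ (𝓡∂ (n + 1)).interior M, ConformallyCompact.yamabe k g (fun _ => 0) β x = 0) :
    (∃ E : (M → ℝ) → M → ℝ,
      ConformallyCompact.IsBoundedSecondOrder (n := n) E ∧
      (ContMDiff (𝓡∂ (n + 1)) 𝓘(ℝ, ℝ) ∞ ρ → ConformallyCompact.IsSmoothMetric gbar →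
        ConformallyCompact.IsSmoothSecondOrder (n := n) E) ∧
      ∀ φ : M → ℝ, ContMDiffOn (𝓡∂ (n + 1)) 𝓘(ℝ, ℝ) 2 φ ((𝓡∂ (n + 1)).interior M) →
        ∀ x ∈ (𝓡∂ (n + 1)).interior M,
          DifferentiableAt ℝ
            (fun ε : ℝ => ConformallyCompact.yamabe k g (fun z => ε * φ z) β x) 0 ∧
          ConformallyCompact.linearization k g β φ x =
            ConformallyCompact.cConst k n *
                (β / ConformallyCompact.betaHyp k n) ^ (((k : ℝ) - 1) / k) *
                ConformallyCompact.laplacian g φ x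
              - 2 * k * β * φ x + ρ x ^ 3 * E φ x) ∧
    (∀ φ : M → ℝ, ContMDiffOn (𝓡∂ (n + 1)) 𝓘(ℝ, ℝ) 2 φ ((𝓡∂ (n + 1)).interior M) →
      (∀ x ∈ (𝓡∂ (n + 1)).interior M, ConformallyCompact.linearization k g β φ x = 0) →
      (∃ B : ℝ, ∀ x ∈ (𝓡∂ (n + 1)).interior M, |φ x| ≤ B) →
      ∀ x ∈ (𝓡∂ (n + 1)).interior M, φ x = 0) := by
  have h : ConformallyCompact.IsYamabeSolution k β ρ gbar g :=
    { isDefiningFunction := hρ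
      eq_smul := hg
      two_le := hn
      one_le := hk1
      le := hk2
      beta_pos := hβ
      yamabe_eq_zero := hsol }
  refine ⟨⟨ConformallyCompact.IsYamabeSolution.remainder k β ρ g,
    h.isBoundedSecondOrder_remainder, h.isSmoothSecondOrder_remainder, fun φ hφ x hx =>
      ⟨?_, h.linearization_eq hx⟩⟩, fun φ hφ h0 ⟨_, hB⟩ x hx =>
      h.eq_zero_of_linearization_eq_zero hbdry hφ h0 hB hx⟩
  exact (h.hasDerivAt_yamabe hk1 (IsManifold.chart_mem_maximalAtlas x)
    (mem_chart_source (EuclideanHalfSpace (n + 1)) x) hx hφ β).differentiableAt
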